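/- Let $K$ be an algebraically closed field. For $n\ge 1$ let $W=S_n$ be the symmetric group with simple transpositions $S=\{s_1,\dots,s_{n-1}\}$, $s_i=(i\ i+1)$, and for $I\subseteq S$ let $W_I=\langle I\rangle$. Let $B$ be the group of invertible upper triangular matrices. The Bruhat–Chevalley order on $W$ is $v\le w\iff BvB\subseteq\overline{BwB}$ (Zariski closure, permutations viewed as permutation matrices over $K$), and $W_I\backslash W/W_I$ is ordered by comparing the maximal elements of double cosets. The rook monoid $R_r$ is the set of injective partial transformations of $\{1,\dots,r\}$, viewed as $r\times r$ $0/1$ matrices with at most one $1$ in each row and column, with the Bruhat–Chevalley–Renner order $\sigma\le\tau\iff B\sigma B\subseteq\overline{B\tau B}$ (closure in the space of $r\times r$ matrices over $K$). Let $M$ be a reductive monoid over $K$ with unit group $G\cong \mathbf{GL}_n$, i.e. an irreducible linear algebraic monoid whose group of units is isomorphic to $\mathbf{GL}_n$ as an algebraic group; let $T\subset B\subset G$ correspond to the diagonal and the upper triangular matrices, $N=N_G(T)$, so that $W=N/T$, and let $R=\overline{N}/T$ be its Renner monoid, with $x\le y\iff BxB\subseteq\overline{ByB}$. Let $\Lambda=\{e\in\overline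 T: e^2=e,\ Be=eBe\}$ be the cross-section lattice, ordered by $e\le f\iff e=fe=ef$, and $\lambda(e)=\{s\in S: es=se \text{ in } R\}$. The monoid $M$ is dual canonical if $\Lambda\setminus\{1\}$ has a unique maximal element $e_{\max}$ and $\lambda(e_{\max})=\emptyset$. The Putcha poset $\mathcal C$ is the quotient of $\{x\in R: Bx\subseteq xB\}$ by conjugation by $W$, ordered by $[x]\le[y]\iff wxw^{-1}\le y$ for some $w\in W$; $\mathcal C(e)\subseteq\mathcal C$ consists of the classes of elements of $WeW$. Theorem. Let $I=\{s_1,\dots,s_k\}\subseteq S$, and suppose that one of the following holds: (1) $n=2m$, $k=m-1$ and $r=m$ with $m\ge1$; (2) $n=2m+1$, $k=m$ and $r=m$ with $m\ge0$; (3) $\lfloor n/2\rfloor\le k\le n-1$ and $r=n-k-1$. Then the opposite of the poset $W_I\backslash W/W_I$ is isomorphic to $(R_r,\le)$. Moreover, for every dual canonical monoid $M$ with unit group $\mathbf{GL}_n$ there is a unique $e_I\in\Lambda\setminus\{1\}$ with $\lambda(e_I)=I$, and the Putcha subposet $\mathcal C(e_I)$ is isomorphic to $(R_r,\le)$. -/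

import Mathlib

noncomputable section

namespace RookPutcha

open Matrix

/-! ### Zariski topology on matrix spaces -/

/-- The value of a polynomial in the matrix entries at a square matrix. -/
def evalMat {K : Type*} [Field K] {N : ℕ} (p : MvPolynomial (Fin N × Fin N) K)
    (x : Matrix (Fin N) (Fin N) K) : K :=
  MvPolynomial.eval (fun ij => x ij.1 ij.2) p

/-- The Zariski closure of a set of `N × N` matrices inside the affine space of all matrices. -/
def zariskiClosure {K : Type*} [Field K] {N : ℕ} (X : Set (Matrix (Fin N) (Fin N) K)) :
    Set (Matrix (Fin N) (Fin N) K) :=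
  {y | ∀ p : MvPolynomial (Fin N × Fin N) K, (∀ x ∈ X, evalMat p x = 0) → evalMat p y = 0}

/-- The double orbit `B x B`. -/
def orbitBB {K : Type*} [Field K] {N : ℕ} (B : Set (Matrix (Fin N) (Fin N) K))
    (x : Matrix (Fin N) (Fin N) K) : Set (Matrix (Fin N) (Fin N) K) :=
  {z | ∃ b ∈ B, ∃ b' ∈ B, z = b * x * b'}

/-- The Bruhat–Chevalley–Renner relation: `B x B` lies in the Zariski closure of `B y B`. -/
def bcrLE {K : Type*} [Field K] {N : ℕ} (B : Set (Matrix (Fin N) (Fin N) K))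
    (x y : Matrix (Fin N) (Fin N) K) : Prop :=
  orbitBB B x ⊆ zariskiClosure (orbitBB B y)

/-! ### `GL_n`, its standard torus and Borel subgroup -/

/-- The maximal torus of invertible diagonal matrices. -/
def torus (K : Type*) [Field K] (n : ℕ) : Set (GL (Fin n) K) :=
  {g | ∀ i j, i ≠ j → (g : Matrix (Fin n) (Fin n) K) i j = 0}

/-- The Borel subgroup of invertible upper triangular matrices. -/
def borel (K : Type*) [Field K] (n : ℕ) : Set (GL (Fin n) K) :=
  {g | ∀ i j, j < i → (g : Matrix (Fin n) (Fin n) K) i j = 0}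

/-- The normalizer of the torus in `GL_n`. -/
def torusNormalizer (K : Type*) [Field K] (n : ℕ) : Subgroup (GL (Fin n) K) where
  carrier := {g | ∀ t, t ∈ torus K n ↔ g * t * g⁻¹ ∈ torus K n}
  one_mem' := by intro t; simp
  mul_mem' := by
    intro a b ha hb t
    rw [hb t, ha (b * t * b⁻¹)]
    simp [mul_assoc]
  inv_mem' := by
    intro a ha t
    rw [ha (a⁻¹ * t * a⁻¹⁻¹)]
    simp [mul_assoc]

/-! ### The rook monoid -/

/-- The `0/1` matrix of an injective partial transformation: column `j` has its `1`
in row `σ j` if `σ j` is defined, and is zero otherwise. -/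
def rookMatrix (K : Type*) [Field K] {m : ℕ} (σ : Fin m ≃. Fin m) :
    Matrix (Fin m) (Fin m) K :=
  Matrix.of fun i j => if σ j = some i then 1 else 0

/-- The standard Borel subgroup of `GL_m`, as a set of matrices. -/
def borelMat (K : Type*) [Field K] (m : ℕ) : Set (Matrix (Fin m) (Fin m) K) :=
  (fun g : GL (Fin m) K => (g : Matrix (Fin m) (Fin m) K)) '' borel K m

/-- The rook monoid `R_m` of injective partial transformations of an `m`-element set. It is a
type synonym, since partial equivalences already carry the (different) order by extension.
The field is the one over which the Bruhat–Chevalley–Renner order is formed. -/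
@[nolint unusedArguments]
def RookMonoid (K : Type*) [Field K] (m : ℕ) : Type := Fin m ≃. Fin m

/-- The Bruhat–Chevalley–Renner order on `R_m`, the Renner monoid of the monoid of all
`m × m` matrices. -/
instance (K : Type*) [Field K] (m : ℕ) : LE (RookMonoid K m) where
  le σ τ := bcrLE (borelMat K m) (rookMatrix K σ) (rookMatrix K τ)

/-! ### The symmetric group and its double cosets -/

/-- The Bruhat–Chevalley order on `S_n`: `B v B` lies in the closure of `B w B`. -/
def bruhatLE (K : Type*) [Field K] {n : ℕ} (v w : Equiv.Perm (Fin n)) : Prop :=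
  bcrLE (borelMat K n) (rookMatrix K v.toPEquiv) (rookMatrix K w.toPEquiv)

/-- The set `{s_1, …, s_k}` of simple transpositions of `S_n` (those among them that exist);
in zero-based notation `s_{i+1}` exchanges `i` and `i + 1`. -/
def firstSimple (n k : ℕ) : Set (Equiv.Perm (Fin n)) :=
  {s | ∃ (i : ℕ) (h : i + 1 < n), i < k ∧ s = Equiv.swap ⟨i, i.lt_succ_self.trans h⟩ ⟨i + 1, h⟩}

/-- The set `S = {s_1, …, s_{n-1}}` of all simple transpositions of `S_n`. -/
def simpleReflections (n : ℕ) : Set (Equiv.Perm (Fin n)) := firstSimple n (n - 1)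

/-- The parabolic subgroup `W_I` generated by `I`. -/
def parabolic {n : ℕ} (I : Set (Equiv.Perm (Fin n))) : Subgroup (Equiv.Perm (Fin n)) :=
  Subgroup.closure I

/-- The set `W_I \ W / W_I` of double cosets, `W = S_n`. -/
@[nolint unusedArguments]
def DoubleCosets (K : Type*) [Field K] {n : ℕ} (I : Set (Equiv.Perm (Fin n))) : Type :=
  DoubleCoset.Quotient (parabolic I : Set (Equiv.Perm (Fin n))) (parabolic I)

/-- `w` is the maximal element of the double coset `D` for the Bruhat–Chevalley order. -/
def IsMaxRep (K : Type*) [Field K] {n : ℕ} {I : Set (Equiv.Perm (Fin n))}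
    (D : DoubleCosets K I) (w : Equiv.Perm (Fin n)) : Prop :=
  DoubleCoset.mk (parabolic I) (parabolic I) w = D ∧
    ∀ v, DoubleCoset.mk (parabolic I) (parabolic I) v = D → bruhatLE K v w

/-- Double cosets are ordered by comparing their maximal elements. -/
instance (K : Type*) [Field K] {n : ℕ} (I : Set (Equiv.Perm (Fin n))) :
    LE (DoubleCosets K I) where
  le D D' := ∃ w w', IsMaxRep K D w ∧ IsMaxRep K D' w' ∧ bruhatLE K w w'

/-! ### Reductive monoids with unit group `GL_n` -/

/-- A reductive monoid with unit group `GL_n`: an irreducible linear algebraic monoid, that is, an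
irreducible Zariski closed submonoid of the `N × N` matrices, together with an isomorphism of
algebraic groups of `GL_n` onto its group of units. -/
structure ReductiveMonoid (K : Type*) [Field K] (n N : ℕ) where
  /-- the underlying monoid -/
  carrier : Submonoid (Matrix (Fin N) (Fin N) K)
  isClosed : zariskiClosure (carrier : Set (Matrix (Fin N) (Fin N) K)) ⊆ carrier
  irreducible : ∀ p q : MvPolynomial (Fin N × Fin N) K,
    (∀ x ∈ carrier, evalMat (p * q) x = 0) →
      (∀ x ∈ carrier, evalMat p x = 0) ∨ (∀ x ∈ carrier, evalMat q x = 0)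
  /-- the identification of `GL_n` with the group of units -/
  unitIso : GL (Fin n) K ≃* carrierˣ
  /-- the entries of the image of `g` are polynomials in the entries of `g` and `1 / det g` -/
  regular : ∀ i j, ∃ (p : MvPolynomial (Fin n × Fin n) K) (d : ℕ), ∀ g : GL (Fin n) K,
    ((unitIso g : carrier) : Matrix (Fin N) (Fin N) K) i j =
      evalMat p (g : Matrix (Fin n) (Fin n) K) * ((g : Matrix (Fin n) (Fin n) K).det)⁻¹ ^ d
  /-- the inverse map is regular as well -/
  regular_symm : ∀ i j, ∃ (p : MvPolynomial (Fin N × Fin N) K) (d : ℕ), ∀ g : GL (Fin n) K,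
    (g : Matrix (Fin n) (Fin n) K) i j =
      evalMat p ((unitIso g : carrier) : Matrix (Fin N) (Fin N) K) *
        (((unitIso g : carrier) : Matrix (Fin N) (Fin N) K).det)⁻¹ ^ d

namespace ReductiveMonoid

variable {K : Type*} [Field K] {n N : ℕ} (M : ReductiveMonoid K n N)

/-- The embedding of the unit group `GL_n` into the matrices. -/
def ι : GL (Fin n) K →* Matrix (Fin N) (Fin N) K :=
  M.carrier.subtype.comp ((Units.coeHom M.carrier).comp M.unitIso.toMonoidHom)

/-- The maximal torus `T` of the unit group. -/
def T : Set (Matrix (Fin N) (Fin N) K) := M.ι '' torus K n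

/-- The Borel subgroup `B` of the unit group. -/
def B : Set (Matrix (Fin N) (Fin N) K) := M.ι '' borel K n

/-- The closure of the normalizer of `T`. The Renner monoid is `R = (closure of N(T)) / T`;
an element of `R` is the class `x T` of some `x` in this set. -/
def closureNT : Set (Matrix (Fin N) (Fin N) K) :=
  zariskiClosure (M.ι '' (torusNormalizer K n : Set (GL (Fin n) K)))

/-- The cross-section lattice `Λ = {e ∈ E(closure of T) : B e = e B e}`. -/
def Λ : Set (Matrix (Fin N) (Fin N) K) :=
  {e | e ∈ zariskiClosure M.T ∧ e * e = e ∧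
    (fun b => b * e) '' M.B = (fun b => e * b * e) '' M.B}

/-- The type map `λ(e) = {s ∈ S : e s = s e}`, the equation being one in `R`, that is, modulo `T`;
the simple reflection `s` is represented by its permutation matrix. -/
def typeMap (e : Matrix (Fin N) (Fin N) K) : Set (Equiv.Perm (Fin n)) :=
  {s | s ∈ simpleReflections n ∧ ∃ g : GL (Fin n) K,
    (g : Matrix (Fin n) (Fin n) K) = rookMatrix K s.toPEquiv ∧ ∃ t ∈ M.T, M.ι g * e = e * M.ι g * t}

/-- `e` is a maximal element of `Λ \ {1}` for the order `e ≤ f ↔ e = f e = e f`. -/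
def IsMaxProper (e : Matrix (Fin N) (Fin N) K) : Prop :=
  e ∈ M.Λ ∧ e ≠ 1 ∧ ∀ f ∈ M.Λ, f ≠ 1 → e = f * e → e = e * f → f = e

/-- `M` is a dual canonical monoid: `Λ \ {1}` has a unique maximal element, and its type is
empty. -/
def IsDualCanonical : Prop :=
  ∃ e, (∀ f, M.IsMaxProper f ↔ f = e) ∧ M.typeMap e = ∅

/-- Representatives of the elements of the Gauss–Jordan monoid `{x ∈ R : B x ⊆ x B}`. -/
def GJ : Type _ :=
  {x : Matrix (Fin N) (Fin N) K // x ∈ M.closureNT ∧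
    (fun b => b * x) '' M.B ⊆ (fun b => x * b) '' M.B}

/-- Conjugacy under `W = N(T) / T` of the classes `x T` and `y T` in the Renner monoid. -/
def conjSetoid : Setoid M.GJ where
  r x y := ∃ w ∈ torusNormalizer K n, ∃ t ∈ torus K n,
    y.1 = M.ι w * x.1 * M.ι w⁻¹ * M.ι t
  iseqv := by
    have hone : (1 : GL (Fin n) K) ∈ torus K n := by
      intro i j h
      simp [Matrix.one_apply_ne h]
    have hmul : ∀ s ∈ torus K n, ∀ t ∈ torus K n, s * t ∈ torus K n := by
      intro s hs t ht i j h
      rw [Units.val_mul, Matrix.mul_apply]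
      refine Finset.sum_eq_zero fun l _ => ?_
      by_cases hl : i = l
      · subst hl; rw [ht _ _ h, mul_zero]
      · rw [hs _ _ hl, zero_mul]
    have hinv : ∀ t ∈ torus K n, t⁻¹ ∈ torus K n := by
      intro t ht i j h
      have e1 : (t : Matrix (Fin n) (Fin n) K) * ((t⁻¹ : GL (Fin n) K) : Matrix _ _ K) = 1 := by
        rw [← Units.val_mul, mul_inv_cancel, Units.val_one]
      have key : ∀ j', (t : Matrix (Fin n) (Fin n) K) i i *
          ((t⁻¹ : GL (Fin n) K) : Matrix _ _ K) i j' = (1 : Matrix (Fin n) (Fin n) K) i j' := by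
        intro j'
        rw [← e1, Matrix.mul_apply, Finset.sum_eq_single i]
        · intro l _ hl
          rw [ht i l (Ne.symm hl), zero_mul]
        · intro hi; exact absurd (Finset.mem_univ i) hi
      have h1 := key i
      have h2 := key j
      rw [Matrix.one_apply_eq] at h1
      rw [Matrix.one_apply_ne h] at h2
      rcases mul_eq_zero.mp h2 with h3 | h3
      · rw [h3, zero_mul] at h1; exact absurd h1 zero_ne_one
      · exact h3
    refine ⟨fun x => ⟨1, one_mem _, 1, hone, by simp⟩, ?_, ?_⟩
    · rintro x y ⟨w, hw, t, ht, h⟩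
      refine ⟨w⁻¹, inv_mem hw, w⁻¹ * t⁻¹ * w⁻¹⁻¹, (inv_mem hw t⁻¹).1 (hinv t ht), ?_⟩
      have e1 : M.ι w⁻¹ * y.1 * M.ι w⁻¹⁻¹ * M.ι (w⁻¹ * t⁻¹ * w⁻¹⁻¹) =
          M.ι (w⁻¹ * w) * x.1 * M.ι (w⁻¹ * t * w⁻¹⁻¹ * (w⁻¹ * t⁻¹ * w⁻¹⁻¹)) := by
        rw [h]; simp only [map_mul, mul_assoc]
      have e2 : w⁻¹ * t * w⁻¹⁻¹ * (w⁻¹ * t⁻¹ * w⁻¹⁻¹) = 1 := by group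
      rw [e1, e2]; simp
    · rintro x y z ⟨w, hw, t, ht, h⟩ ⟨v, hv, s, hs, h'⟩
      refine ⟨v * w, mul_mem hv hw, v * t * v⁻¹ * s, hmul _ ((hv t).1 ht) _ hs, ?_⟩
      have e1 : M.ι (v * w) * x.1 * M.ι (v * w)⁻¹ * M.ι (v * t * v⁻¹ * s) =
          M.ι v * (M.ι w * x.1 * (M.ι (w⁻¹ * (v⁻¹ * v) * t))) * M.ι v⁻¹ * M.ι s := by
        simp only [map_mul, mul_assoc, _root_.mul_inv_rev]
      rw [e1, h', h]
      simp [mul_assoc]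

/-- The Putcha poset `C = GJ / ∼`. -/
def PutchaPoset : Type _ := Quotient M.conjSetoid

/-- The Putcha order: `[x] ≤ [y]` if `w x w⁻¹ ≤ y` in the Bruhat–Chevalley–Renner order of `R`
for some `w ∈ W`. -/
instance : LE M.PutchaPoset where
  le c d := ∃ x y : M.GJ, Quotient.mk M.conjSetoid x = c ∧ Quotient.mk M.conjSetoid y = d ∧
    ∃ w ∈ torusNormalizer K n, bcrLE M.B (M.ι w * x.1 * M.ι w⁻¹) y.1

/-- The subposet `C(e)` of the classes that come from the double coset `W e W`. -/
abbrev PutchaSubposet (e : Matrix (Fin N) (Fin N) K) : Type _ :=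
  {c : M.PutchaPoset // ∃ x : M.GJ, Quotient.mk M.conjSetoid x = c ∧
    ∃ a ∈ torusNormalizer K n, ∃ b ∈ torusNormalizer K n, x.1 = M.ι a * e * M.ι b}

end ReductiveMonoid

end RookPutcha

end

noncomputable section

namespace RookPutcha

open Matrix

/-! ### Polynomial functions and Zariski closures -/

section Zariski

variable {K : Type*} [Field K] {N : ℕ}

/-! Put `q = k + 1`. Each of the three cases says that `n = q + r` with `r ≤ q`, and `W_I` consists
of the permutations that fix every zero-based index `≥ q`.

Both orders are governed by ranks of lower left corners. Along a closure these ranks can only drop,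
because minors vanish on closed sets. Conversely, if all corner ranks of a placement are at most
those of another, some rook can be moved down, or exchanged with a later one, without exceeding the
target, and every such move reverses a degeneration along a line. This is `bcrLE_placement_iff`.

Multiplication by `W_I` on either side does not change the corner ranks with both cuts `≥ q`. A
representative that is decreasing on the first `q` rows and columns dominates every permutation with
smaller ranks of this kind, so these ranks determine the double coset and its place in the order.
They are read off the lower right `r × r` block, and every rook placement occurs as such a block
because `r ≤ q`. The rows `≥ q + i` contain exactly `r - i` rooks, so counting rooks in the last
columns instead of the first ones reverses the inequalities; reversing the columns of the block then
gives the order of `R_r`. The argument is packaged as `nonempty_orderIso_rookMonoid`, which applies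
to any set parametrized by permutations compatibly with the corner ranks.

For a monoid, the torus is diagonalized by weights. An idempotent `e` of its closure is the
projection to a face of the set of weights and, by Farkas' lemma, the limit of a cocharacter
(`exists_cocharacter`). If `μ` is the cocharacter of `e_max`, then `λ(e_max) = ∅` forces `μ` to be
strictly increasing, hence regular. As every proper `e` in `Λ` lies below `e_max`, the Borel
subgroup acts on `e` from the left, and its opposite from the right, only through the torus.
Regularity also shows that conjugates of `μ` generate the cone of nonnegative cocharacters, so
dominant vectors orthogonal to `μ` are nonnegative on that cone; this yields existence and
uniqueness of `e_I` (`exists_of_type`, `idem_eq_of_type`).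

For `e = e_I` the group `W_I` commutes with `e` and acts on it through the torus. Every Gauss–Jordan
element in `W e W` is therefore some `e w` up to the torus, and conjugation by `W_I` lets the class
depend only on `W_I w W_I`. The orbit `B e w B` is contained in `e w B`. Applying `x ↦ e w₀ x` to
the closure of `B w₀ w B`, with `w₀` the order-reversing permutation, shows that the Bruhat order is
reversed (`mem_closure_of_permRk_le`). Conversely, if `e v` lies in the closure, then for some `b`
in `B` the matrix `w b v⁻¹` has regular leading blocks of every size `≥ q`, which compares corner
ranks (`cornerLE_of_mem_closure`). Hence `C(e)` is also parametrized by corner ranks with the order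
reversed. -/

/-- The algebra of polynomial functions on the space of square matrices. -/
def polyFun (K : Type*) [Field K] (N : ℕ) : Subalgebra K (Matrix (Fin N) (Fin N) K → K) where
  carrier := {f | ∃ p : MvPolynomial (Fin N × Fin N) K, ∀ x, f x = evalMat p x}
  mul_mem' := by
    rintro f g ⟨p, hp⟩ ⟨q, hq⟩
    exact ⟨p * q, fun x => by simp [evalMat, hp, hq]⟩
  add_mem' := by
    rintro f g ⟨p, hp⟩ ⟨q, hq⟩
    exact ⟨p + q, fun x => by simp [evalMat, hp, hq]⟩
  algebraMap_mem' c := ⟨MvPolynomial.C c, fun x => by simp [evalMat]⟩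

theorem entry_mem_polyFun (i j : Fin N) : (fun x => x i j) ∈ polyFun K N :=
  ⟨MvPolynomial.X (i, j), fun x => by simp [evalMat]⟩

theorem const_mem_polyFun (c : K) : (fun _ => c) ∈ polyFun K N :=
  (polyFun K N).algebraMap_mem c

theorem sum_mem_polyFun {ι : Type*} (s : Finset ι) (f : ι → Matrix (Fin N) (Fin N) K → K)
    (h : ∀ a ∈ s, f a ∈ polyFun K N) : (fun x => ∑ a ∈ s, f a x) ∈ polyFun K N := by
  have := (polyFun K N).sum_mem h
  convert this using 1
  ext x; simp

theorem prod_mem_polyFun {ι : Type*} (s : Finset ι) (f : ι → Matrix (Fin N) (Fin N) K → K)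
    (h : ∀ a ∈ s, f a ∈ polyFun K N) : (fun x => ∏ a ∈ s, f a x) ∈ polyFun K N := by
  have := (polyFun K N).prod_mem h
  convert this using 1
  ext x; simp

theorem mul_entry_mem_polyFun {l m : Type*} (a : Matrix l (Fin N) K) (b : Matrix (Fin N) m K)
    (i : l) (j : m) : (fun x : Matrix (Fin N) (Fin N) K => (a * x * b) i j) ∈ polyFun K N := by
  simp only [Matrix.mul_apply]
  exact sum_mem_polyFun _ _ fun c _ => (polyFun K N).mul_mem
    (sum_mem_polyFun _ _ fun d _ => (polyFun K N).mul_mem (const_mem_polyFun _)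
      (entry_mem_polyFun _ _)) (const_mem_polyFun _)

theorem det_mem_polyFun {ι : Type*} [Fintype ι] [DecidableEq ι]
    (F : Matrix (Fin N) (Fin N) K → Matrix ι ι K)
    (h : ∀ i j, (fun x => F x i j) ∈ polyFun K N) : (fun x => (F x).det) ∈ polyFun K N := by
  simp only [Matrix.det_apply, Units.smul_def, zsmul_eq_mul]
  exact sum_mem_polyFun _ _ fun σ _ => (polyFun K N).mul_mem (const_mem_polyFun _)
    (prod_mem_polyFun _ _ fun i _ => h _ _)

theorem evalMat_eq_zero_of_mem_closure {X : Set (Matrix (Fin N) (Fin N) K)}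
    {y : Matrix (Fin N) (Fin N) K} (hy : y ∈ zariskiClosure X)
    {f : Matrix (Fin N) (Fin N) K → K} (hf : f ∈ polyFun K N) (h : ∀ x ∈ X, f x = 0) :
    f y = 0 := by
  obtain ⟨p, hp⟩ := hf
  rw [hp]
  exact hy p fun x hx => by rw [← hp, h x hx]

theorem eq_of_mem_closure {X : Set (Matrix (Fin N) (Fin N) K)}
    {y : Matrix (Fin N) (Fin N) K} (hy : y ∈ zariskiClosure X)
    {f g : Matrix (Fin N) (Fin N) K → K} (hf : f ∈ polyFun K N) (hg : g ∈ polyFun K N)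
    (h : ∀ x ∈ X, f x = g x) : f y = g y :=
  sub_eq_zero.1 (evalMat_eq_zero_of_mem_closure hy ((polyFun K N).sub_mem hf hg)
    fun x hx => by simp [h x hx])

theorem subset_zariskiClosure (X : Set (Matrix (Fin N) (Fin N) K)) : X ⊆ zariskiClosure X :=
  fun x hx _ hp => hp x hx

theorem zariskiClosure_mono {X Y : Set (Matrix (Fin N) (Fin N) K)}
    (h : X ⊆ zariskiClosure Y) : zariskiClosure X ⊆ zariskiClosure Y :=
  fun _ hx p hp => hx p fun _ hy => h hy p hp

/-- Two-sided multiplication preserves closures. -/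
theorem mul_mem_closure {X Y : Set (Matrix (Fin N) (Fin N) K)} {y : Matrix (Fin N) (Fin N) K}
    (hy : y ∈ zariskiClosure X) (a b : Matrix (Fin N) (Fin N) K)
    (h : ∀ x ∈ X, a * x * b ∈ zariskiClosure Y) : a * y * b ∈ zariskiClosure Y := by
  intro p hp
  have hf : (fun x : Matrix (Fin N) (Fin N) K => evalMat p (a * x * b)) ∈ polyFun K N := by
    unfold evalMat
    simp only [MvPolynomial.eval_eq]
    exact sum_mem_polyFun _ _ fun d _ => (polyFun K N).mul_mem (const_mem_polyFun _)
      (prod_mem_polyFun _ _ fun ij _ => (polyFun K N).pow_mem (mul_entry_mem_polyFun _ _ _ _) _)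
  exact evalMat_eq_zero_of_mem_closure hy hf fun x hx => h x hx p hp

theorem mul_eq_of_mem_closure {l m : Type*} {X : Set (Matrix (Fin N) (Fin N) K)}
    {y : Matrix (Fin N) (Fin N) K} (hy : y ∈ zariskiClosure X)
    (a c : Matrix l (Fin N) K) (b d : Matrix (Fin N) m K)
    (h : ∀ x ∈ X, a * x * b = c * x * d) : a * y * b = c * y * d := by
  ext i j
  exact eq_of_mem_closure hy (mul_entry_mem_polyFun a b i j) (mul_entry_mem_polyFun c d i j)
    fun x hx => by rw [h x hx]

/-- The closure of a double orbit is stable under multiplication by `B` on both sides, so a single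
point of the smaller orbit suffices. -/
theorem bcrLE_of_mem {B : Set (Matrix (Fin N) (Fin N) K)}
    (hB : ∀ a ∈ B, ∀ b ∈ B, a * b ∈ B) {x y : Matrix (Fin N) (Fin N) K}
    (h : x ∈ zariskiClosure (orbitBB B y)) : bcrLE B x y := by
  rintro _ ⟨b, hb, b', hb', rfl⟩
  refine mul_mem_closure h b b' ?_
  rintro _ ⟨c, hc, c', hc', rfl⟩
  exact subset_zariskiClosure _ ⟨b * c, hB _ hb _ hc, c' * b', hB _ hc' _ hb', by
    simp only [mul_assoc]⟩

theorem bcrLE_trans {B : Set (Matrix (Fin N) (Fin N) K)} {x y z : Matrix (Fin N) (Fin N) K}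
    (h : bcrLE B x y) (h' : bcrLE B y z) : bcrLE B x z :=
  h.trans (zariskiClosure_mono h')

theorem bcrLE_refl (B : Set (Matrix (Fin N) (Fin N) K)) (x : Matrix (Fin N) (Fin N) K) :
    bcrLE B x x := subset_zariskiClosure _

/-- A polynomial over an infinite field that vanishes away from zero vanishes at zero. -/
theorem eval_zero_eq_zero [Infinite K] (p : Polynomial K) (h : ∀ t ≠ 0, p.eval t = 0) :
    p.eval 0 = 0 := by
  have : p = 0 := by
    refine Polynomial.eq_zero_of_infinite_isRoot p (Set.Infinite.mono (s := {0}ᶜ) ?_ ?_)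
    · intro t ht; exact h t ht
    · exact (Set.finite_singleton (0 : K)).infinite_compl
  simp [this]

/-- The limit at zero of a polynomial curve in `X` lies in the closure of `X`. -/
theorem mem_closure_of_curve [Infinite K] {X : Set (Matrix (Fin N) (Fin N) K)}
    (Q : Matrix (Fin N) (Fin N) (Polynomial K))
    (h : ∀ t ≠ 0, Q.map (Polynomial.eval t) ∈ X) : Q.map (Polynomial.eval 0) ∈ zariskiClosure X := by
  intro p hp
  have key : ∀ t, evalMat p (Q.map (Polynomial.eval t)) =
      (MvPolynomial.aeval (fun ij : Fin N × Fin N => Q ij.1 ij.2) p).eval t := by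
    intro t
    rw [← Polynomial.coe_evalRingHom, MvPolynomial.aeval_def, MvPolynomial.hom_eval₂]
    change MvPolynomial.eval₂ (RingHom.id K) _ p = _
    congr 1
    ext; simp
  rw [key]
  exact eval_zero_eq_zero _ fun t ht => by rw [← key]; exact hp _ (h t ht)

end Zariski

end RookPutcha

end

noncomputable section

namespace RookPutcha

open Matrix

/-! ### Rank functions of rook placements -/

section Rank

variable {m : ℕ}

/-- The number of columns `b < j` with an entry in a (zero-based) row `≥ i`; the function `f`
records one plus the row of the entry of a column, and `0` for an empty column. -/
def rk (f : Fin m → ℕ) (i j : ℕ) : ℕ :=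
  (Finset.univ.filter fun b : Fin m => b.val < j ∧ i < f b).card

theorem rk_eq_sum (f : Fin m → ℕ) (i j : ℕ) :
    (rk f i j : ℤ) = ∑ b : Fin m, if b.val < j ∧ i < f b then 1 else 0 := by
  simp [rk]

/-- `f` describes a placement of non-attacking rooks. -/
def IsRook (f : Fin m → ℕ) : Prop :=
  (∀ b, f b ≤ m) ∧ ∀ b c, f b = f c → f b ≠ 0 → b = c

/-- One step up in the Bruhat–Chevalley–Renner order: the entry of the column `d` moves down,
either to a free row or by an exchange with a later column. -/
def RookStep (f f' : Fin m → ℕ) (d : Fin m) (p : ℕ) : Prop :=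
  f d < p ∧ p ≤ m ∧
    ((∃ k, d < k ∧ f k = p ∧ f' = f ∘ Equiv.swap d k) ∨
      ((∀ b, f b ≠ p) ∧ f' = Function.update f d p))

theorem RookStep.isRook {f f' : Fin m → ℕ} {d : Fin m} {p : ℕ} (h : RookStep f f' d p)
    (hf : IsRook f) : IsRook f' := by
  obtain ⟨h1, h2, ⟨k, hk, hp, rfl⟩ | ⟨hp, rfl⟩⟩ := h
  · refine ⟨fun b => hf.1 _, fun b c hbc h0 => ?_⟩
    exact (Equiv.swap d k).injective (hf.2 _ _ hbc h0)
  · refine ⟨fun b => ?_, fun b c hbc h0 => ?_⟩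
    · by_cases hb : b = d
      · subst hb; simpa using h2
      · simpa [hb] using hf.1 b
    · by_cases hb : b = d <;> by_cases hc : c = d
      · rw [hb, hc]
      · subst hb; simp [hc] at hbc; exact absurd hbc.symm (hp c)
      · subst hc; simp [hb] at hbc; exact absurd hbc (hp b)
      · simp [hb, hc] at hbc h0; exact hf.2 _ _ hbc h0

/-- Only the columns `d` and `k` contribute to the difference. Their contributions cancel unless the
corner contains column `d` but not `k` and its row cut separates the two entries. -/
theorem rk_swap (f : Fin m → ℕ) {d k : Fin m} (hk : d < k) (hp : f d < f k) (i j : ℕ) :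
    rk (f ∘ Equiv.swap d k) i j =
      rk f i j + if d.val < j ∧ j ≤ k.val ∧ f d ≤ i ∧ i < f k then 1 else 0 := by
  have h : (rk (f ∘ Equiv.swap d k) i j : ℤ) - rk f i j =
      ((if d.val < j ∧ i < f k then 1 else 0) - (if d.val < j ∧ i < f d then 1 else 0)) +
      ((if k.val < j ∧ i < f d then 1 else 0) - (if k.val < j ∧ i < f k then 1 else 0)) := by
    rw [rk_eq_sum, rk_eq_sum, ← Finset.sum_sub_distrib, Fintype.sum_eq_add d k hk.ne]
    · simp
    · rintro x ⟨hx, hx'⟩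
      simp [Equiv.swap_apply_of_ne_of_ne hx hx']
  have hk' : d.val < k.val := hk
  split_ifs at h ⊢ <;> omega

theorem rk_update (f : Fin m → ℕ) {d : Fin m} {p : ℕ} (hp : f d < p) (i j : ℕ) :
    rk (Function.update f d p) i j =
      rk f i j + if d.val < j ∧ f d ≤ i ∧ i < p then 1 else 0 := by
  have h : (rk (Function.update f d p) i j : ℤ) - rk f i j =
      ((if d.val < j ∧ i < p then 1 else 0) - (if d.val < j ∧ i < f d then 1 else 0)) := by
    rw [rk_eq_sum, rk_eq_sum, ← Finset.sum_sub_distrib, Fintype.sum_eq_single d]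
    · simp
    · intro x hx
      simp [hx]
  split_ifs at h ⊢ <;> omega

/-- A statistic that increases along rook steps. -/
def rookWeight (f : Fin m → ℕ) : ℤ := ∑ b : Fin m, ((m : ℤ) - b.val) * f b

/-- Rearrangement: the coefficients decrease with the column, so moving a larger value to an earlier
column raises the sum. This gives termination of chains of steps. -/
theorem RookStep.weight_lt {f f' : Fin m → ℕ} {d : Fin m} {p : ℕ} (h : RookStep f f' d p) :
    rookWeight f < rookWeight f' := by
  have hd := d.2
  obtain ⟨h1, h2, ⟨k, hk, hp, rfl⟩ | ⟨hp, rfl⟩⟩ := h <;>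
  rw [← sub_pos, rookWeight, rookWeight, ← Finset.sum_sub_distrib]
  · rw [Fintype.sum_eq_add d k hk.ne]
    · simp only [Function.comp, Equiv.swap_apply_left, Equiv.swap_apply_right]
      have hk' : (d.val : ℤ) < k.val := by exact_mod_cast hk
      have h3 : (f d : ℤ) < f k := by exact_mod_cast hp ▸ h1
      nlinarith [mul_pos (sub_pos.2 hk') (sub_pos.2 h3)]
    · rintro x ⟨hx, hx'⟩
      simp [Equiv.swap_apply_of_ne_of_ne hx hx']
  · rw [Fintype.sum_eq_single d]
    · simp only [Function.update_self]
      have hk' : (d.val : ℤ) < m := by exact_mod_cast hd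
      have h3 : (f d : ℤ) < p := by exact_mod_cast h1
      nlinarith [mul_pos (sub_pos.2 hk') (sub_pos.2 h3)]
    · intro x hx
      simp [hx]

theorem rookWeight_le {f : Fin m → ℕ} (hf : IsRook f) : rookWeight f ≤ m * (m * m) := by
  calc rookWeight f ≤ ∑ b : Fin m, ((m : ℤ) * m) := by
        refine Finset.sum_le_sum fun b _ => ?_
        have h1 : (f b : ℤ) ≤ m := by exact_mod_cast hf.1 b
        have h2 : (b.val : ℤ) < m := by exact_mod_cast b.2
        have h3 : (0 : ℤ) ≤ b.val := by positivity
        have h4 : (0 : ℤ) ≤ f b := by positivity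
        nlinarith
    _ = m * (m * m) := by simp

/-- Comparison of two placements that agree before column `d`. -/
theorem rk_add_one_le {f g : Fin m → ℕ} (hle : ∀ i j, rk f i j ≤ rk g i j) {d : Fin m}
    (hlt : ∀ b < d, f b = g b) {i j : ℕ} (hdj : d.val < j) (hfi : f d ≤ i) (hig : i < g d)
    (hno : ∀ b : Fin m, d < b → b.val < j → ¬ (f d < f b ∧ f b ≤ g d)) :
    rk f i j + 1 ≤ rk g i j := by
  have split : ∀ h : Fin m → ℕ, rk h i j = rk h (g d) j +
      (Finset.univ.filter fun b : Fin m => b.val < j ∧ i < h b ∧ h b ≤ g d).card := by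
    intro h
    rw [rk, rk, ← Finset.card_union_of_disjoint]
    · congr 1; ext b; simp only [Finset.mem_filter, Finset.mem_union, Finset.mem_univ, true_and]
      omega
    · rw [Finset.disjoint_filter]; intro b _; omega
  rw [split f, split g, add_assoc]
  refine add_le_add (hle _ _) ?_
  have h1 : (Finset.univ.filter fun b : Fin m => b.val < j ∧ i < f b ∧ f b ≤ g d) ⊆
      Finset.univ.filter fun b : Fin m => b < d ∧ i < g b ∧ g b ≤ g d := by
    intro b
    simp only [Finset.mem_filter, Finset.mem_univ, true_and]
    rintro ⟨hb, h2, h3⟩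
    rcases lt_trichotomy b d with h | h | h
    · rw [← hlt b h]; exact ⟨h, h2, h3⟩
    · subst h; omega
    · exact absurd ⟨by omega, h3⟩ (hno b h hb)
  have h2 : insert d (Finset.univ.filter fun b : Fin m => b < d ∧ i < g b ∧ g b ≤ g d) ⊆
      Finset.univ.filter fun b : Fin m => b.val < j ∧ i < g b ∧ g b ≤ g d := by
    intro b
    simp only [Finset.mem_filter, Finset.mem_univ, true_and, Finset.mem_insert]
    rintro (rfl | ⟨h, h'⟩)
    · exact ⟨hdj, hig, le_rfl⟩
    · exact ⟨lt_trans h hdj, h'⟩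
  have h3 := Finset.card_le_card h1
  have h4 := Finset.card_le_card h2
  rw [Finset.card_insert_of_notMem (by simp)] at h4
  omega

/-- At the first column `d` where the placements differ, `f` has the higher entry. That entry is
moved towards row `g d`, stopping at the nearest later column whose entry lies in between. The step
raises the ranks by one on a rectangle, and `rk_add_one_le` provides the slack there. -/
theorem exists_rookStep {f g : Fin m → ℕ} (hf : IsRook f) (hg : IsRook g)
    (hle : ∀ i j, rk f i j ≤ rk g i j) (hne : f ≠ g) :
    ∃ f' d p, RookStep f f' d p ∧ ∀ i j, rk f' i j ≤ rk g i j := by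
  obtain ⟨d, hd, hlt⟩ : ∃ d, f d ≠ g d ∧ ∀ b < d, f b = g b := by
    have hex : (Finset.univ.filter fun b => f b ≠ g b).Nonempty := by
      obtain ⟨b, hb⟩ := Function.ne_iff.1 hne
      exact ⟨b, by simpa using hb⟩
    refine ⟨_, (Finset.mem_filter.1 (Finset.min'_mem _ hex)).2, fun b hb => ?_⟩
    by_contra h
    exact absurd (Finset.min'_le _ b (by simpa using h)) (not_le.2 hb)
  -- Otherwise the corner with the columns up to `d` and the row cut `g d` has larger rank for `f`
  -- than for `g`.
  have hfg : f d < g d := by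
    by_contra hcon
    have hgf : g d < f d := by omega
    have hsub : insert d (Finset.univ.filter fun b : Fin m => b.val < d.val + 1 ∧ g d < g b) ⊆
        Finset.univ.filter fun b : Fin m => b.val < d.val + 1 ∧ g d < f b := by
      intro b
      simp only [Finset.mem_filter, Finset.mem_univ, true_and, Finset.mem_insert]
      rintro (rfl | ⟨h, h'⟩)
      · exact ⟨by omega, hgf⟩
      · refine ⟨h, ?_⟩
        have hbd : b ≠ d := by rintro rfl; omega
        rw [hlt b (lt_of_le_of_ne (Fin.le_def.2 (by omega)) hbd)]; exact h'
    have h4 := Finset.card_le_card hsub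
    rw [Finset.card_insert_of_notMem (by simp)] at h4
    have := hle (g d) (d.val + 1)
    rw [rk, rk] at this
    omega
  by_cases hD : (Finset.univ.filter fun b => d < b ∧ f d < f b ∧ f b ≤ g d).Nonempty
  · set k := Finset.min' _ hD with hkdef
    obtain ⟨hk1, hk2, hk3⟩ := (Finset.mem_filter.1 (Finset.min'_mem _ hD)).2
    rw [← hkdef] at hk1 hk2 hk3
    refine ⟨_, d, f k, ⟨hk2, hf.1 _, Or.inl ⟨k, hk1, rfl, rfl⟩⟩, fun i j => ?_⟩
    rw [rk_swap f hk1 hk2]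
    split_ifs with hc
    · refine rk_add_one_le hle hlt hc.1 hc.2.2.1 (by omega) fun b hb hbj hcon => ?_
      have := Finset.min'_le (Finset.univ.filter fun b => d < b ∧ f d < f b ∧ f b ≤ g d) b
        (Finset.mem_filter.2 ⟨Finset.mem_univ _, hb, hcon⟩)
      rw [← hkdef] at this
      have : k.val ≤ b.val := this
      omega
    · exact hle i j
  · rw [Finset.not_nonempty_iff_eq_empty, Finset.filter_eq_empty_iff] at hD
    -- With no entry in between in later columns, row `g d` is free in `f`: an earlier column using
    -- it would also use it in `g`.
    refine ⟨_, d, g d, ⟨hfg, hg.1 _, Or.inr ⟨fun b hb => ?_, rfl⟩⟩, fun i j => ?_⟩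
    · rcases lt_trichotomy b d with h | h | h
      · have := hg.2 b d (by rw [← hlt b h, hb]) (by rw [← hlt b h]; omega)
        exact h.ne this
      · subst h; omega
      · exact hD (Finset.mem_univ b) ⟨h, by omega, by omega⟩
    · rw [rk_update f hfg]
      split_ifs with hc
      · exact rk_add_one_le hle hlt hc.1 hc.2.1 hc.2.2 fun b hb _ hcon =>
          hD (Finset.mem_univ b) ⟨hb, hcon⟩
      · exact hle i j

/-- The rank function determines the placement. -/
theorem eq_of_rk_eq {f g : Fin m → ℕ} (hf : IsRook f) (hg : IsRook g)
    (h : ∀ i j, rk f i j = rk g i j) : f = g := by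
  by_contra hne
  obtain ⟨f', d, p, hs, hle⟩ := exists_rookStep hf hg (fun i j => (h i j).le) hne
  obtain ⟨h1, h2, ⟨k, hk, hp, rfl⟩ | ⟨hp, rfl⟩⟩ := hs
  · have := hle (f d) (d.val + 1)
    rw [rk_swap f hk (hp ▸ h1), if_pos ⟨by omega, hk, le_rfl, hp ▸ h1⟩, h] at this
    omega
  · have := hle (f d) (d.val + 1)
    rw [rk_update f h1, if_pos ⟨by omega, le_rfl, h1⟩, h] at this
    omega

end Rank

/-! ### The rank criterion -/

section Criterion

variable {K : Type*} [Field K] {m : ℕ}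

/-- The matrix of a rook placement. -/
def placementMatrix (K : Type*) [Field K] {m : ℕ} (f : Fin m → ℕ) : Matrix (Fin m) (Fin m) K :=
  Matrix.of fun i j => if f j = i.val + 1 then 1 else 0

theorem mem_borelMat_iff {x : Matrix (Fin m) (Fin m) K} :
    x ∈ borelMat K m ↔ (∀ i j, j < i → x i j = 0) ∧ ∀ i, x i i ≠ 0 := by
  have hdet : (∀ i j, j < i → x i j = 0) → x.det = ∏ i, x i i := fun h =>
    Matrix.det_of_isUpperTriangular fun i j hij => h i j hij
  constructor
  · rintro ⟨g, hg, rfl⟩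
    refine ⟨hg, fun i hi => ?_⟩
    have h1 : (g : Matrix (Fin m) (Fin m) K).det ≠ 0 :=
      ((Matrix.isUnit_iff_isUnit_det _).1 g.isUnit).ne_zero
    rw [hdet hg] at h1
    exact h1 (Finset.prod_eq_zero (Finset.mem_univ i) hi)
  · rintro ⟨h1, h2⟩
    have h3 : x.det ≠ 0 := by
      rw [hdet h1]; exact Finset.prod_ne_zero_iff.2 fun i _ => h2 i
    exact ⟨Matrix.GeneralLinearGroup.mkOfDetNeZero x h3, h1, rfl⟩

theorem one_mem_borelMat : (1 : Matrix (Fin m) (Fin m) K) ∈ borelMat K m :=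
  mem_borelMat_iff.2 ⟨fun _ _ h => Matrix.one_apply_ne h.ne', fun i => by simp⟩

theorem mul_mem_borelMat {a b : Matrix (Fin m) (Fin m) K} (ha : a ∈ borelMat K m)
    (hb : b ∈ borelMat K m) : a * b ∈ borelMat K m := by
  rw [mem_borelMat_iff] at *
  constructor
  · intro i j hij
    rw [Matrix.mul_apply]
    refine Finset.sum_eq_zero fun c _ => ?_
    rcases lt_or_ge c i with h | h
    · rw [ha.1 i c h, zero_mul]
    · rw [hb.1 c j (hij.trans_le h), mul_zero]
  · intro i
    rw [Matrix.mul_apply, Finset.sum_eq_single i]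
    · exact mul_ne_zero (ha.2 i) (hb.2 i)
    · intro c _ hc
      rcases lt_or_gt_of_ne hc with h | h
      · rw [ha.1 i c h, zero_mul]
      · rw [hb.1 c i h, mul_zero]
    · simp

theorem transvection_mem_borelMat {i j : Fin m} (h : i < j) (c : K) :
    Matrix.transvection i j c ∈ borelMat K m := by
  rw [mem_borelMat_iff]
  constructor
  · intro a b hab
    rw [Matrix.transvection, Matrix.add_apply, Matrix.one_apply_ne hab.ne', zero_add,
      Matrix.single_apply_of_ne]
    rintro ⟨rfl, rfl⟩
    exact absurd hab (not_lt.2 h.le)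
  · intro a
    rw [Matrix.transvection, Matrix.add_apply, Matrix.one_apply_eq, Matrix.single_apply_of_ne]
    · simp
    · rintro ⟨rfl, rfl⟩; exact h.ne rfl

theorem diagonal_mem_borelMat {t : Fin m → K} (h : ∀ i, t i ≠ 0) :
    Matrix.diagonal t ∈ borelMat K m := by
  rw [mem_borelMat_iff]
  exact ⟨fun i j hij => Matrix.diagonal_apply_ne _ hij.ne', fun i => by simpa using h i⟩

end Criterion

end RookPutcha

end

noncomputable section

namespace RookPutcha

open Matrix

/-! ### Degenerations and minors: the two directions of the rank criterion -/

section Criterion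

variable {K : Type*} [Field K] {m : ℕ}

/-- Adding an entry `t` below the entry of column `d` moves into the orbit of the larger
placement. -/
theorem RookStep.add_single_mem_orbit {f f' : Fin m → ℕ} {d : Fin m} {p : ℕ}
    (h : RookStep f f' d p) (hf : IsRook f) (i₀ : Fin m) (hi₀ : i₀.val + 1 = p) {t : K}
    (ht : t ≠ 0) :
    placementMatrix K f + Matrix.single i₀ d t ∈ orbitBB (borelMat K m) (placementMatrix K f') := by
  obtain ⟨h1, h2, hcase⟩ := h
  -- it suffices to treat the matrix after clearing the upper entry of column `d`
  suffices hM : ∃ R ∈ borelMat K m, ∀ a b, (placementMatrix K f' * R) a b =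
      (placementMatrix K f + Matrix.single i₀ d t) a b -
        (if a.val + 1 = f d then t⁻¹ * (placementMatrix K f + Matrix.single i₀ d t) i₀ b else 0) by
    obtain ⟨R, hR, hM⟩ := hM
    by_cases h0 : f d = 0
    · refine ⟨1, one_mem_borelMat, R, hR, ?_⟩
      ext a b
      rw [one_mul, hM, if_neg (by omega), sub_zero]
    · have hlt : f d - 1 < m := by have := hf.1 d; omega
      refine ⟨Matrix.transvection ⟨f d - 1, hlt⟩ i₀ t⁻¹,
        transvection_mem_borelMat (Fin.lt_def.2 (by simp; omega)) _, R, hR, ?_⟩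
      ext a b
      rw [mul_assoc]
      by_cases ha : a = ⟨f d - 1, hlt⟩
      · subst ha
        rw [Matrix.transvection_mul_apply_same, hM, hM, if_pos (by simp; omega),
          if_neg (by omega)]
        ring
      · rw [Matrix.transvection_mul_apply_of_ne _ _ _ _ ha, hM, if_neg, sub_zero]
        intro h3; apply ha; ext; simp; omega
  rcases hcase with ⟨k, hk, hp, rfl⟩ | ⟨hp, rfl⟩
  -- Write `e_p` and `e_{f d}` for unit columns in rows `p` and `f d`, the latter zero if `f d = 0`.
  -- After clearing, column `d` is `t e_p` and column `k` is `e_p - t⁻¹ e_{f d}`. These arise from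
  -- the columns `e_p` and `e_{f d}` of `f'` by scaling with `t` and `-t⁻¹` and then adding `t⁻¹`
  -- times the first to the second.
  · refine ⟨Matrix.diagonal (Function.update (Function.update 1 d t) k (-t⁻¹)) *
      Matrix.transvection d k t⁻¹, mul_mem_borelMat (diagonal_mem_borelMat fun i => ?_)
        (transvection_mem_borelMat hk _), fun a b => ?_⟩
    · by_cases hik : i = k
      · subst hik; simpa using ht
      · by_cases hid : i = d
        · subst hid; simpa [hik] using ht
        · simp [hik, hid]
    · rw [← mul_assoc]
      have hne : d ≠ k := hk.ne
      by_cases hbk : b = k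
      · subst hbk
        rw [Matrix.mul_transvection_apply_same, Matrix.mul_diagonal, Matrix.mul_diagonal]
        simp only [placementMatrix, Matrix.of_apply, Function.comp, Equiv.swap_apply_left,
          Equiv.swap_apply_right, Matrix.add_apply, Matrix.single_apply, hne, and_false,
          if_false, add_zero, Function.update_self, Function.update_of_ne hne, hp, hi₀, if_true]
        by_cases h3 : a.val + 1 = f d
        · simp [h3, h1.ne']
        · have h4 : ¬ f d = a.val + 1 := fun h => h3 h.symm
          simp [h3, h4, ht]
      · rw [Matrix.mul_transvection_apply_of_ne _ _ _ _ hbk, Matrix.mul_diagonal]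
        by_cases hbd : b = d
        · subst hbd
          simp only [placementMatrix, Matrix.of_apply, Function.comp, Equiv.swap_apply_left,
            Matrix.add_apply, Matrix.single_apply, and_true, Function.update_of_ne hbk,
            Function.update_self, hp, hi₀, if_true]
          have h5 : (i₀ = a) ↔ (p = a.val + 1) := by rw [Fin.ext_iff]; omega
          simp only [h5, h1.ne, if_false, zero_add, inv_mul_cancel₀ ht]
          by_cases h3 : a.val + 1 = f b
          · simp [h3, h1.ne']
          · have h4 : ¬ f b = a.val + 1 := fun h => h3 h.symm
            simp [h3, h4]
        · have h6 : f b ≠ p := fun h => hbk (hf.2 b k (h.trans hp.symm) (by omega))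
          simp only [placementMatrix, Matrix.of_apply, Function.comp,
            Equiv.swap_apply_of_ne_of_ne hbd hbk, Matrix.add_apply, Matrix.single_apply,
            Ne.symm hbd, and_false, if_false, hi₀, h6, Function.update_of_ne hbk,
            Function.update_of_ne hbd]
          simp
  · refine ⟨Matrix.diagonal (Function.update 1 d t), diagonal_mem_borelMat fun i => ?_,
      fun a b => ?_⟩
    · by_cases hid : i = d
      · subst hid; simpa using ht
      · simp [hid]
    · rw [Matrix.mul_diagonal]
      by_cases hbd : b = d
      · subst hbd
        simp only [placementMatrix, Matrix.of_apply, Matrix.add_apply, Matrix.single_apply,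
          and_true, Function.update_self, hi₀, if_true]
        have h5 : (i₀ = a) ↔ (p = a.val + 1) := by rw [Fin.ext_iff]; omega
        simp only [h5, h1.ne, if_false, zero_add, inv_mul_cancel₀ ht]
        by_cases h3 : a.val + 1 = f b
        · simp [h3, h1.ne']
        · have h4 : ¬ f b = a.val + 1 := fun h => h3 h.symm
          simp [h3, h4]
      · simp only [placementMatrix, Matrix.of_apply, Matrix.add_apply, Matrix.single_apply,
          Ne.symm hbd, and_false, if_false, hi₀, hp b, Function.update_of_ne hbd]
        simp

/-- The line `f + t E`, with `E` the elementary matrix at the new position, lies in the orbit of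
`f'` for `t ≠ 0` and passes through `f` at `t = 0`. -/
theorem RookStep.bcrLE [Infinite K] {f f' : Fin m → ℕ} {d : Fin m} {p : ℕ}
    (h : RookStep f f' d p) (hf : IsRook f) :
    bcrLE (borelMat K m) (placementMatrix K f) (placementMatrix K f') := by
  refine bcrLE_of_mem (fun a ha b hb => mul_mem_borelMat ha hb) ?_
  have hlt : p - 1 < m := by have := h.1; have := h.2.1; omega
  have hmem := fun (t : K) (ht : t ≠ 0) => h.add_single_mem_orbit hf ⟨p - 1, hlt⟩
    (by have := h.1; simp; omega) ht
  have hmap : ∀ t : K, ((placementMatrix K f).map Polynomial.C +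
      Matrix.single (⟨p - 1, hlt⟩ : Fin m) d Polynomial.X).map (Polynomial.eval t) =
      placementMatrix K f + Matrix.single ⟨p - 1, hlt⟩ d t := by
    intro t
    ext a b
    simp only [Matrix.map_apply, Matrix.add_apply, Polynomial.eval_add, Polynomial.eval_C,
      Matrix.single_apply]
    split_ifs <;> simp
  have := mem_closure_of_curve (K := K) (X := orbitBB (borelMat K m) (placementMatrix K f'))
    ((placementMatrix K f).map Polynomial.C + Matrix.single (⟨p - 1, hlt⟩ : Fin m) d Polynomial.X)
    (fun t ht => by rw [hmap]; exact hmem t ht)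
  rw [hmap] at this
  simpa using this

theorem bcrLE_of_rk_le [Infinite K] {f g : Fin m → ℕ} (hf : IsRook f) (hg : IsRook g)
    (hle : ∀ i j, rk f i j ≤ rk g i j) :
    bcrLE (borelMat K m) (placementMatrix K f) (placementMatrix K g) := by
  -- Steps are iterated until `g` is reached; the weight increases strictly and is bounded by `m ^
  -- 3`.
  induction hN : (m * (m * m) - rookWeight f).toNat using Nat.strong_induction_on generalizing f with
  | _ N ih =>
    by_cases hne : f = g
    · subst hne; exact bcrLE_refl _ _
    · obtain ⟨f', d, p, hs, hle'⟩ := exists_rookStep hf hg hle hne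
      refine bcrLE_trans (hs.bcrLE hf) (ih _ ?_ (hs.isRook hf) hle' rfl)
      have h1 := hs.weight_lt
      have h2 := rookWeight_le (hs.isRook hf)
      omega

/-- The minor on the rooks of `f` in the given corner equals `1` at `f`. If `g` had fewer rooks in
that corner, the same minor would vanish on the whole orbit of `g`, hence on its closure. -/
theorem rk_le_of_bcrLE {f g : Fin m → ℕ} (hf : IsRook f)
    (h : bcrLE (borelMat K m) (placementMatrix K f) (placementMatrix K g)) (i j : ℕ) :
    rk f i j ≤ rk g i j := by
  by_contra hlt
  rw [not_le] at hlt
  let S := {b : Fin m // b.val < j ∧ i < f b}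
  let G := {b : Fin m // b.val < j ∧ i < g b}
  have hS : Fintype.card S = rk f i j := Fintype.card_subtype _
  have hG : Fintype.card G = rk g i j := Fintype.card_subtype _
  let row : S → Fin m := fun b => ⟨f b.1 - 1, by have := hf.1 b.1; have := b.2.2; omega⟩
  let col : S → Fin m := Subtype.val
  have hmem : placementMatrix K f ∈
      zariskiClosure (orbitBB (borelMat K m) (placementMatrix K g)) :=
    h ⟨1, one_mem_borelMat, 1, one_mem_borelMat, by simp⟩
  have h0 : ((placementMatrix K f).submatrix row col).det = 0 := by
    refine evalMat_eq_zero_of_mem_closure (f := fun x => (x.submatrix row col).det) hmem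
      (det_mem_polyFun _ fun a b => entry_mem_polyFun _ _) ?_
    rintro _ ⟨b, hb, b', hb', rfl⟩
    rw [mem_borelMat_iff] at hb hb'
    -- By triangularity of `b` and `b'`, only the columns of `g` in `G` contribute to this submatrix
    -- of `b g b'`, so it factors through a space of dimension less than its size.
    have hfac : (b * placementMatrix K g * b').submatrix row col =
        (Matrix.of fun (s : S) (c : G) => (b * placementMatrix K g) (row s) c.1) *
          (Matrix.of fun (c : G) (s : S) => b' c.1 (col s)) := by
      ext s s'
      rw [Matrix.submatrix_apply, Matrix.mul_apply, Matrix.mul_apply,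
        ← Finset.sum_filter_add_sum_filter_not Finset.univ (fun c => c.val < j ∧ i < g c)]
      simp only [Matrix.of_apply]
      rw [Finset.sum_subtype _ (p := fun c => c.val < j ∧ i < g c) (by simp), add_eq_left]
      refine Finset.sum_eq_zero fun c hc => ?_
      have hc' := (Finset.mem_filter.1 hc).2
      by_cases hcj : c.val < j
      · have hgi : g c ≤ i := by by_contra h5; exact hc' ⟨hcj, by omega⟩
        rw [Matrix.mul_apply, Finset.sum_eq_zero, zero_mul]
        intro a _
        by_cases hga : g c = a.val + 1
        · rw [hb.1, zero_mul]
          have := s.2.2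
          exact Fin.lt_def.2 (by simp only [row]; omega)
        · simp [placementMatrix, hga]
      · rw [hb'.1 c, mul_zero]
        have := s'.2.1
        exact Fin.lt_def.2 (by simp only [col]; omega)
    change ((b * placementMatrix K g * b').submatrix row col).det = 0
    by_contra hdet
    have hr := Matrix.rank_of_isUnit _ ((Matrix.isUnit_iff_isUnit_det _).2 (isUnit_iff_ne_zero.2 hdet))
    have hr2 := (Matrix.rank_mul_le_left (Matrix.of fun (s : S) (c : G) =>
      (b * placementMatrix K g) (row s) c.1) (Matrix.of fun (c : G) (s : S) => b' c.1 (col s))).trans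
        (Matrix.rank_le_card_width _)
    rw [← hfac, hr] at hr2
    omega
  have h1 : (placementMatrix K f).submatrix row col = 1 := by
    ext s s'
    have hs := s.2.2
    have hs' := s'.2.2
    rw [Matrix.submatrix_apply, Matrix.one_apply]
    simp only [placementMatrix, Matrix.of_apply, row, col]
    by_cases hss : s = s'
    · subst hss; rw [if_pos rfl, if_pos (by omega)]
    · rw [if_neg hss, if_neg]
      intro h5
      exact hss (Subtype.ext (hf.2 _ _ (by omega) (by omega)))
  rw [h1, Matrix.det_one] at h0
  exact one_ne_zero h0

/-- The rank criterion for the Bruhat–Chevalley–Renner order of rook placements. -/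
theorem bcrLE_placement_iff [Infinite K] {f g : Fin m → ℕ} (hf : IsRook f) (hg : IsRook g) :
    bcrLE (borelMat K m) (placementMatrix K f) (placementMatrix K g) ↔
      ∀ i j, rk f i j ≤ rk g i j :=
  ⟨rk_le_of_bcrLE hf, bcrLE_of_rk_le hf hg⟩

/-- The placement of an injective partial transformation. -/
def pequivPlacement (σ : Fin m ≃. Fin m) (b : Fin m) : ℕ := (σ b).elim 0 fun i => i.val + 1

theorem pequivPlacement_eq_iff (σ : Fin m ≃. Fin m) (b i : Fin m) :
    pequivPlacement σ b = i.val + 1 ↔ σ b = some i := by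
  unfold pequivPlacement
  cases h : σ b <;> simp [Fin.ext_iff]

theorem isRook_pequivPlacement (σ : Fin m ≃. Fin m) : IsRook (pequivPlacement σ) := by
  constructor
  · intro b
    unfold pequivPlacement
    cases h : σ b <;> simp
  · intro b c hbc h0
    cases h : σ b with
    | none => simp [pequivPlacement, h] at h0
    | some i =>
      have h1 := (pequivPlacement_eq_iff σ b i).2 h
      rw [hbc, pequivPlacement_eq_iff] at h1
      exact σ.inj h h1

theorem pequivPlacement_injective : Function.Injective (pequivPlacement (m := m)) := by
  intro σ τ h
  ext b i
  have := congrFun h b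
  rw [← pequivPlacement_eq_iff, ← pequivPlacement_eq_iff, this]

theorem rookMatrix_eq (σ : Fin m ≃. Fin m) :
    rookMatrix K σ = placementMatrix K (pequivPlacement σ) := by
  ext a b
  simp [rookMatrix, placementMatrix, pequivPlacement_eq_iff]

theorem rookMonoid_le_iff [Infinite K] (σ τ : Fin m ≃. Fin m) :
    @LE.le (RookMonoid K m) inferInstance σ τ ↔
      ∀ i j, rk (pequivPlacement σ) i j ≤ rk (pequivPlacement τ) i j := by
  have h : @LE.le (RookMonoid K m) inferInstance σ τ ↔
      bcrLE (borelMat K m) (rookMatrix K σ) (rookMatrix K τ) := Iff.rfl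
  rw [h, rookMatrix_eq, rookMatrix_eq]
  exact bcrLE_placement_iff (isRook_pequivPlacement _) (isRook_pequivPlacement _)

/-- The number of `b < j` with `w b ≥ i`. -/
def permRk (w : Equiv.Perm (Fin m)) (i j : ℕ) : ℕ := rk (fun b => (w b).val + 1) i j

theorem permRk_eq (w : Equiv.Perm (Fin m)) (i j : ℕ) :
    permRk w i j = (Finset.univ.filter fun b : Fin m => b.val < j ∧ i ≤ (w b).val).card := by
  simp only [permRk, rk, Nat.lt_succ_iff]

theorem isRook_perm (w : Equiv.Perm (Fin m)) : IsRook fun b => (w b).val + 1 :=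
  ⟨fun b => (w b).2, fun b c h _ => w.injective (Fin.ext (by simpa using h))⟩

theorem pequivPlacement_perm (w : Equiv.Perm (Fin m)) :
    pequivPlacement w.toPEquiv = fun b => (w b).val + 1 := by
  ext b; simp [pequivPlacement, Equiv.toPEquiv]

theorem bruhatLE_iff [Infinite K] (v w : Equiv.Perm (Fin m)) :
    bruhatLE K v w ↔ ∀ i j, permRk v i j ≤ permRk w i j := by
  rw [bruhatLE, rookMatrix_eq, rookMatrix_eq, pequivPlacement_perm, pequivPlacement_perm]
  exact bcrLE_placement_iff (isRook_perm v) (isRook_perm w)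

theorem perm_eq_of_permRk_eq {v w : Equiv.Perm (Fin m)} (h : ∀ i j, permRk v i j = permRk w i j) :
    v = w := by
  ext b
  simpa using congrFun (eq_of_rk_eq (isRook_perm v) (isRook_perm w) h) b

end Criterion

end RookPutcha

end

noncomputable section

namespace RookPutcha

open Matrix

/-! ### The parabolic subgroup -/

section Parabolic

variable {n : ℕ}

theorem perm_inv_apply_self {α : Type*} (w : Equiv.Perm α) (x : α) : w⁻¹ (w x) = x :=
  w.symm_apply_apply x

theorem perm_apply_inv_self {α : Type*} (w : Equiv.Perm α) (x : α) : w (w⁻¹ x) = x :=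
  w.apply_symm_apply x

/-- The permutations that fix every index `≥ q`. -/
def fixLast (n q : ℕ) : Subgroup (Equiv.Perm (Fin n)) where
  carrier := {w | ∀ i : Fin n, q ≤ i.val → w i = i}
  one_mem' := by intro i _; rfl
  mul_mem' := by
    intro a b ha hb i hi
    rw [Equiv.Perm.mul_apply, hb i hi, ha i hi]
  inv_mem' := by
    intro a ha i hi
    rw [Equiv.Perm.inv_eq_iff_eq, ha i hi]

theorem le_apply_iff_of_mem_fixLast {q : ℕ} {w : Equiv.Perm (Fin n)} (hw : w ∈ fixLast n q)
    {i : ℕ} (hi : q ≤ i) (b : Fin n) : i ≤ (w b).val ↔ i ≤ b.val := by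
  constructor
  · intro h
    have h1 := hw (w b) (hi.trans h)
    rw [w.injective h1] at h
    exact h
  · intro h
    rwa [hw b (hi.trans h)]

theorem rookWeight_nonneg {m : ℕ} (f : Fin m → ℕ) : 0 ≤ rookWeight f := by
  refine Finset.sum_nonneg fun b _ => mul_nonneg ?_ (by positivity)
  have := b.2
  omega

theorem rookWeight_lt_mul_swap (w : Equiv.Perm (Fin n)) {b c : Fin n} (hbc : b < c)
    (h : w b < w c) : rookWeight (fun x => (w x).val + 1) <
      rookWeight fun x => ((w * Equiv.swap b c) x).val + 1 := by
  refine RookStep.weight_lt (d := b) (p := (w c).val + 1) ⟨?_, (w c).2, Or.inl ⟨c, hbc, rfl, rfl⟩⟩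
  exact Nat.succ_lt_succ h

/-- Without descents `w` is strictly increasing, and so is its inverse; both then lie above the
identity, which forces `w = 1`. -/
theorem exists_descent {w : Equiv.Perm (Fin n)} (hw : w ≠ 1) :
    ∃ (i : ℕ) (h : i + 1 < n), w ⟨i + 1, h⟩ < w ⟨i, i.lt_succ_self.trans h⟩ := by
  by_contra hcon
  push Not at hcon
  apply hw
  obtain _ | n := n
  · exact Subsingleton.elim _ _
  have hmono : StrictMono w := by
    rw [Fin.strictMono_iff_lt_succ]
    intro i
    refine lt_of_le_of_ne (hcon i.val (by omega)) fun h => ?_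
    exact absurd (w.injective h) (Fin.castSucc_lt_succ).ne
  have hinv : StrictMono (w⁻¹ : Equiv.Perm (Fin (n + 1))) := by
    intro a b hab
    rw [← hmono.lt_iff_lt]
    simpa using hab
  ext i
  have h1 : i ≤ w i := hmono.le_apply
  have h2 : w i ≤ w⁻¹ (w i) := hinv.le_apply
  rw [perm_inv_apply_self] at h2
  exact congrArg Fin.val (le_antisymm h2 h1)

/-- A nontrivial element that fixes all indices `≥ k + 1` has a descent, necessarily at some `i <
k`. Multiplying by that simple transposition lowers the weight, so induction writes the element as a
product of generators. -/
theorem parabolic_firstSimple (n k : ℕ) : parabolic (firstSimple n k) = fixLast n (k + 1) := by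
  apply le_antisymm
  · rw [parabolic, Subgroup.closure_le]
    rintro _ ⟨i, h, hik, rfl⟩ j hj
    refine Equiv.swap_apply_of_ne_of_ne ?_ ?_ <;> rw [Ne, Fin.ext_iff] <;> simp <;> omega
  · intro w hw
    induction hN : (rookWeight fun b => (w b).val + 1).toNat using Nat.strong_induction_on
      generalizing w with
    | _ N ih =>
      by_cases hne : w = 1
      · rw [hne]; exact one_mem _
      obtain ⟨i, h, hlt⟩ := exists_descent hne
      have hik : i < k := by
        by_contra hik
        have h1 : w ⟨i + 1, h⟩ = ⟨i + 1, h⟩ := hw _ (by simp; omega)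
        rw [h1] at hlt
        have h2 : i + 1 < (w ⟨i, i.lt_succ_self.trans h⟩).val := hlt
        have h3 := hw (w ⟨i, i.lt_succ_self.trans h⟩) (by omega)
        rw [w.injective h3] at h2
        simp at h2
      set s := Equiv.swap (⟨i, i.lt_succ_self.trans h⟩ : Fin n) ⟨i + 1, h⟩ with hs
      have hsI : s ∈ firstSimple n k := ⟨i, h, hik, rfl⟩
      have hsf : s ∈ fixLast n (k + 1) := by
        intro j hj
        refine Equiv.swap_apply_of_ne_of_ne ?_ ?_ <;> rw [Ne, Fin.ext_iff] <;> simp <;> omega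
      have hw' : w * s ∈ fixLast n (k + 1) := mul_mem hw hsf
      have hwt := rookWeight_lt_mul_swap (w * s) (b := ⟨i, i.lt_succ_self.trans h⟩)
        (c := ⟨i + 1, h⟩) (Fin.lt_def.2 (by simp)) (by simpa [hs] using hlt)
      rw [← hs, mul_assoc, hs, Equiv.swap_mul_self, mul_one, ← hs] at hwt
      have hnn := rookWeight_nonneg fun x => ((w * s) x).val + 1
      have := ih _ (by omega) hw' rfl
      have h4 : w = w * s * s := by rw [mul_assoc, hs, Equiv.swap_mul_self, mul_one]
      rw [h4]
      exact mul_mem this (Subgroup.subset_closure hsI)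

end Parabolic

/-! ### Corner ranks and maximal representatives -/

section Corner

variable {n q : ℕ}

/-- Comparison of the ranks of the corners that are invariant under the parabolic subgroup. -/
def CornerLE (q : ℕ) (v w : Equiv.Perm (Fin n)) : Prop :=
  ∀ i j, q ≤ i → q ≤ j → permRk v i j ≤ permRk w i j

theorem permRk_mul_mul {u u' : Equiv.Perm (Fin n)} (hu : u ∈ fixLast n q) (hu' : u' ∈ fixLast n q)
    (w : Equiv.Perm (Fin n)) {i j : ℕ} (hi : q ≤ i) (hj : q ≤ j) :
    permRk (u * w * u') i j = permRk w i j := by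
  rw [permRk_eq, permRk_eq]
  refine Finset.card_equiv u' fun b => ?_
  simp only [Finset.mem_filter, Finset.mem_univ, true_and]
  rw [Equiv.Perm.mul_apply, Equiv.Perm.mul_apply, le_apply_iff_of_mem_fixLast hu hi, ← not_le, ← not_le, le_apply_iff_of_mem_fixLast hu' hj]

/-- If some column in `[j, q)` has its entry in a row `≥ i`, then all columns before `j` do, and the
rank of `w` is the largest possible. Otherwise passing from `j` to `q` does not change the rank of
`w`. -/
theorem permRk_le_of_antitone_cols {v w : Equiv.Perm (Fin n)}
    (hw : ∀ b c : Fin n, b ≤ c → c.val < q → w c ≤ w b) {i j : ℕ} (hj : j ≤ q)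
    (h : permRk v i q ≤ permRk w i q) : permRk v i j ≤ permRk w i j := by
  simp only [permRk_eq] at *
  by_cases hc : ∃ c : Fin n, j ≤ c.val ∧ c.val < q ∧ i ≤ (w c).val
  · obtain ⟨c, h1, h2, h3⟩ := hc
    refine Finset.card_le_card fun b => ?_
    simp only [Finset.mem_filter, Finset.mem_univ, true_and]
    rintro ⟨hb, -⟩
    exact ⟨hb, h3.trans (hw b c (Fin.le_def.2 (by omega)) h2)⟩
  · push Not at hc
    calc _ ≤ _ := Finset.card_le_card fun b => ?_
      _ ≤ _ := h
      _ ≤ _ := Finset.card_le_card fun b => ?_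
    · simp only [Finset.mem_filter, Finset.mem_univ, true_and]
      rintro ⟨hb, hb'⟩; exact ⟨by omega, hb'⟩
    · simp only [Finset.mem_filter, Finset.mem_univ, true_and]
      rintro ⟨hb, hb'⟩
      refine ⟨?_, hb'⟩
      by_contra h1
      have := hc b (by omega) hb
      omega

/-- The transposed argument. Either every column before `j` counts for `w`, or all rows in `[i, q)`
have their entry before column `j`, and then the passage from `q` to `i` adds the maximal amount `q
- i`. -/
theorem permRk_le_of_antitone_rows {v w : Equiv.Perm (Fin n)} (hq : q ≤ n)
    (hw : ∀ b c : Fin n, b ≤ c → c.val < q → w⁻¹ c ≤ w⁻¹ b) {i j : ℕ} (hi : i ≤ q)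
    (h : permRk v q j ≤ permRk w q j) : permRk v i j ≤ permRk w i j := by
  simp only [permRk_eq] at *
  by_cases hc : ∃ c : Fin n, i ≤ c.val ∧ c.val < q ∧ j ≤ (w⁻¹ c).val
  · obtain ⟨c, h1, h2, h3⟩ := hc
    refine Finset.card_le_card fun b => ?_
    simp only [Finset.mem_filter, Finset.mem_univ, true_and]
    rintro ⟨hb, -⟩
    refine ⟨hb, ?_⟩
    by_contra h4
    have h5 : w⁻¹ c ≤ w⁻¹ (w b) := hw (w b) c (Fin.le_def.2 (by omega)) h2
    rw [perm_inv_apply_self] at h5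
    have : (w⁻¹ c).val ≤ b.val := h5
    omega
  · push Not at hc
    have split : ∀ u : Equiv.Perm (Fin n),
        (Finset.univ.filter fun b : Fin n => b.val < j ∧ i ≤ (u b).val).card =
        (Finset.univ.filter fun b : Fin n => b.val < j ∧ q ≤ (u b).val).card +
        (Finset.univ.filter fun b : Fin n => b.val < j ∧ i ≤ (u b).val ∧ (u b).val < q).card := by
      intro u
      rw [← Finset.card_union_of_disjoint]
      · congr 1; ext b
        simp only [Finset.mem_filter, Finset.mem_union, Finset.mem_univ, true_and]
        omega
      · rw [Finset.disjoint_filter]; intro b _; omega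
    rw [split v, split w]
    refine add_le_add h (le_trans (b := (Finset.Ico i q).card) ?_ ?_)
    · refine Finset.card_le_card_of_injOn (fun b => (v b).val) ?_ ?_
      · intro b hb
        simp only [Finset.coe_filter, Finset.mem_univ, true_and, Set.mem_ofPred_eq] at hb
        simp only [Finset.coe_Ico, Set.mem_Ico]
        exact hb.2
      · intro a _ b _ hab
        exact v.injective (Fin.ext hab)
    · refine Finset.card_le_card_of_surjOn (fun b => (w b).val) ?_
      intro a ha
      simp only [Finset.coe_Ico, Set.mem_Ico] at ha
      refine ⟨w⁻¹ ⟨a, by omega⟩, ?_, by simp⟩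
      simp only [Finset.coe_filter, Finset.mem_univ, true_and, Set.mem_ofPred_eq,
        perm_apply_inv_self]
      exact ⟨hc _ ha.1 ha.2, ha⟩

/-- A permutation that is decreasing on the first `q` rows and columns dominates every
permutation with smaller corner ranks. -/
theorem permRk_le_of_cornerLE {v w : Equiv.Perm (Fin n)} (hq : q ≤ n)
    (hcol : ∀ b c : Fin n, b ≤ c → c.val < q → w c ≤ w b)
    (hrow : ∀ b c : Fin n, b ≤ c → c.val < q → w⁻¹ c ≤ w⁻¹ b) (h : CornerLE q v w) (i j : ℕ) :
    permRk v i j ≤ permRk w i j := by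
  have h1 : ∀ i, q ≤ i → ∀ j, permRk v i j ≤ permRk w i j := by
    intro i hi j
    rcases le_total q j with hj | hj
    · exact h i j hi hj
    · exact permRk_le_of_antitone_cols hcol hj (h i q hi le_rfl)
  rcases le_total q i with hi | hi
  · exact h1 i hi j
  · exact permRk_le_of_antitone_rows hq hrow hi (h1 q le_rfl j)

theorem antitone_of_adjacent {w : Equiv.Perm (Fin n)}
    (h : ∀ (i : ℕ) (hi : i + 1 < n), i + 1 < q → w ⟨i + 1, hi⟩ ≤ w ⟨i, i.lt_succ_self.trans hi⟩)
    (b c : Fin n) (hbc : b ≤ c) (hc : c.val < q) : w c ≤ w b := by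
  obtain ⟨b, hb⟩ := b
  obtain ⟨c, hc'⟩ := c
  have hbc' : b ≤ c := hbc
  clear hbc
  induction c, hbc' using Nat.le_induction with
  | base => exact le_rfl
  | succ c hbc ih =>
    exact (h c hc' hc).trans (ih (c.lt_succ_self.trans hc') (c.lt_succ_self.trans hc))

theorem swap_mem_fixLast {b c : Fin n} (hb : b.val < q) (hc : c.val < q) :
    Equiv.swap b c ∈ fixLast n q := by
  intro j hj
  refine Equiv.swap_apply_of_ne_of_ne ?_ ?_ <;> rintro rfl <;> omega

/-- Every double coset has a representative that dominates everything with smaller corner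
ranks. -/
theorem exists_dominating (hq : q ≤ n) (w : Equiv.Perm (Fin n)) :
    ∃ u ∈ fixLast n q, ∃ u' ∈ fixLast n q,
      ∀ v, CornerLE q v w → ∀ i j, permRk v i j ≤ permRk (u * w * u') i j := by
  classical
  -- A representative of maximal weight has no ascent among the first `q` columns or rows, since
  -- swapping one would stay in the double coset and raise the weight.
  obtain ⟨⟨⟨u, hu⟩, ⟨u', hu'⟩⟩, hmax⟩ := Finite.exists_max
    (fun p : fixLast n q × fixLast n q =>
      rookWeight fun b => ((p.1.1 * w * p.2.1) b).val + 1)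
  refine ⟨u, hu, u', hu', fun v hv => ?_⟩
  have hv' : CornerLE q v (u * w * u') := fun i j hi hj => by
    rw [permRk_mul_mul hu hu' w hi hj]; exact hv i j hi hj
  set x := u * w * u' with hx
  refine permRk_le_of_cornerLE hq (antitone_of_adjacent fun i hi hiq => ?_)
    (antitone_of_adjacent fun i hi hiq => ?_) hv'
  · by_contra hlt
    rw [not_le] at hlt
    have h1 := rookWeight_lt_mul_swap x (b := ⟨i, i.lt_succ_self.trans hi⟩) (c := ⟨i + 1, hi⟩)
      (Fin.lt_def.2 (by simp)) hlt
    have h2 := hmax (⟨u, hu⟩, ⟨u' * Equiv.swap ⟨i, i.lt_succ_self.trans hi⟩ ⟨i + 1, hi⟩,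
      mul_mem hu' (swap_mem_fixLast (i.lt_succ_self.trans hiq) hiq)⟩)
    simp only [← mul_assoc, ← hx] at h2
    exact absurd h1 (not_lt.2 h2)
  · by_contra hlt
    rw [not_le] at hlt
    have h1 := rookWeight_lt_mul_swap x hlt (by
      rw [perm_apply_inv_self, perm_apply_inv_self]; exact Fin.lt_def.2 (by simp))
    have h2 := hmax (⟨Equiv.swap ⟨i, i.lt_succ_self.trans hi⟩ ⟨i + 1, hi⟩ * u,
      mul_mem (swap_mem_fixLast (i.lt_succ_self.trans hiq) hiq) hu⟩, ⟨u', hu'⟩)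
    have h3 : x * Equiv.swap (x⁻¹ ⟨i, i.lt_succ_self.trans hi⟩) (x⁻¹ ⟨i + 1, hi⟩) =
        Equiv.swap ⟨i, i.lt_succ_self.trans hi⟩ ⟨i + 1, hi⟩ * u * w * u' := by
      rw [Equiv.mul_swap_eq_swap_mul, hx]
      simp [mul_assoc]
    rw [h3] at h1
    exact absurd h1 (not_lt.2 h2)

end Corner

/-! ### The order on double cosets in terms of corner ranks -/

section DoubleCosets

variable {K : Type*} [Field K] {n k : ℕ}

/-- The double coset of a permutation. -/
def mkCoset (K : Type*) [Field K] {n : ℕ} (k : ℕ) (w : Equiv.Perm (Fin n)) :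
    DoubleCosets K (firstSimple n k) :=
  DoubleCoset.mk (parabolic (firstSimple n k)) (parabolic (firstSimple n k)) w

theorem mkCoset_eq_iff {v w : Equiv.Perm (Fin n)} :
    mkCoset K k v = mkCoset K k w ↔
      ∃ u ∈ fixLast n (k + 1), ∃ u' ∈ fixLast n (k + 1), w = u * v * u' := by
  have h := DoubleCoset.eq (parabolic (firstSimple n k)) (parabolic (firstSimple n k)) v w
  simp only [parabolic_firstSimple] at h
  rw [← h]
  exact Iff.rfl

theorem exists_isMaxRep [Infinite K] (hk : k + 1 ≤ n) (w : Equiv.Perm (Fin n)) :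
    ∃ w', IsMaxRep K (mkCoset K k w) w' ∧
      ∀ v, CornerLE (k + 1) v w → ∀ i j, permRk v i j ≤ permRk w' i j := by
  obtain ⟨u, hu, u', hu', h⟩ := exists_dominating hk w
  refine ⟨u * w * u', ⟨(mkCoset_eq_iff.2 ⟨u, hu, u', hu', rfl⟩).symm, fun v hv => ?_⟩, h⟩
  rw [bruhatLE_iff]
  obtain ⟨a, ha, a', ha', hv⟩ := mkCoset_eq_iff.1 (show mkCoset K k v = mkCoset K k w from hv)
  refine h v fun i j hi hj => ?_
  rw [hv, permRk_mul_mul ha ha' v hi hj]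

/-- Corner ranks are constant on a double coset, and the maximal representative dominates everything
with smaller corner ranks, so comparing maximal elements loses nothing. -/
theorem mkCoset_le_iff [Infinite K] (hk : k + 1 ≤ n) {v w : Equiv.Perm (Fin n)} :
    mkCoset K k v ≤ mkCoset K k w ↔ CornerLE (k + 1) v w := by
  constructor
  · rintro ⟨v', w', ⟨hv, -⟩, ⟨hw, -⟩, hle⟩ i j hi hj
    obtain ⟨a, ha, a', ha', hv⟩ := mkCoset_eq_iff.1 (show mkCoset K k v' = mkCoset K k v from hv)
    obtain ⟨b, hb, b', hb', hw⟩ := mkCoset_eq_iff.1 (show mkCoset K k w' = mkCoset K k w from hw)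
    rw [hv, hw, permRk_mul_mul ha ha' _ hi hj, permRk_mul_mul hb hb' _ hi hj]
    exact (bruhatLE_iff _ _).1 hle i j
  · intro h
    obtain ⟨v', hv', -⟩ := exists_isMaxRep (K := K) hk v
    obtain ⟨w', hw', hmax⟩ := exists_isMaxRep (K := K) hk w
    refine ⟨v', w', hv', hw', (bruhatLE_iff _ _).2 (hmax v' fun i j hi hj => ?_)⟩
    obtain ⟨a, ha, a', ha', hv⟩ := mkCoset_eq_iff.1
      (show mkCoset K k v' = mkCoset K k v from hv'.1)
    refine le_trans (le_of_eq ?_) (h i j hi hj)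
    rw [hv, permRk_mul_mul ha ha' _ hi hj]

/-- Permutations with equal corner ranks lie in the same double coset. -/
theorem exists_mul_mul_of_cornerLE (hk : k + 1 ≤ n) {v w : Equiv.Perm (Fin n)}
    (h : CornerLE (k + 1) v w) (h' : CornerLE (k + 1) w v) :
    ∃ u ∈ fixLast n (k + 1), ∃ u' ∈ fixLast n (k + 1), w = u * v * u' := by
  obtain ⟨a, ha, a', ha', hv⟩ := exists_dominating hk v
  obtain ⟨b, hb, b', hb', hw⟩ := exists_dominating hk w
  have heq : a * v * a' = b * w * b' := by
    refine perm_eq_of_permRk_eq fun i j => le_antisymm (hw _ ?_ i j) (hv _ ?_ i j)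
    · intro i j hi hj; rw [permRk_mul_mul ha ha' _ hi hj]; exact h i j hi hj
    · intro i j hi hj; rw [permRk_mul_mul hb hb' _ hi hj]; exact h' i j hi hj
  refine ⟨b⁻¹ * a, mul_mem (inv_mem hb) ha, a' * b'⁻¹, mul_mem ha' (inv_mem hb'), ?_⟩
  have : w = b⁻¹ * (b * w * b') * b'⁻¹ := by group
  rw [this, ← heq]
  group

end DoubleCosets

end RookPutcha

end

noncomputable section

namespace RookPutcha

open Matrix

/-! ### Double cosets and the rook monoid -/

section Correspondence

variable {K : Type*} [Field K] {q r : ℕ}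

/-- `ρ` is the lower right block of `w`, with the order of the columns reversed. -/
def IsBlock (ρ : Fin r ≃. Fin r) (w : Equiv.Perm (Fin (q + r))) : Prop :=
  ∀ j i : Fin r, ρ j = some i ↔ w (Fin.natAdd q j.rev) = Fin.natAdd q i

theorem exists_block (w : Equiv.Perm (Fin (q + r))) : ∃ ρ : Fin r ≃. Fin r, IsBlock ρ w := by
  classical
  have hopt : ∀ (P : Fin r → Prop), (∀ a b, P a → P b → a = b) →
      ∃ o : Option (Fin r), ∀ a, o = some a ↔ P a := by
    intro P hP
    by_cases h : ∃ a, P a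
    · obtain ⟨a, ha⟩ := h
      refine ⟨some a, fun b => ⟨fun hb => ?_, fun hb => by rw [hP a b ha hb]⟩⟩
      rw [Option.some_inj] at hb; rwa [← hb]
    · exact ⟨none, fun a => ⟨fun h' => by simp at h', fun h' => absurd ⟨a, h'⟩ h⟩⟩
  choose f hf using fun j : Fin r =>
    hopt (fun i => w (Fin.natAdd q j.rev) = Fin.natAdd q i) fun a b ha hb => by
      simpa using ha.symm.trans hb
  choose g hg using fun i : Fin r =>
    hopt (fun j => w (Fin.natAdd q j.rev) = Fin.natAdd q i) fun a b ha hb => by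
      simpa using w.injective (ha.trans hb.symm)
  exact ⟨⟨f, g, fun a b => by rw [hf, hg]⟩, hf⟩

/-- Columns of the block without a rook must be sent to rows above the block. There are `q ≥ r` such
rows, so `j` can go to row `j`; the remaining columns are filled arbitrarily. -/
theorem exists_perm_of_block (hr : r ≤ q) (ρ : Fin r ≃. Fin r) :
    ∃ w : Equiv.Perm (Fin (q + r)), IsBlock ρ w := by
  classical
  let φ : Fin r → Fin (q + r) := fun j =>
    (ρ j).elim (Fin.castAdd r (Fin.castLE hr j)) fun i => Fin.natAdd q i
  have hφ : ∀ j i, ρ j = some i ↔ φ j = Fin.natAdd q i := by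
    intro j i
    cases h : ρ j with
    | none =>
      simp only [φ, h, Option.elim, reduceCtorEq, false_iff, Fin.ext_iff]
      simp; omega
    | some i' => simp [φ, h]
  have hinj : Function.Injective φ := by
    intro a b hab
    cases h : ρ a with
    | none =>
      cases h' : ρ b with
      | none => simpa [φ, h, h', Fin.ext_iff] using hab
      | some i =>
        rw [(hφ b i).1 h', ← hφ, h] at hab
        simp at hab
    | some i =>
      rw [(hφ a i).1 h] at hab
      exact ρ.inj h ((hφ b i).2 hab.symm)
  have hinj' : Function.Injective fun j : Fin r => Fin.natAdd q j.rev := fun a b h => by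
    simpa using h
  let e : {x // x ∈ Set.range fun j : Fin r => Fin.natAdd q j.rev} ≃ {x // x ∈ Set.range φ} :=
    (Equiv.ofInjective _ hinj').symm.trans (Equiv.ofInjective _ hinj)
  refine ⟨e.extendSubtype, fun j i => ?_⟩
  rw [hφ, Equiv.extendSubtype_apply_of_mem e _ ⟨j, rfl⟩]
  have h1 : e ⟨Fin.natAdd q j.rev, j, rfl⟩ = ⟨φ j, j, rfl⟩ := by
    have : (⟨Fin.natAdd q j.rev, j, rfl⟩ : {x // x ∈ Set.range fun j : Fin r =>
      Fin.natAdd q j.rev}) = Equiv.ofInjective _ hinj' j := rfl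
    rw [this]
    simp only [e, Equiv.trans_apply, Equiv.symm_apply_apply]
    rfl
  rw [h1]

theorem IsBlock.lt_iff {ρ : Fin r ≃. Fin r} {w : Equiv.Perm (Fin (q + r))} (h : IsBlock ρ w)
    (i : ℕ) (b : Fin r) :
    i < pequivPlacement ρ b ↔ q + i ≤ (w (Fin.natAdd q b.rev)).val := by
  constructor
  · intro hi
    cases hb : ρ b with
    | none => simp [pequivPlacement, hb] at hi
    | some a =>
      rw [(h b a).1 hb]
      simp [pequivPlacement, hb] at hi
      simp; omega
  · intro hi
    have hlt := (w (Fin.natAdd q b.rev)).2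
    have h1 := (h b ⟨(w (Fin.natAdd q b.rev)).val - q, by omega⟩).2 (Fin.ext (by simp; omega))
    rw [← pequivPlacement_eq_iff] at h1
    simp only at h1
    omega

theorem card_le_perm {n : ℕ} (w : Equiv.Perm (Fin n)) (i : ℕ) :
    (Finset.univ.filter fun b : Fin n => i ≤ (w b).val).card = n - i := by
  have h1 : (Finset.univ.filter fun b : Fin n => i ≤ (w b).val).card =
      (Finset.univ.filter fun b : Fin n => i ≤ b.val).card :=
    Finset.card_equiv w fun b => by simp
  rw [h1]
  have h2 : (Finset.univ.filter fun b : Fin n => i ≤ b.val).card = (Finset.Ico i n).card := by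
    rw [← Finset.card_map Fin.valEmbedding]
    congr 1; ext a
    simp only [Finset.mem_map, Finset.mem_filter, Finset.mem_univ, true_and,
      Fin.valEmbedding_apply, Finset.mem_Ico]
    constructor
    · rintro ⟨b, hb, rfl⟩; exact ⟨hb, b.2⟩
    · rintro ⟨h, h'⟩; exact ⟨⟨a, h'⟩, h, rfl⟩
  rw [h2, Nat.card_Ico]

/-- The rows `≥ q + i` of a permutation matrix hold exactly `r - i` entries. Those in the last `j`
columns are the rooks of the reversed block in its first `j` columns; the others are counted by
`permRk`. This complement is what reverses the order. -/
theorem IsBlock.rk_add {ρ : Fin r ≃. Fin r} {w : Equiv.Perm (Fin (q + r))} (h : IsBlock ρ w)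
    (i : ℕ) {j : ℕ} (hj : j ≤ r) :
    rk (pequivPlacement ρ) i j + permRk w (q + i) (q + r - j) = r - i := by
  have h1 : rk (pequivPlacement ρ) i j =
      (Finset.univ.filter fun b : Fin (q + r) =>
        q + r - j ≤ b.val ∧ q + i ≤ (w b).val).card := by
    rw [rk]
    refine Finset.card_nbij (fun b => Fin.natAdd q b.rev) ?_ ?_ ?_
    · intro b
      simp only [Finset.mem_filter, Finset.mem_univ, true_and, h.lt_iff, SetLike.mem_coe]
      rintro ⟨h1, h2⟩
      refine ⟨?_, h2⟩
      simp [Fin.val_rev]; omega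
    · intro a _ b _ hab; simpa using hab
    · intro b
      simp only [Finset.coe_filter, Finset.mem_univ, true_and, Set.mem_ofPred_eq, Set.mem_image,
        h.lt_iff]
      rintro ⟨h1, h2⟩
      have hb := b.2
      have hb' : Fin.natAdd q (Fin.rev (⟨q + r - 1 - b.val, by omega⟩ : Fin r)) = b := by
        ext; simp [Fin.val_rev]; omega
      exact ⟨⟨q + r - 1 - b.val, by omega⟩, ⟨by simp; omega, by rw [hb']; exact h2⟩, hb'⟩
  have h2 : r - i = (q + r) - (q + i) := by omega
  rw [h1, permRk_eq, h2, ← card_le_perm w (q + i), ← Finset.card_union_of_disjoint]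
  · congr 1; ext b
    simp only [Finset.mem_filter, Finset.mem_union, Finset.mem_univ, true_and]
    omega
  · rw [Finset.disjoint_filter]; intro b _; omega

theorem rk_of_ge {m : ℕ} (f : Fin m → ℕ) (i : ℕ) {j : ℕ} (hj : m ≤ j) : rk f i j = rk f i m := by
  unfold rk
  congr 1; ext b
  have := b.2
  simp only [Finset.mem_filter, Finset.mem_univ, true_and]
  omega

theorem IsBlock.le_iff [Infinite K] {ρ σ : Fin r ≃. Fin r} {w v : Equiv.Perm (Fin (q + r))}
    (h : IsBlock ρ w) (h' : IsBlock σ v) :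
    @LE.le (RookMonoid K r) inferInstance ρ σ ↔ CornerLE q v w := by
  rw [rookMonoid_le_iff]
  constructor
  · intro hle i j hi hj
    obtain ⟨i, rfl⟩ := Nat.exists_eq_add_of_le hi
    rcases le_total (q + r) j with hjn | hjn
    · rw [permRk, permRk, rk_of_ge _ _ hjn, rk_of_ge _ _ hjn]
      have h1 := h.rk_add i (Nat.zero_le _)
      have h2 := h'.rk_add i (Nat.zero_le _)
      have h3 := hle i 0
      rw [Nat.sub_zero] at h1 h2
      simp only [permRk] at h1 h2
      omega
    · have h1 := h.rk_add i (j := q + r - j) (by omega)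
      have h2 := h'.rk_add i (j := q + r - j) (by omega)
      have h3 := hle i (q + r - j)
      rw [Nat.sub_sub_self hjn] at h1 h2
      omega
  · intro hle i j
    have key : ∀ j ≤ r, rk (pequivPlacement ρ) i j ≤ rk (pequivPlacement σ) i j := by
      intro j hj
      have h1 := h.rk_add i hj
      have h2 := h'.rk_add i hj
      have h3 := hle (q + i) (q + r - j) (by omega) (by omega)
      omega
    rcases le_total r j with hj | hj
    · rw [rk_of_ge _ _ hj, rk_of_ge (pequivPlacement σ) _ hj]; exact key r le_rfl
    · exact key j hj

theorem rookMonoid_antisymm [Infinite K] {ρ σ : Fin r ≃. Fin r}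
    (h : @LE.le (RookMonoid K r) inferInstance ρ σ)
    (h' : @LE.le (RookMonoid K r) inferInstance σ ρ) : ρ = σ := by
  rw [rookMonoid_le_iff] at h h'
  exact pequivPlacement_injective (eq_of_rk_eq (isRook_pequivPlacement _)
    (isRook_pequivPlacement _) fun i j => le_antisymm (h i j) (h' i j))

/-- A set with a relation that is parametrized by permutations, compatibly with the corner
ranks, is order isomorphic to the rook monoid. -/
theorem nonempty_orderIso_rookMonoid [Infinite K] {k : ℕ} (hr : r ≤ k + 1) {X : Type*} [LE X]
    (F : Equiv.Perm (Fin (k + 1 + r)) → X) (hsurj : Function.Surjective F)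
    (hle : ∀ v w, F v ≤ F w ↔ CornerLE (k + 1) w v)
    (heq : ∀ v, ∀ u ∈ fixLast (k + 1 + r) (k + 1), ∀ u' ∈ fixLast (k + 1 + r) (k + 1),
      F (u * v * u') = F v) : Nonempty (X ≃o RookMonoid K r) := by
  -- A section of the map from permutations to blocks; composed with `F` it becomes the isomorphism.
  -- Injectivity is antisymmetry of the order of the rook monoid.
  choose s hs using exists_perm_of_block hr
  have hle' : ∀ ρ σ : Fin r ≃. Fin r,
      F (s ρ) ≤ F (s σ) ↔ @LE.le (RookMonoid K r) inferInstance ρ σ := fun ρ σ => by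
    rw [hle, (hs ρ).le_iff (hs σ)]
  have hbij : Function.Bijective fun ρ : Fin r ≃. Fin r => F (s ρ) := by
    constructor
    · intro ρ σ h
      have hρ : F (s ρ) = F (s σ) := h
      refine rookMonoid_antisymm (K := K) ((hle' ρ σ).1 ?_) ((hle' σ ρ).1 ?_)
      · rw [← hρ, hle']; exact (rookMonoid_le_iff _ _).2 fun _ _ => le_rfl
      · rw [← hρ, hle']; exact (rookMonoid_le_iff _ _).2 fun _ _ => le_rfl
    · intro x
      obtain ⟨w, rfl⟩ := hsurj x
      obtain ⟨ρ, hρ⟩ := exists_block w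
      refine ⟨ρ, ?_⟩
      have h1 := ((hs ρ).le_iff (K := K) hρ).1 ((rookMonoid_le_iff _ _).2 fun _ _ => le_rfl)
      have h2 := (hρ.le_iff (K := K) (hs ρ)).1 ((rookMonoid_le_iff _ _).2 fun _ _ => le_rfl)
      obtain ⟨u, hu, u', hu', h⟩ := exists_mul_mul_of_cornerLE (by omega) h1 h2
      change F (s ρ) = F w
      rw [h, heq _ u hu u' hu']
  let E : RookMonoid K r ≃ X := Equiv.ofBijective _ hbij
  exact ⟨(⟨E, fun {ρ σ} => hle' ρ σ⟩ : RookMonoid K r ≃o X).symm⟩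

theorem doubleCosets_orderIso [Infinite K] {k : ℕ} (hr : r ≤ k + 1) :
    Nonempty ((DoubleCosets K (firstSimple (k + 1 + r) k))ᵒᵈ ≃o RookMonoid K r) := by
  refine nonempty_orderIso_rookMonoid hr (fun w => OrderDual.toDual (mkCoset K k w)) ?_ ?_ ?_
  · intro x
    obtain ⟨w, hw⟩ := Quotient.exists_rep (OrderDual.ofDual x)
    exact ⟨w, congrArg OrderDual.toDual hw⟩
  · intro v w
    exact mkCoset_le_iff (by omega)
  · intro v u hu u' hu'
    exact congrArg OrderDual.toDual (mkCoset_eq_iff.2 ⟨u, hu, u', hu', rfl⟩).symm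

end Correspondence

end RookPutcha

end

noncomputable section

namespace RookPutcha

open Matrix

/-! ### Farkas' lemma -/

section Farkas

/-- **Farkas' lemma** for finitely generated cones in a rational vector space. -/
theorem farkas_rat {V ι : Type*} [AddCommGroup V] [Module ℚ V] (s : Finset ι) (v : ι → V) (b : V) :
    (∃ c : ι → ℚ, (∀ i ∈ s, 0 ≤ c i) ∧ b = ∑ i ∈ s, c i • v i) ∨
      ∃ f : V →ₗ[ℚ] ℚ, (∀ i ∈ s, 0 ≤ f (v i)) ∧ f b < 0 := by
  classical
  induction s using Finset.induction_on generalizing v b with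
  | empty =>
    by_cases hb : b = 0
    · exact Or.inl ⟨0, by simp, by simp [hb]⟩
    · right
      have := (Module.forall_dual_apply_eq_zero_iff ℚ b).not.2 hb
      push Not at this
      obtain ⟨f, hf⟩ := this
      rcases lt_or_gt_of_ne hf with h | h
      · exact ⟨f, by simp, h⟩
      · exact ⟨-f, by simp, by simpa using h⟩
  | insert a s ha ih =>
    rcases ih v b with ⟨c, hc, hb⟩ | ⟨f, hf, hfb⟩
    · refine Or.inl ⟨Function.update c a 0, fun i hi => ?_, ?_⟩
      · by_cases hia : i = a
        · subst hia; simp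
        · simpa [hia] using hc i (Finset.mem_of_mem_insert_of_ne hi hia)
      · rw [Finset.sum_insert ha, hb]
        simp only [Function.update_self, zero_smul, zero_add]
        refine Finset.sum_congr rfl fun i hi => ?_
        rw [Function.update_of_ne (by rintro rfl; exact ha hi)]
    · by_cases hfa : 0 ≤ f (v a)
      · refine Or.inr ⟨f, fun i hi => ?_, hfb⟩
        rcases Finset.mem_insert.1 hi with rfl | hi
        · exact hfa
        · exact hf i hi
      rw [not_le] at hfa
      -- The new generator lies on the negative side of `f`. Projecting everything to the kernel of
      -- `f` along `v a` reduces the question to the old index set.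
      rcases ih (fun i => v i - (f (v i) / f (v a)) • v a) (b - (f b / f (v a)) • v a) with
        ⟨c, hc, hb⟩ | ⟨g, hg, hgb⟩
      · left
        -- Undoing the projection collects the coefficient of `v a`. It is nonnegative because `f b`
        -- and `f (v a)` are negative while `f (v i)` and `c i` are nonnegative.
        refine ⟨Function.update c a (f b / f (v a) - ∑ i ∈ s, c i * (f (v i) / f (v a))),
          fun i hi => ?_, ?_⟩
        · by_cases hia : i = a
          · subst hia
            rw [Function.update_self, sub_nonneg]
            refine le_trans (Finset.sum_nonpos fun i hi => ?_)
              (div_nonneg_of_nonpos hfb.le hfa.le)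
            exact mul_nonpos_of_nonneg_of_nonpos (hc i hi)
              (div_nonpos_of_nonneg_of_nonpos (hf i hi) hfa.le)
          · simpa [hia] using hc i (Finset.mem_of_mem_insert_of_ne hi hia)
        · rw [Finset.sum_insert ha, Function.update_self]
          have h1 : ∑ i ∈ s, Function.update c a (f b / f (v a) -
              ∑ i ∈ s, c i * (f (v i) / f (v a))) i • v i = ∑ i ∈ s, c i • v i :=
            Finset.sum_congr rfl fun i hi => by
              rw [Function.update_of_ne (by rintro rfl; exact ha hi)]
          rw [h1, sub_smul, Finset.sum_smul, eq_comm, ← sub_eq_zero]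
          rw [← sub_eq_zero] at hb
          simp only [smul_sub, Finset.sum_sub_distrib, smul_smul] at hb
          rw [← neg_eq_zero, ← hb]
          abel
      · right
        -- The composite of `g` with the projection; it vanishes on `v a`.
        refine ⟨g - (g (v a) / f (v a)) • f, fun i hi => ?_, ?_⟩
        · rcases Finset.mem_insert.1 hi with rfl | hi
          · simp [div_mul_cancel₀ _ hfa.ne]
          · have := hg i hi
            simp only [map_sub, map_smul, smul_eq_mul] at this
            simp only [LinearMap.sub_apply, LinearMap.smul_apply, smul_eq_mul]
            convert this using 1; ring
        · simp only [map_sub, map_smul, smul_eq_mul] at hgb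
          simp only [LinearMap.sub_apply, LinearMap.smul_apply, smul_eq_mul]
          convert hgb using 1; ring

theorem exists_common_denominator {ι : Type*} (s : Finset ι) (c : ι → ℚ) :
    ∃ (D : ℕ) (z : ι → ℤ), 0 < D ∧ ∀ i ∈ s, (D : ℚ) * c i = z i := by
  classical
  refine ⟨∏ i ∈ s, (c i).den, fun i => (∏ j ∈ s.erase i, (c j).den) * (c i).num,
    Finset.prod_pos fun i _ => (c i).den_pos, fun i hi => ?_⟩
  rw [← Finset.mul_prod_erase s _ hi]
  push_cast
  have := Rat.den_mul_eq_num (c i)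
  rw [← this]
  ring

/-- Farkas' lemma for integral vectors. -/
theorem farkas_int {n : ℕ} {ι : Type*} (s : Finset ι) (v : ι → Fin n → ℤ) (b : Fin n → ℤ) :
    (∃ (D : ℕ) (c : ι → ℕ), 0 < D ∧ D • b = ∑ i ∈ s, c i • v i) ∨
      ∃ ν : Fin n → ℤ, (∀ i ∈ s, 0 ≤ v i ⬝ᵥ ν) ∧ b ⬝ᵥ ν < 0 := by
  rcases farkas_rat s (fun i (a : Fin n) => (v i a : ℚ)) (fun a => (b a : ℚ)) with
    ⟨c, hc, hb⟩ | ⟨f, hf, hfb⟩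
  · left
    obtain ⟨D, z, hD, hz⟩ := exists_common_denominator s c
    have hz0 : ∀ i ∈ s, 0 ≤ z i := fun i hi => by
      have : (0 : ℚ) ≤ z i := by rw [← hz i hi]; exact mul_nonneg (by positivity) (hc i hi)
      exact_mod_cast this
    refine ⟨D, fun i => (z i).toNat, hD, ?_⟩
    ext a
    have h1 := congrFun hb a
    simp only [Finset.sum_apply, Pi.smul_apply, smul_eq_mul] at h1
    have h2 : (D : ℚ) * b a = ∑ i ∈ s, (z i : ℚ) * v i a := by
      rw [h1, Finset.mul_sum]
      refine Finset.sum_congr rfl fun i hi => ?_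
      rw [← hz i hi]; ring
    have h3 : (D : ℤ) * b a = ∑ i ∈ s, z i * v i a := by exact_mod_cast h2
    simp only [Finset.sum_apply, Pi.smul_apply, nsmul_eq_mul]
    rw [h3]
    refine Finset.sum_congr rfl fun i hi => ?_
    change _ = ((z i).toNat : ℤ) * v i a
    rw [Int.toNat_of_nonneg (hz0 i hi)]
  · right
    obtain ⟨D, z, hD, hz⟩ := exists_common_denominator Finset.univ
      fun a => f (Pi.single a 1)
    have hD' : (0 : ℚ) < D := by exact_mod_cast hD
    have key : ∀ x : Fin n → ℤ, ((x ⬝ᵥ z : ℤ) : ℚ) = D * f fun a => (x a : ℚ) := by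
      intro x
      rw [LinearMap.pi_apply_eq_sum_univ f, dotProduct, Finset.mul_sum]
      push_cast
      refine Finset.sum_congr rfl fun a _ => ?_
      rw [← hz a (Finset.mem_univ _), smul_eq_mul]
      have : (fun j => if a = j then (1 : ℚ) else 0) = Pi.single a 1 := by
        ext j; simp [Pi.single_apply, eq_comm]
      rw [this]; ring
    refine ⟨z, fun i hi => ?_, ?_⟩
    · have : (0 : ℚ) ≤ ((v i ⬝ᵥ z : ℤ) : ℚ) := by
        rw [key]; exact mul_nonneg hD'.le (hf i hi)
      exact_mod_cast this
    · have : ((b ⬝ᵥ z : ℤ) : ℚ) < 0 := by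
        rw [key]; exact mul_neg_of_pos_of_neg hD' hfb
      exact_mod_cast this

end Farkas

end RookPutcha

end

noncomputable section

namespace RookPutcha

open Matrix

/-! ### Diagonal and permutation matrices -/

section Monomial

variable {K : Type*} [Field K] {n : ℕ}

/-- The diagonal torus. -/
def diagGL (K : Type*) [Field K] (n : ℕ) : (Fin n → Kˣ) →* GL (Fin n) K :=
  (Units.map (Matrix.diagonalRingHom (Fin n) K).toMonoidHom).comp MulEquiv.piUnits.symm.toMonoidHom

theorem coe_diagGL (t : Fin n → Kˣ) :
    (diagGL K n t : Matrix (Fin n) (Fin n) K) = Matrix.diagonal fun i => (t i : K) := rfl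

theorem diagGL_mem_torus (t : Fin n → Kˣ) : diagGL K n t ∈ torus K n := by
  intro i j h
  rw [coe_diagGL, Matrix.diagonal_apply_ne _ h]

theorem det_ne_zero (g : GL (Fin n) K) : (g : Matrix (Fin n) (Fin n) K).det ≠ 0 :=
  ((Matrix.isUnit_iff_isUnit_det _).1 g.isUnit).ne_zero

theorem mem_torus_iff {g : GL (Fin n) K} : g ∈ torus K n ↔ ∃ t, g = diagGL K n t := by
  constructor
  · intro h
    have hd : (g : Matrix (Fin n) (Fin n) K) =
        Matrix.diagonal fun i => (g : Matrix (Fin n) (Fin n) K) i i := by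
      ext i j
      by_cases hij : i = j
      · subst hij; simp
      · rw [h i j hij, Matrix.diagonal_apply_ne _ hij]
    have hne : ∀ i, (g : Matrix (Fin n) (Fin n) K) i i ≠ 0 := by
      have := det_ne_zero g
      rw [hd, Matrix.det_diagonal, Finset.prod_ne_zero_iff] at this
      exact fun i => this i (Finset.mem_univ i)
    refine ⟨fun i => Units.mk0 _ (hne i), Units.ext ?_⟩
    rw [coe_diagGL]; exact hd
  · rintro ⟨t, rfl⟩; exact diagGL_mem_torus t

theorem rookMatrix_perm_apply (w : Equiv.Perm (Fin n)) (i j : Fin n) :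
    rookMatrix K w.toPEquiv i j = if w j = i then 1 else 0 := by
  simp [rookMatrix, Equiv.toPEquiv]

theorem mul_rookMatrix_apply (x : Matrix (Fin n) (Fin n) K) (w : Equiv.Perm (Fin n))
    (i j : Fin n) : (x * rookMatrix K w.toPEquiv) i j = x i (w j) := by
  simp [Matrix.mul_apply, rookMatrix_perm_apply]

theorem rookMatrix_mul_apply (x : Matrix (Fin n) (Fin n) K) (w : Equiv.Perm (Fin n))
    (i j : Fin n) : (rookMatrix K w.toPEquiv * x) i j = x (w⁻¹ i) j := by
  rw [Matrix.mul_apply, Finset.sum_eq_single (w⁻¹ i)]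
  · rw [rookMatrix_perm_apply, perm_apply_inv_self, if_pos rfl, one_mul]
  · intro b _ hb
    rw [rookMatrix_perm_apply, if_neg, zero_mul]
    rintro rfl; exact hb (perm_inv_apply_self w b).symm
  · simp

theorem rookMatrix_mul (v w : Equiv.Perm (Fin n)) :
    rookMatrix K (v * w).toPEquiv = rookMatrix K v.toPEquiv * rookMatrix K w.toPEquiv := by
  ext i j
  rw [mul_rookMatrix_apply, rookMatrix_perm_apply, rookMatrix_perm_apply]
  rfl

theorem rookMatrix_one : rookMatrix K (1 : Equiv.Perm (Fin n)).toPEquiv = 1 := by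
  ext i j
  rw [rookMatrix_perm_apply, Matrix.one_apply]
  simp [eq_comm]

/-- Permutation matrices in `GL_n`. -/
def permGL (K : Type*) [Field K] (n : ℕ) : Equiv.Perm (Fin n) →* GL (Fin n) K where
  toFun w := ⟨rookMatrix K w.toPEquiv, rookMatrix K w⁻¹.toPEquiv,
    by rw [← rookMatrix_mul, mul_inv_cancel, rookMatrix_one],
    by rw [← rookMatrix_mul, inv_mul_cancel, rookMatrix_one]⟩
  map_one' := Units.ext rookMatrix_one
  map_mul' v w := Units.ext (rookMatrix_mul v w)

theorem coe_permGL (w : Equiv.Perm (Fin n)) :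
    (permGL K n w : Matrix (Fin n) (Fin n) K) = rookMatrix K w.toPEquiv := rfl

theorem permGL_mul_diagGL (w : Equiv.Perm (Fin n)) (t : Fin n → Kˣ) :
    permGL K n w * diagGL K n t = diagGL K n (t ∘ ⇑w⁻¹) * permGL K n w := by
  apply Units.ext
  ext i j
  rw [Units.val_mul, Units.val_mul, coe_permGL, coe_diagGL, coe_diagGL, Matrix.mul_diagonal,
    Matrix.diagonal_mul, rookMatrix_perm_apply]
  split_ifs with h
  · subst h; simp
  · simp

theorem permGL_mem_torusNormalizer (w : Equiv.Perm (Fin n)) :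
    permGL K n w ∈ torusNormalizer K n := by
  intro t
  constructor
  · intro h
    obtain ⟨t, rfl⟩ := mem_torus_iff.1 h
    rw [permGL_mul_diagGL, mul_inv_cancel_right]
    exact diagGL_mem_torus _
  · intro h
    obtain ⟨s, hs⟩ := mem_torus_iff.1 h
    have : t = permGL K n w⁻¹ * diagGL K n s * permGL K n w := by
      rw [← hs, map_inv]; group
    rw [this, permGL_mul_diagGL, mul_assoc, ← map_mul, inv_mul_cancel, map_one, mul_one]
    exact diagGL_mem_torus _

theorem diagGL_mem_torusNormalizer (t : Fin n → Kˣ) : diagGL K n t ∈ torusNormalizer K n := by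
  have key : ∀ u, diagGL K n t * u * (diagGL K n t)⁻¹ ∈ torus K n ↔ u ∈ torus K n := by
    intro u
    constructor
    · intro h
      obtain ⟨s, hs⟩ := mem_torus_iff.1 h
      have : u = diagGL K n (t⁻¹ * s * t) := by
        rw [map_mul, map_mul, ← hs, map_inv]; group
      rw [this]; exact diagGL_mem_torus _
    · intro h
      obtain ⟨s, rfl⟩ := mem_torus_iff.1 h
      rw [← map_inv, ← map_mul, ← map_mul]
      exact diagGL_mem_torus _
  exact fun u => (key u).symm

/-- The normalizer of the torus consists of the monomial matrices. -/
theorem exists_eq_permGL_mul_diagGL [Infinite K] {g : GL (Fin n) K}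
    (hg : g ∈ torusNormalizer K n) : ∃ w t, g = permGL K n w * diagGL K n t := by
  classical
  have : Infinite Kˣ := by
    have : Infinite {x : K // x ≠ 0} :=
      (Set.infinite_coe_iff (s := {x : K | x ≠ 0})).2 (Set.finite_singleton (0 : K)).infinite_compl
    exact Infinite.of_injective (fun x : {x : K // x ≠ 0} => Units.mk0 x.1 x.2) fun a b h => by
      simpa [Units.ext_iff, Subtype.ext_iff] using h
  -- A torus element with distinct entries. Conjugating it into the torus forces `t j = s i` at each
  -- nonzero entry of `g`, so no row has two of them.
  obtain ⟨t⟩ : Nonempty (Fin n ↪ Kˣ) := ⟨Fin.valEmbedding.trans (Infinite.natEmbedding Kˣ)⟩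
  obtain ⟨s, hs⟩ := mem_torus_iff.1 ((hg _).1 (diagGL_mem_torus (t : Fin n → Kˣ)))
  have hgt : g * diagGL K n t = diagGL K n s * g := by rw [← hs]; group
  have hent : ∀ i j, (g : Matrix (Fin n) (Fin n) K) i j ≠ 0 → t j = s i := by
    intro i j hij
    have h1 := congrArg (fun x : GL (Fin n) K => (x : Matrix (Fin n) (Fin n) K) i j) hgt
    simp only [Units.val_mul, coe_diagGL, Matrix.mul_diagonal, Matrix.diagonal_mul] at h1
    rw [mul_comm] at h1
    exact Units.ext (mul_right_cancel₀ hij h1)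
  have hcol : ∀ j, ∃ i, (g : Matrix (Fin n) (Fin n) K) i j ≠ 0 := by
    intro j
    by_contra h
    push Not at h
    exact det_ne_zero g (Matrix.det_eq_zero_of_column_eq_zero j h)
  have hrow : ∀ i, ∃ j, (g : Matrix (Fin n) (Fin n) K) i j ≠ 0 := by
    intro i
    by_contra h
    push Not at h
    exact det_ne_zero g (Matrix.det_eq_zero_of_row_eq_zero i h)
  have huniq : ∀ i j j', (g : Matrix (Fin n) (Fin n) K) i j ≠ 0 →
      (g : Matrix (Fin n) (Fin n) K) i j' ≠ 0 → j = j' := fun i j j' h h' =>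
    t.injective ((hent i j h).trans (hent i j' h').symm)
  choose w hw using hcol
  have hinj : Function.Injective w := fun a b hab => huniq (w a) a b (hw a) (hab ▸ hw b)
  let σ : Equiv.Perm (Fin n) := Equiv.ofBijective w (Finite.injective_iff_bijective.1 hinj)
  refine ⟨σ, fun j => Units.mk0 _ (hw j), Units.ext ?_⟩
  ext i j
  rw [Units.val_mul, coe_permGL, coe_diagGL, Matrix.mul_diagonal, rookMatrix_perm_apply]
  by_cases h : σ j = i
  · subst h; simp [σ]
  · rw [if_neg h, zero_mul]
    by_contra h0
    obtain ⟨j', hj'⟩ := (Finite.injective_iff_surjective.1 hinj) i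
    have := huniq i j j' h0 (hj' ▸ hw j')
    subst this
    exact h hj'

end Monomial

/-! ### Weights of the torus -/

section Weights

variable {K : Type*} [Field K] {n : ℕ}

/-- The character of the torus with the given exponents. -/
def wt (K : Type*) [Field K] {n : ℕ} (χ : Fin n → ℤ) : (Fin n → Kˣ) →* K where
  toFun t := ((∏ i, t i ^ χ i : Kˣ) : K)
  map_one' := by simp
  map_mul' s t := by simp [mul_zpow, Finset.prod_mul_distrib]

theorem wt_apply (χ : Fin n → ℤ) (t : Fin n → Kˣ) :
    wt K χ t = ∏ i, (t i : K) ^ χ i := by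
  simp [wt]

/-- Otherwise the nonzero polynomial `X (X ^ d - 1)` would vanish on the whole infinite field. -/
theorem exists_zpow_ne_one [Infinite K] {m : ℤ} (hm : m ≠ 0) : ∃ x : Kˣ, x ^ m ≠ 1 := by
  classical
  wlog hpos : 0 < m generalizing m
  · obtain ⟨x, hx⟩ := this (m := -m) (by omega) (by omega)
    exact ⟨x, fun h => hx (by rw [_root_.zpow_neg, h, inv_one])⟩
  obtain ⟨d, rfl⟩ := Int.eq_ofNat_of_zero_le hpos.le
  by_contra hcon
  push Not at hcon
  have hd : 0 < d := by exact_mod_cast hpos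
  have : (Polynomial.X * (Polynomial.X ^ d - 1) : Polynomial K) = 0 := by
    refine Polynomial.zero_of_eval_zero _ fun x => ?_
    by_cases hx : x = 0
    · simp [hx]
    · have h1 := congrArg Units.val (hcon (Units.mk0 x hx))
      simp at h1
      simp [h1]
  rcases mul_eq_zero.1 this with h | h
  · exact Polynomial.X_ne_zero h
  · exact Polynomial.X_pow_sub_C_ne_zero hd (1 : K) (by simpa using h)

theorem wt_injective [Infinite K] : Function.Injective (wt K (n := n)) := by
  intro χ ψ h
  ext i
  by_contra hne
  obtain ⟨x, hx⟩ := exists_zpow_ne_one (K := K) (m := χ i - ψ i) (by omega)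
  have h1 : ∀ φ : Fin n → ℤ, wt K φ (Function.update (1 : Fin n → Kˣ) i x) = (x : K) ^ φ i := by
    intro φ
    rw [wt_apply, Finset.prod_eq_single i]
    · simp
    · intro b _ hb; simp [hb]
    · simp
  have h2 := DFunLike.congr_fun h (Function.update (1 : Fin n → Kˣ) i x)
  rw [h1, h1, ← Units.val_zpow_eq_zpow_val, ← Units.val_zpow_eq_zpow_val] at h2
  apply hx
  rw [_root_.zpow_sub, Units.ext h2, mul_inv_cancel]

/-- Dedekind's independence of characters, applied to the pairwise distinct characters `wt K χ`. -/
theorem linearIndependent_wt [Infinite K] :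
    LinearIndependent K fun χ : Fin n → ℤ => (wt K χ : (Fin n → Kˣ) → K) :=
  (linearIndependent_monoidHom (Fin n → Kˣ) K).comp _ wt_injective

/-- The coefficients of a matrix valued character sum are unique. -/
theorem coeff_eq_zero_of_sum_wt [Infinite K] {N : ℕ} (S : Finset (Fin n → ℤ))
    (X : (Fin n → ℤ) → Matrix (Fin N) (Fin N) K) (h : ∀ t, ∑ χ ∈ S, wt K χ t • X χ = 0)
    {χ : Fin n → ℤ} (hχ : χ ∈ S) : X χ = 0 := by
  ext a b
  refine linearIndependent_iff'.1 (linearIndependent_wt (K := K) (n := n)) S (fun χ => X χ a b) ?_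
    χ hχ
  ext t
  have := congrFun (congrFun (h t) a) b
  simp only [Matrix.sum_apply, Matrix.smul_apply, smul_eq_mul, Matrix.zero_apply] at this
  simp only [Finset.sum_apply, Pi.smul_apply, smul_eq_mul, Pi.zero_apply]
  rw [← this]
  exact Finset.sum_congr rfl fun _ _ => mul_comm _ _

theorem coeff_eq_of_sum_wt [Infinite K] {N : ℕ} (S : Finset (Fin n → ℤ))
    (X Y : (Fin n → ℤ) → Matrix (Fin N) (Fin N) K)
    (h : ∀ t, ∑ χ ∈ S, wt K χ t • X χ = ∑ χ ∈ S, wt K χ t • Y χ)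
    {χ : Fin n → ℤ} (hχ : χ ∈ S) : X χ = Y χ := by
  rw [← sub_eq_zero]
  refine coeff_eq_zero_of_sum_wt S (fun χ => X χ - Y χ) (fun t => ?_) hχ
  simp only [smul_sub, Finset.sum_sub_distrib, h t, sub_self]

/-- A regular function on `GL_n` restricts to a combination of characters of the torus. -/
theorem regular_mem_span_wt (p : MvPolynomial (Fin n × Fin n) K) (d : ℕ) :
    (fun t : Fin n → Kˣ => evalMat p (Matrix.diagonal fun i => (t i : K)) *
      ((Matrix.diagonal fun i => (t i : K)).det)⁻¹ ^ d) ∈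
      Submodule.span K (Set.range fun χ : Fin n → ℤ => (wt K χ : (Fin n → Kˣ) → K)) := by
  classical
  have hrw : (fun t : Fin n → Kˣ => evalMat p (Matrix.diagonal fun i => (t i : K)) *
      ((Matrix.diagonal fun i => (t i : K)).det)⁻¹ ^ d) =
      ∑ m ∈ p.support, p.coeff m • fun t : Fin n → Kˣ =>
        (∏ ij : Fin n × Fin n, (Matrix.diagonal (fun i => (t i : K)) ij.1 ij.2) ^ m ij) *
          ((∏ i, (t i : K))⁻¹) ^ d := by
    ext t
    simp only [evalMat, MvPolynomial.eval_eq', Matrix.det_diagonal, Finset.sum_mul,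
      Finset.sum_apply, Pi.smul_apply, smul_eq_mul, mul_assoc]
  rw [hrw]
  refine Submodule.sum_mem _ fun m _ => Submodule.smul_mem _ _ ?_
  by_cases hm : ∃ i j, i ≠ j ∧ m (i, j) ≠ 0
  · obtain ⟨i, j, hij, hmij⟩ := hm
    convert Submodule.zero_mem _ using 1
    ext t
    rw [Finset.prod_eq_zero (Finset.mem_univ (i, j)), zero_mul, Pi.zero_apply]
    simp [Matrix.diagonal_apply_ne _ hij, hmij]
  · push Not at hm
    refine Submodule.subset_span ⟨fun i => (m (i, i) : ℤ) - d, ?_⟩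
    ext t
    change wt K _ t = _
    rw [wt_apply, Fintype.prod_prod_type, ← Finset.prod_inv_distrib, ← Finset.prod_pow,
      ← Finset.prod_mul_distrib]
    refine Finset.prod_congr rfl fun i _ => ?_
    rw [Finset.prod_eq_single i]
    · simp [zpow_sub₀ (t i).ne_zero, div_eq_mul_inv]
    · intro j _ hj
      simp [hm i j (Ne.symm hj)]
    · simp

end Weights

end RookPutcha

end

noncomputable section

namespace RookPutcha

open Matrix

/-! ### The weight decomposition of the torus -/

section WeightDec

variable {K : Type*} [Field K] {n N : ℕ}

/-- The decomposition of the identity into the projections onto the weight spaces of the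
maximal torus. -/
structure WeightDec (M : ReductiveMonoid K n N) where
  /-- the weights -/
  Ω : Finset (Fin n → ℤ)
  /-- the projections onto the weight spaces -/
  A : (Fin n → ℤ) → Matrix (Fin N) (Fin N) K
  map_diag : ∀ t, M.ι (diagGL K n t) = ∑ χ ∈ Ω, wt K χ t • A χ
  ne_zero : ∀ χ ∈ Ω, A χ ≠ 0
  eq_zero : ∀ χ, χ ∉ Ω → A χ = 0
  mul_self : ∀ χ, A χ * A χ = A χ
  mul_ne : ∀ χ ψ, χ ≠ ψ → A χ * A ψ = 0
  sum_eq_one : ∑ χ ∈ Ω, A χ = 1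

theorem exists_characterSum (M : ReductiveMonoid K n N) :
    ∃ (S : Finset (Fin n → ℤ)) (A : (Fin n → ℤ) → Matrix (Fin N) (Fin N) K),
      (∀ χ, χ ∉ S → A χ = 0) ∧ ∀ t, M.ι (diagGL K n t) = ∑ χ ∈ S, wt K χ t • A χ := by
  classical
  have hspan : ∀ a b, ∃ c : (Fin n → ℤ) →₀ K, ∀ t,
      M.ι (diagGL K n t) a b = ∑ χ ∈ c.support, c χ * wt K χ t := by
    intro a b
    obtain ⟨p, d, hp⟩ := M.regular a b
    obtain ⟨c, hc⟩ := (Finsupp.mem_span_range_iff_exists_finsupp).1 (regular_mem_span_wt p d)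
    refine ⟨c, fun t => ?_⟩
    have h1 := hp (diagGL K n t)
    rw [coe_diagGL] at h1
    refine h1.trans ((congrFun hc t).symm.trans ?_)
    simp [Finsupp.sum]
  choose c hc using hspan
  refine ⟨Finset.univ.biUnion fun ab : Fin N × Fin N => (c ab.1 ab.2).support,
    fun χ => Matrix.of fun a b => c a b χ, fun χ hχ => ?_, fun t => ?_⟩
  · ext a b
    simp only [Finset.mem_biUnion, Finset.mem_univ, true_and, not_exists,
      Finsupp.notMem_support_iff] at hχ
    exact hχ (a, b)
  · ext a b
    rw [hc, Matrix.sum_apply]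
    simp only [Matrix.smul_apply, Matrix.of_apply, smul_eq_mul]
    simp only [mul_comm (wt K _ t)]
    refine Finset.sum_subset ?_ ?_
    · exact Finset.subset_biUnion_of_mem (fun ab : Fin N × Fin N => (c ab.1 ab.2).support)
        (Finset.mem_univ (a, b))
    · intro χ _ hχ
      rw [Finsupp.notMem_support_iff.1 hχ, zero_mul]

/-- The restriction to the torus is a character sum with matrix coefficients. Since it is
multiplicative, comparing the coefficients of characters in each of the two torus variables
separately shows that the coefficients are orthogonal idempotents. They sum to `1` by evaluation at
the identity. -/
theorem nonempty_weightDec [Infinite K] (M : ReductiveMonoid K n N) : Nonempty (WeightDec M) := by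
  classical
  obtain ⟨S, A, hA, hS⟩ := exists_characterSum M
  have hmul : ∀ χ ∈ S, ∀ ψ ∈ S, A χ * A ψ = if ψ = χ then A χ else 0 := by
    intro χ hχ ψ hψ
    refine coeff_eq_of_sum_wt S (fun ψ => A χ * A ψ) (fun ψ => if ψ = χ then A χ else 0)
      (fun t => ?_) hψ
    rw [← sub_eq_zero]
    have h1 := coeff_eq_of_sum_wt S (fun χ => A χ * M.ι (diagGL K n t))
      (fun χ => wt K χ t • A χ) (fun s => ?_) hχ
    · rw [hS, Finset.mul_sum] at h1
      simp only [Matrix.mul_smul] at h1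
      rw [h1, sub_eq_zero]
      simp [hχ]
    · have h2 : M.ι (diagGL K n s) * M.ι (diagGL K n t) = M.ι (diagGL K n (s * t)) := by
        rw [map_mul, map_mul]
      rw [hS s, hS (s * t), Finset.sum_mul] at h2
      simp only [Matrix.smul_mul] at h2
      rw [h2]
      refine Finset.sum_congr rfl fun χ _ => ?_
      rw [map_mul, mul_smul]
  refine ⟨⟨S.filter fun χ => A χ ≠ 0, A, fun t => ?_, ?_, ?_, ?_, ?_, ?_⟩⟩
  · rw [hS, Finset.sum_filter_of_ne]
    intro χ _ h h0
    exact h (by rw [h0, smul_zero])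
  · intro χ hχ; exact (Finset.mem_filter.1 hχ).2
  · intro χ hχ
    by_contra h
    exact hχ (Finset.mem_filter.2 ⟨by_contra fun h' => h (hA χ h'), h⟩)
  · intro χ
    by_cases hχ : χ ∈ S
    · rw [hmul χ hχ χ hχ, if_pos rfl]
    · rw [hA χ hχ, zero_mul]
  · intro χ ψ hne
    by_cases hχ : χ ∈ S
    · by_cases hψ : ψ ∈ S
      · rw [hmul χ hχ ψ hψ, if_neg (Ne.symm hne)]
      · rw [hA ψ hψ, mul_zero]
    · rw [hA χ hχ, zero_mul]
  · rw [Finset.sum_filter_ne_zero, ← M.ι.map_one, ← (diagGL K n).map_one, hS]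
    simp

theorem wt_add (χ ψ : Fin n → ℤ) (t : Fin n → Kˣ) :
    wt K (χ + ψ) t = wt K χ t * wt K ψ t := by
  simp only [wt_apply, ← Finset.prod_mul_distrib]
  exact Finset.prod_congr rfl fun i _ => zpow_add₀ (t i).ne_zero _ _

theorem wt_zero (t : Fin n → Kˣ) : wt K (0 : Fin n → ℤ) t = 1 := by simp [wt_apply]

theorem wt_nsmul (m : ℕ) (χ : Fin n → ℤ) (t : Fin n → Kˣ) :
    wt K (m • χ) t = wt K χ t ^ m := by
  induction m with
  | zero => rw [zero_smul, wt_zero, pow_zero]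
  | succ m ih => rw [succ_nsmul, wt_add, ih, pow_succ]

theorem wt_sum (S : Finset (Fin n → ℤ)) (m : (Fin n → ℤ) → ℕ) (t : Fin n → Kˣ) :
    wt K (∑ χ ∈ S, m χ • χ) t = ∏ χ ∈ S, wt K χ t ^ m χ := by
  classical
  induction S using Finset.induction_on with
  | empty => simp [wt_zero]
  | insert a s ha ih => rw [Finset.sum_insert ha, Finset.prod_insert ha, wt_add, wt_nsmul, ih]

/-! ### Weight projections and the idempotents in the closure of the torus -/

namespace WeightDec

variable {M : ReductiveMonoid K n N} (D : WeightDec M)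

theorem mul_map_diag (χ : Fin n → ℤ) (t : Fin n → Kˣ) :
    D.A χ * M.ι (diagGL K n t) = wt K χ t • D.A χ := by
  by_cases hχ : χ ∈ D.Ω
  · rw [D.map_diag, Finset.mul_sum, Finset.sum_eq_single χ]
    · rw [Matrix.mul_smul, D.mul_self]
    · intro ψ _ hψ
      rw [Matrix.mul_smul, D.mul_ne _ _ (Ne.symm hψ), smul_zero]
    · exact fun h => absurd hχ h
  · rw [D.eq_zero χ hχ, zero_mul, smul_zero]

/-- The sum of the projections to a set of weight spaces. -/
def proj (F : Finset (Fin n → ℤ)) : Matrix (Fin N) (Fin N) K := ∑ χ ∈ F, D.A χ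

theorem A_mul_proj [DecidableEq (Fin n → ℤ)] (χ : Fin n → ℤ) (F : Finset (Fin n → ℤ)) :
    D.A χ * D.proj F = if χ ∈ F then D.A χ else 0 := by
  rw [proj, Finset.mul_sum]
  split_ifs with h
  · rw [Finset.sum_eq_single χ]
    · rw [D.mul_self]
    · intro ψ _ hψ; rw [D.mul_ne _ _ (Ne.symm hψ)]
    · exact fun h' => absurd h h'
  · exact Finset.sum_eq_zero fun ψ hψ => D.mul_ne _ _ (by rintro rfl; exact h hψ)

theorem proj_mul_proj [DecidableEq (Fin n → ℤ)] (F G : Finset (Fin n → ℤ)) :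
    D.proj F * D.proj G = D.proj (F ∩ G) := by
  rw [proj, Finset.sum_mul]
  simp only [D.A_mul_proj]
  rw [proj, ← Finset.sum_filter, Finset.filter_mem_eq_inter]

theorem proj_comm (F G : Finset (Fin n → ℤ)) : D.proj F * D.proj G = D.proj G * D.proj F := by
  classical
  rw [proj_mul_proj, proj_mul_proj, Finset.inter_comm]

theorem proj_mul_self (F : Finset (Fin n → ℤ)) : D.proj F * D.proj F = D.proj F := by
  classical
  rw [proj_mul_proj, Finset.inter_self]

theorem subset_of_proj_mul {F G : Finset (Fin n → ℤ)} (hF : F ⊆ D.Ω)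
    (h : D.proj F * D.proj G = D.proj F) : F ⊆ G := by
  classical
  intro χ hχ
  have h1 : D.A χ * (D.proj F * D.proj G) = D.A χ * D.proj F := by rw [h]
  rw [D.proj_mul_proj, A_mul_proj, A_mul_proj, if_pos hχ] at h1
  split_ifs at h1 with h2
  · exact (Finset.mem_inter.1 h2).2
  · exact absurd h1.symm (D.ne_zero χ (hF hχ))

theorem proj_injOn {F G : Finset (Fin n → ℤ)} (hF : F ⊆ D.Ω) (hG : G ⊆ D.Ω)
    (h : D.proj F = D.proj G) : F = G := by
  refine Finset.Subset.antisymm (D.subset_of_proj_mul hF ?_) (D.subset_of_proj_mul hG ?_)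
  · rw [← h, proj_mul_self]
  · rw [h, proj_mul_self]

theorem proj_mul_of_subset {F G : Finset (Fin n → ℤ)} (h : F ⊆ G) :
    D.proj F * D.proj G = D.proj F := by
  classical
  rw [proj_mul_proj, Finset.inter_eq_left.2 h]

theorem proj_Ω : D.proj D.Ω = 1 := D.sum_eq_one

/-- Elements of the closure of the torus are combinations of the weight projections whose
coefficients satisfy the binomial relations between the weights. -/
theorem exists_coeff {y : Matrix (Fin N) (Fin N) K} (hy : y ∈ zariskiClosure M.T) :
    ∃ c : (Fin n → ℤ) → K, y = ∑ χ ∈ D.Ω, c χ • D.A χ ∧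
      ∀ m m' : (Fin n → ℤ) → ℕ, ∑ χ ∈ D.Ω, m χ • χ = ∑ χ ∈ D.Ω, m' χ • χ →
        ∏ χ ∈ D.Ω, c χ ^ m χ = ∏ χ ∈ D.Ω, c χ ^ m' χ := by
  classical
  -- The coefficient at `χ` is a polynomial function, read off at a nonzero entry of `A χ`. On the
  -- torus it is the character `χ`, so multiplicative relations between weights pass to the closure.
  have hex : ∀ χ, ∃ f ∈ polyFun K N, χ ∈ D.Ω → ∀ (x : Matrix (Fin N) (Fin N) K) (s : K),
      D.A χ * x = s • D.A χ → f x = s := by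
    intro χ
    by_cases hχ : χ ∈ D.Ω
    · obtain ⟨a, b, hab⟩ : ∃ a b, D.A χ a b ≠ 0 := by
        by_contra hcon
        push Not at hcon
        exact D.ne_zero χ hχ (by ext a b; exact hcon a b)
      refine ⟨fun x => (D.A χ a b)⁻¹ * (D.A χ * x * (1 : Matrix (Fin N) (Fin N) K)) a b, (polyFun K N).mul_mem
        (const_mem_polyFun _) (mul_entry_mem_polyFun _ _ _ _), fun _ x s h => ?_⟩
      simp only [mul_one, h, Matrix.smul_apply, smul_eq_mul]
      field_simp
    · exact ⟨0, zero_mem _, fun h => absurd h hχ⟩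
  choose f hf hfc using hex
  have hT : ∀ x ∈ M.T, ∃ t, x = M.ι (diagGL K n t) ∧ ∀ χ ∈ D.Ω, f χ x = wt K χ t := by
    rintro _ ⟨g, hg, rfl⟩
    obtain ⟨t, rfl⟩ := mem_torus_iff.1 hg
    exact ⟨t, rfl, fun χ hχ => hfc χ hχ _ _ (D.mul_map_diag χ t)⟩
  refine ⟨fun χ => f χ y, ?_, fun m m' hm => ?_⟩
  · ext a b
    refine eq_of_mem_closure (f := fun x => x a b)
      (g := fun x => (∑ χ ∈ D.Ω, f χ x • D.A χ) a b) hy (entry_mem_polyFun a b) ?_ ?_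
    · simp only [Matrix.sum_apply, Matrix.smul_apply, smul_eq_mul]
      exact sum_mem_polyFun _ _ fun χ _ => (polyFun K N).mul_mem (hf χ) (const_mem_polyFun _)
    · intro x hx
      obtain ⟨t, rfl, ht⟩ := hT x hx
      have h1 : ∑ χ ∈ D.Ω, f χ (M.ι (diagGL K n t)) • D.A χ = ∑ χ ∈ D.Ω, wt K χ t • D.A χ :=
        Finset.sum_congr rfl fun χ hχ => by rw [ht χ hχ]
      exact congrFun (congrFun ((D.map_diag t).trans h1.symm) a) b
  · refine eq_of_mem_closure (f := fun x => ∏ χ ∈ D.Ω, f χ x ^ m χ)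
      (g := fun x => ∏ χ ∈ D.Ω, f χ x ^ m' χ) hy
      (prod_mem_polyFun _ _ fun χ _ => (polyFun K N).pow_mem (hf χ) _)
      (prod_mem_polyFun _ _ fun χ _ => (polyFun K N).pow_mem (hf χ) _) fun x hx => ?_
    obtain ⟨t, rfl, ht⟩ := hT x hx
    rw [Finset.prod_congr rfl fun χ hχ => by rw [ht χ hχ], ← wt_sum, hm, wt_sum]
    exact Finset.prod_congr rfl fun χ hχ => by rw [ht χ hχ]

/-- An idempotent in the closure of the torus is the projection to a face of the set of
weights. -/
theorem exists_face {e : Matrix (Fin N) (Fin N) K} (he : e ∈ zariskiClosure M.T)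
    (hee : e * e = e) :
    ∃ F ⊆ D.Ω, e = D.proj F ∧
      ∀ m m' : (Fin n → ℤ) → ℕ, ∑ χ ∈ D.Ω, m χ • χ = ∑ χ ∈ D.Ω, m' χ • χ →
        (∀ χ ∈ D.Ω, m χ ≠ 0 → χ ∈ F) → ∀ χ ∈ D.Ω, m' χ ≠ 0 → χ ∈ F := by
  classical
  obtain ⟨c, hc, hrel⟩ := D.exists_coeff he
  have hA : ∀ χ ∈ D.Ω, D.A χ * e = c χ • D.A χ := by
    intro χ hχ
    rw [hc, Finset.mul_sum, Finset.sum_eq_single χ]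
    · rw [Matrix.mul_smul, D.mul_self]
    · intro ψ _ hψ
      rw [Matrix.mul_smul, D.mul_ne _ _ (Ne.symm hψ), smul_zero]
    · exact fun h => absurd hχ h
  have h01 : ∀ χ ∈ D.Ω, c χ = 0 ∨ c χ = 1 := by
    intro χ hχ
    have h1 : D.A χ * (e * e) = D.A χ * e := by rw [hee]
    rw [← mul_assoc, hA χ hχ, Matrix.smul_mul, hA χ hχ, smul_smul] at h1
    have h2 := smul_left_injective K (D.ne_zero χ hχ) h1
    have h3 : c χ * (c χ - 1) = 0 := by linear_combination h2
    rcases mul_eq_zero.1 h3 with h | h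
    · exact Or.inl h
    · exact Or.inr (sub_eq_zero.1 h)
  refine ⟨D.Ω.filter fun χ => c χ = 1, Finset.filter_subset _ _, ?_, ?_⟩
  · rw [proj, Finset.sum_filter, hc]
    refine Finset.sum_congr rfl fun χ hχ => ?_
    rcases h01 χ hχ with h | h <;> simp [h]
  · intro m m' hm h χ hχ hm'
    rw [Finset.mem_filter]
    refine ⟨hχ, ?_⟩
    have h1 : ∏ χ ∈ D.Ω, c χ ^ m χ = 1 := by
      refine Finset.prod_eq_one fun ψ hψ => ?_
      by_cases h0 : m ψ = 0
      · rw [h0, pow_zero]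
      · rw [(Finset.mem_filter.1 (h ψ hψ h0)).2, one_pow]
    rw [hrel m m' hm] at h1
    rcases h01 χ hχ with h2 | h2
    · rw [Finset.prod_eq_zero hχ (by rw [h2, zero_pow hm'])] at h1
      exact absurd h1 zero_ne_one
    · exact h2

/-- The weights on which a cocharacter vanishes. -/
def face (ν : Fin n → ℤ) : Finset (Fin n → ℤ) := D.Ω.filter fun χ => χ ⬝ᵥ ν = 0

theorem mem_face {ν χ : Fin n → ℤ} : χ ∈ D.face ν ↔ χ ∈ D.Ω ∧ χ ⬝ᵥ ν = 0 := Finset.mem_filter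

theorem face_subset (ν : Fin n → ℤ) : D.face ν ⊆ D.Ω := Finset.filter_subset _ _

/-- The idempotent that a nonnegative cocharacter tends to. -/
def idem (ν : Fin n → ℤ) : Matrix (Fin N) (Fin N) K := D.proj (D.face ν)

/-- The cocharacters that are nonnegative on all weights. -/
def Nonneg (ν : Fin n → ℤ) : Prop := ∀ χ ∈ D.Ω, 0 ≤ χ ⬝ᵥ ν

/-- For each weight `ψ` outside the face, Farkas' lemma gives a cocharacter that is nonnegative on
all weights, zero on the face and positive on `ψ`. The sum of these vanishes on the face and nowhere
else. -/
theorem exists_cocharacter {e : Matrix (Fin N) (Fin N) K} (he : e ∈ zariskiClosure M.T)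
    (hee : e * e = e) : ∃ ν, D.Nonneg ν ∧ e = D.idem ν := by
  classical
  obtain ⟨F, hF, rfl, hface⟩ := D.exists_face he hee
  have hex : ∀ ψ, ∃ ν : Fin n → ℤ, D.Nonneg ν ∧ (∀ χ ∈ F, χ ⬝ᵥ ν = 0) ∧
      (ψ ∈ D.Ω → ψ ∉ F → 0 < ψ ⬝ᵥ ν) := by
    intro ψ
    by_cases hψ : ψ ∈ D.Ω ∧ ψ ∉ F
    · rcases farkas_int (D.Ω.disjSum F) (Sum.elim id fun χ => -χ) (-ψ) with
        ⟨d, c, hd, hc⟩ | ⟨ν, hν, hlt⟩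
      -- In the other alternative, a positive multiple of `ψ` plus a nonnegative combination of
      -- weights equals a combination of weights of `F`. The binomial relations then put `ψ` into
      -- `F`.
      · exfalso
        rw [Finset.sum_disjSum] at hc
        simp only [Sum.elim_inl, Sum.elim_inr, id, smul_neg, Finset.sum_neg_distrib] at hc
        refine hψ.2 (hface (fun χ => if χ ∈ F then c (Sum.inr χ) else 0)
          (fun χ => c (Sum.inl χ) + if χ = ψ then d else 0) ?_ ?_ ψ hψ.1 ?_)
        · simp only [add_smul, ite_smul, zero_smul, Finset.sum_add_distrib]
          rw [Finset.sum_ite_eq' D.Ω ψ, if_pos hψ.1, ← Finset.sum_filter,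
            Finset.filter_mem_eq_inter, Finset.inter_eq_right.2 hF]
          rw [eq_comm, ← sub_eq_zero]
          rw [eq_comm, ← sub_eq_zero] at hc
          rw [← hc]; abel
        · intro χ _ h0
          by_contra h1
          simp [h1] at h0
        · simp; omega
      · refine ⟨ν, fun χ hχ => ?_, fun χ hχ => le_antisymm ?_ ?_, fun _ _ => ?_⟩
        · exact hν (Sum.inl χ) (by simpa using hχ)
        · have := hν (Sum.inr χ) (by simpa using hχ)
          simpa using this
        · exact hν (Sum.inl χ) (by simpa using hF hχ)
        · simpa using hlt
    · refine ⟨0, fun χ _ => by simp, fun χ _ => by simp, fun h1 h2 => absurd ⟨h1, h2⟩ hψ⟩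
  choose ν hν0 hνF hνψ using hex
  have hsum : ∀ χ : Fin n → ℤ, χ ⬝ᵥ (∑ ψ ∈ D.Ω, ν ψ) = ∑ ψ ∈ D.Ω, χ ⬝ᵥ ν ψ := fun χ =>
    dotProduct_sum _ _ _
  refine ⟨∑ ψ ∈ D.Ω, ν ψ, fun χ hχ => ?_, ?_⟩
  · rw [hsum]; exact Finset.sum_nonneg fun ψ _ => hν0 ψ χ hχ
  · rw [idem]
    congr 1
    ext χ
    rw [mem_face, hsum]
    constructor
    · intro hχ; exact ⟨hF hχ, Finset.sum_eq_zero fun ψ _ => hνF ψ χ hχ⟩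
    · rintro ⟨hχ, h0⟩
      by_contra hχF
      have := (Finset.sum_eq_zero_iff_of_nonneg fun ψ _ => hν0 ψ χ hχ).1 h0 χ hχ
      exact (hνψ χ hχ hχF).ne' this

/-- The value of a cocharacter. -/
def _root_.RookPutcha.cochar (ν : Fin n → ℤ) (x : Kˣ) : Fin n → Kˣ := fun i => x ^ ν i

theorem _root_.RookPutcha.wt_cochar (χ ν : Fin n → ℤ) (x : Kˣ) :
    wt K χ (cochar ν x) = (x : K) ^ (χ ⬝ᵥ ν) := by
  rw [wt_apply, dotProduct]
  have : ∀ s : Finset (Fin n), ∏ i ∈ s, ((cochar ν x i : Kˣ) : K) ^ χ i =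
      (x : K) ^ ∑ i ∈ s, χ i * ν i := by
    classical
    intro s
    induction s using Finset.induction_on with
    | empty => simp
    | insert a s ha ih =>
      rw [Finset.prod_insert ha, Finset.sum_insert ha, ih, zpow_add₀ x.ne_zero, cochar,
        Units.val_zpow_eq_zpow_val, ← _root_.zpow_mul, mul_comm (ν a)]
  exact this _

/-- The polynomial curve of a nonnegative cocharacter. -/
def curve (ν : Fin n → ℤ) : Matrix (Fin N) (Fin N) (Polynomial K) :=
  ∑ χ ∈ D.Ω, (Polynomial.X ^ (χ ⬝ᵥ ν).toNat : Polynomial K) • (D.A χ).map Polynomial.C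

theorem curve_eval (ν : Fin n → ℤ) (x : K) :
    (D.curve ν).map (Polynomial.eval x) = ∑ χ ∈ D.Ω, x ^ (χ ⬝ᵥ ν).toNat • D.A χ := by
  ext a b
  simp only [curve, Matrix.sum_apply, Polynomial.eval_finsetSum, Matrix.map_apply,
    Matrix.smul_apply, smul_eq_mul, Polynomial.eval_mul, Polynomial.eval_pow, Polynomial.eval_X,
    Polynomial.eval_C]

theorem curve_eval_unit {ν : Fin n → ℤ} (hν : D.Nonneg ν) (x : Kˣ) :
    (D.curve ν).map (Polynomial.eval (x : K)) = M.ι (diagGL K n (cochar ν x)) := by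
  rw [curve_eval, D.map_diag]
  refine Finset.sum_congr rfl fun χ hχ => ?_
  rw [wt_cochar, ← zpow_natCast, Int.toNat_of_nonneg (hν χ hχ)]

theorem curve_eval_zero {ν : Fin n → ℤ} (hν : D.Nonneg ν) :
    (D.curve ν).map (Polynomial.eval 0) = D.idem ν := by
  rw [curve_eval, idem, proj, face, Finset.sum_filter]
  refine Finset.sum_congr rfl fun χ hχ => ?_
  have := hν χ hχ
  split_ifs with h
  · simp [h]
  · rw [zero_pow (by omega), zero_smul]

/-- The cocharacter is a polynomial curve because its exponents on the weights are nonnegative; its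
value at zero is the limit. -/
theorem idem_mem_closure [Infinite K] {ν : Fin n → ℤ} (hν : D.Nonneg ν) :
    D.idem ν ∈ zariskiClosure M.T := by
  rw [← D.curve_eval_zero hν]
  refine mem_closure_of_curve _ fun x hx => ?_
  have := D.curve_eval_unit hν (Units.mk0 x hx)
  rw [Units.val_mk0] at this
  rw [this]
  exact ⟨_, diagGL_mem_torus _, rfl⟩

theorem idem_mul_self (ν : Fin n → ℤ) : D.idem ν * D.idem ν = D.idem ν := D.proj_mul_self _

end WeightDec

end WeightDec

end RookPutcha

end

noncomputable section

namespace RookPutcha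

open Matrix

variable {K : Type*} [Field K] {n N : ℕ}

/-! ### The action of the Weyl group on weights -/

theorem dotProduct_comp_perm (χ ν : Fin n → ℤ) (w : Equiv.Perm (Fin n)) :
    (χ ∘ w) ⬝ᵥ (ν ∘ w) = χ ⬝ᵥ ν := by
  simp only [dotProduct, Function.comp]
  exact Equiv.sum_comp w fun i => χ i * ν i

theorem wt_comp_perm (χ : Fin n → ℤ) (w : Equiv.Perm (Fin n)) (t : Fin n → Kˣ) :
    wt K (χ ∘ w) t = wt K χ (t ∘ ⇑w⁻¹) := by
  rw [wt_apply, wt_apply, ← Equiv.prod_comp w fun i => ((t ∘ ⇑w⁻¹) i : K) ^ χ i]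
  simp

theorem comp_perm_inv_comp {α : Type*} (χ : Fin n → α) (w : Equiv.Perm (Fin n)) :
    (χ ∘ ⇑w⁻¹) ∘ ⇑w = χ := by
  ext i; simp

theorem comp_perm_comp_inv {α : Type*} (χ : Fin n → α) (w : Equiv.Perm (Fin n)) :
    (χ ∘ ⇑w) ∘ ⇑w⁻¹ = χ := by
  ext i; simp

namespace WeightDec

variable {M : ReductiveMonoid K n N} (D : WeightDec M)

theorem map_diag_mul (χ : Fin n → ℤ) (t : Fin n → Kˣ) :
    M.ι (diagGL K n t) * D.A χ = wt K χ t • D.A χ := by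
  by_cases hχ : χ ∈ D.Ω
  · rw [D.map_diag, Finset.sum_mul, Finset.sum_eq_single χ]
    · rw [Matrix.smul_mul, D.mul_self]
    · intro ψ _ hψ
      rw [Matrix.smul_mul, D.mul_ne _ _ hψ, smul_zero]
    · exact fun h => absurd hχ h
  · rw [D.eq_zero χ hχ, mul_zero, smul_zero]

theorem map_diag_mul_proj (t : Fin n → Kˣ) (F : Finset (Fin n → ℤ)) :
    M.ι (diagGL K n t) * D.proj F = D.proj F * M.ι (diagGL K n t) := by
  rw [proj, Finset.mul_sum, Finset.sum_mul]
  exact Finset.sum_congr rfl fun χ _ => by rw [D.map_diag_mul, D.mul_map_diag]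

/-- Moving a torus element across the permutation scales the product by two different characters
unless the weights correspond. -/
theorem A_mul_perm_mul_A [Infinite K] (w : Equiv.Perm (Fin n)) {χ ψ : Fin n → ℤ}
    (h : χ ≠ ψ ∘ w) : D.A ψ * M.ι (permGL K n w) * D.A χ = 0 := by
  by_contra hne
  apply h
  apply wt_injective (K := K)
  refine DFunLike.ext _ _ fun t => ?_
  rw [wt_comp_perm]
  have h1 : D.A ψ * M.ι (permGL K n w * diagGL K n t) * D.A χ =
      D.A ψ * M.ι (diagGL K n (t ∘ ⇑w⁻¹) * permGL K n w) * D.A χ := by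
    rw [permGL_mul_diagGL]
  rw [map_mul, map_mul, mul_assoc, mul_assoc, D.map_diag_mul, ← mul_assoc, ← mul_assoc,
    D.mul_map_diag, Matrix.mul_smul, Matrix.smul_mul, Matrix.smul_mul] at h1
  exact smul_left_injective K hne h1

theorem perm_mul_A [Infinite K] (w : Equiv.Perm (Fin n)) (χ : Fin n → ℤ) :
    M.ι (permGL K n w) * D.A χ = D.A (χ ∘ ⇑w⁻¹) * M.ι (permGL K n w) := by
  have h1 : M.ι (permGL K n w) * D.A χ = D.A (χ ∘ ⇑w⁻¹) * M.ι (permGL K n w) * D.A χ := by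
    conv_lhs => rw [← one_mul (M.ι (permGL K n w)), ← D.sum_eq_one, Finset.sum_mul,
      Finset.sum_mul]
    by_cases hmem : χ ∘ ⇑w⁻¹ ∈ D.Ω
    · rw [Finset.sum_eq_single_of_mem _ hmem]
      intro ψ _ hψ
      exact D.A_mul_perm_mul_A w fun h => hψ (by rw [h, comp_perm_comp_inv])
    · rw [D.eq_zero _ hmem, zero_mul, zero_mul]
      refine Finset.sum_eq_zero fun ψ hψ => D.A_mul_perm_mul_A w fun h => hmem ?_
      rwa [h, comp_perm_comp_inv]
  have h2 : D.A (χ ∘ ⇑w⁻¹) * M.ι (permGL K n w) =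
      D.A (χ ∘ ⇑w⁻¹) * M.ι (permGL K n w) * D.A χ := by
    conv_lhs => rw [← mul_one (M.ι (permGL K n w)), ← D.sum_eq_one, Finset.mul_sum,
      Finset.mul_sum]
    by_cases hmem : χ ∈ D.Ω
    · rw [Finset.sum_eq_single_of_mem _ hmem, mul_assoc]
      intro ψ _ hψ
      rw [← mul_assoc]
      exact D.A_mul_perm_mul_A w fun h => hψ (by rw [h, comp_perm_inv_comp])
    · rw [D.eq_zero _ hmem, mul_zero]
      refine Finset.sum_eq_zero fun ψ hψ => ?_
      rw [← mul_assoc]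
      exact D.A_mul_perm_mul_A w fun h => hmem (by rwa [h, comp_perm_inv_comp] at hψ)
  rw [h1, ← h2]

theorem map_inv_mul (g : GL (Fin n) K) : M.ι g⁻¹ * M.ι g = 1 := by
  rw [← map_mul, inv_mul_cancel, map_one]

theorem map_mul_inv (g : GL (Fin n) K) : M.ι g * M.ι g⁻¹ = 1 := by
  rw [← map_mul, mul_inv_cancel, map_one]

theorem comp_perm_inv_mem [Infinite K] (w : Equiv.Perm (Fin n)) {χ : Fin n → ℤ} (hχ : χ ∈ D.Ω) :
    χ ∘ ⇑w⁻¹ ∈ D.Ω := by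
  by_contra h
  have h1 := D.perm_mul_A w χ
  rw [D.eq_zero _ h, zero_mul] at h1
  apply D.ne_zero χ hχ
  rw [← one_mul (D.A χ), ← map_inv_mul (M := M) (permGL K n w), mul_assoc, h1, mul_zero]

theorem comp_perm_mem [Infinite K] (w : Equiv.Perm (Fin n)) {χ : Fin n → ℤ} (hχ : χ ∈ D.Ω) :
    χ ∘ ⇑w ∈ D.Ω := by
  simpa using D.comp_perm_inv_mem w⁻¹ hχ

theorem nonneg_comp_perm [Infinite K] {ν : Fin n → ℤ} (hν : D.Nonneg ν)
    (w : Equiv.Perm (Fin n)) : D.Nonneg (ν ∘ w) := by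
  intro χ hχ
  have h1 := hν _ (D.comp_perm_inv_mem w hχ)
  rwa [← dotProduct_comp_perm _ _ w, comp_perm_inv_comp] at h1

theorem perm_mul_proj [Infinite K] [DecidableEq (Fin n → ℤ)] (w : Equiv.Perm (Fin n))
    (F : Finset (Fin n → ℤ)) :
    M.ι (permGL K n w) * D.proj F = D.proj (F.image fun χ => χ ∘ ⇑w⁻¹) * M.ι (permGL K n w) := by
  rw [proj, proj, Finset.sum_image, Finset.mul_sum, Finset.sum_mul]
  · exact Finset.sum_congr rfl fun χ _ => D.perm_mul_A w χ
  · intro χ _ ψ _ h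
    rw [← comp_perm_inv_comp χ w, ← comp_perm_inv_comp ψ w]
    exact congrArg (· ∘ ⇑w) h

theorem image_face [Infinite K] [DecidableEq (Fin n → ℤ)] (w : Equiv.Perm (Fin n))
    (ν : Fin n → ℤ) : (D.face ν).image (fun χ => χ ∘ ⇑w⁻¹) = D.face (ν ∘ ⇑w⁻¹) := by
  ext χ
  rw [Finset.mem_image, D.mem_face]
  constructor
  · rintro ⟨ψ, hψ, rfl⟩
    rw [D.mem_face] at hψ
    exact ⟨D.comp_perm_inv_mem w hψ.1, by rw [dotProduct_comp_perm]; exact hψ.2⟩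
  · rintro ⟨h1, h2⟩
    refine ⟨χ ∘ ⇑w, D.mem_face.2 ⟨D.comp_perm_mem w h1, ?_⟩, comp_perm_comp_inv χ w⟩
    rw [← dotProduct_comp_perm _ _ w⁻¹, comp_perm_comp_inv]; exact h2

theorem perm_mul_idem [Infinite K] (w : Equiv.Perm (Fin n)) (ν : Fin n → ℤ) :
    M.ι (permGL K n w) * D.idem ν = D.idem (ν ∘ ⇑w⁻¹) * M.ι (permGL K n w) := by
  classical
  rw [idem, perm_mul_proj, image_face, idem]

/-! ### Limits along cocharacters -/

/-- The embedding of `GL_n` is polynomial up to inverse powers of the determinant, which are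
harmless along a curve of constant determinant. -/
theorem exists_polynomial_lift (M : ReductiveMonoid K n N) [Infinite K]
    (Q : Matrix (Fin n) (Fin n) (Polynomial K)) {c : K}
    (hdet : ∀ x, (Q.map (Polynomial.eval x)).det = c) :
    ∃ P : Matrix (Fin N) (Fin N) (Polynomial K), ∀ (x : K) (h : GL (Fin n) K),
      (h : Matrix (Fin n) (Fin n) K) = Q.map (Polynomial.eval x) →
        M.ι h = P.map (Polynomial.eval x) := by
  choose p d hp using M.regular
  refine ⟨Matrix.of fun a b => MvPolynomial.aeval (fun ij : Fin n × Fin n => Q ij.1 ij.2) (p a b) *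
    Polynomial.C (c⁻¹ ^ d a b), fun x h hx => ?_⟩
  ext a b
  have h1 := hp a b h
  rw [hx, hdet] at h1
  refine h1.trans ?_
  rw [Matrix.map_apply, Matrix.of_apply, Polynomial.eval_mul, Polynomial.eval_C]
  congr 1
  rw [← Polynomial.coe_evalRingHom, MvPolynomial.aeval_def, MvPolynomial.hom_eval₂]
  change MvPolynomial.eval₂ (RingHom.id K) _ _ = _
  congr 1
  ext; simp

theorem map_eval_mul (P Q : Matrix (Fin N) (Fin N) (Polynomial K)) (x : K) :
    (P * Q).map (Polynomial.eval x) = P.map (Polynomial.eval x) * Q.map (Polynomial.eval x) :=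
  Matrix.map_mul (f := Polynomial.evalRingHom x)

theorem map_eval_zero_eq [Infinite K] {P Q : Matrix (Fin N) (Fin N) (Polynomial K)}
    (h : ∀ x ≠ 0, P.map (Polynomial.eval x) = Q.map (Polynomial.eval x)) :
    P.map (Polynomial.eval 0) = Q.map (Polynomial.eval 0) := by
  ext a b
  have := eval_zero_eq_zero (P a b - Q a b) fun x hx => by
    rw [Polynomial.eval_sub, sub_eq_zero]
    exact congrFun (congrFun (h x hx) a) b
  rwa [Polynomial.eval_sub, sub_eq_zero] at this

/-- The conjugate of a matrix by a cocharacter, as a polynomial matrix. -/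
def _root_.RookPutcha.conjCurve (ν : Fin n → ℤ) (g : Matrix (Fin n) (Fin n) K) :
    Matrix (Fin n) (Fin n) (Polynomial K) :=
  Matrix.of fun i j => Polynomial.C (g i j) * Polynomial.X ^ (ν j - ν i).toNat

theorem _root_.RookPutcha.diag_mul_conjCurve {ν : Fin n → ℤ} {g : Matrix (Fin n) (Fin n) K}
    (hg : ∀ i j, ν j < ν i → g i j = 0) (x : Kˣ) :
    (diagGL K n (cochar ν x) : Matrix (Fin n) (Fin n) K) *
      (conjCurve ν g).map (Polynomial.eval (x : K)) = g * diagGL K n (cochar ν x) := by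
  ext i j
  rw [coe_diagGL, Matrix.diagonal_mul, Matrix.mul_diagonal]
  simp only [conjCurve, Matrix.map_apply, Matrix.of_apply, Polynomial.eval_mul, Polynomial.eval_C,
    Polynomial.eval_pow, Polynomial.eval_X, cochar, Units.val_zpow_eq_zpow_val]
  by_cases h : ν j < ν i
  · rw [hg i j h]; simp
  · have h1 : (x : K) ^ ν j = (x : K) ^ ν i * (x : K) ^ (ν j - ν i).toNat := by
      rw [← zpow_natCast, ← zpow_add₀ x.ne_zero]
      congr 1; omega
    rw [h1]; ring

theorem _root_.RookPutcha.conjCurve_eval_zero {ν : Fin n → ℤ} {g : Matrix (Fin n) (Fin n) K}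
    (hg : ∀ i j, ν j < ν i → g i j = 0) (i j : Fin n) :
    (conjCurve ν g).map (Polynomial.eval 0) i j = if ν i = ν j then g i j else 0 := by
  simp only [conjCurve, Matrix.map_apply, Matrix.of_apply, Polynomial.eval_mul, Polynomial.eval_C,
    Polynomial.eval_pow, Polynomial.eval_X]
  rcases lt_trichotomy (ν i) (ν j) with h | h | h
  · rw [if_neg h.ne, zero_pow (by omega), mul_zero]
  · simp [h]
  · rw [hg i j h]; simp

/-- For `x ≠ 0` the curve is a conjugate of `g`; the value at `0` follows by polynomial continuity.
-/
theorem _root_.RookPutcha.det_conjCurve [Infinite K] {ν : Fin n → ℤ}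
    {g : Matrix (Fin n) (Fin n) K} (hg : ∀ i j, ν j < ν i → g i j = 0) (x : K) :
    ((conjCurve ν g).map (Polynomial.eval x)).det = g.det := by
  have hne : ∀ x ≠ 0, ((conjCurve ν g).map (Polynomial.eval x)).det = g.det := by
    intro x hx
    have h1 := congrArg Matrix.det (diag_mul_conjCurve hg (Units.mk0 x hx))
    rw [Matrix.det_mul, Matrix.det_mul, mul_comm] at h1
    exact mul_right_cancel₀ (det_ne_zero _) h1
  have hev : ∀ x, ((conjCurve ν g).map (Polynomial.eval x)).det =
      ((conjCurve ν g).det).eval x := fun x =>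
    (RingHom.map_det (Polynomial.evalRingHom x) (conjCurve ν g)).symm
  by_cases hx : x = 0
  · subst hx
    have := eval_zero_eq_zero ((conjCurve ν g).det - Polynomial.C g.det) fun x hx => by
      rw [Polynomial.eval_sub, Polynomial.eval_C, ← hev, hne x hx, sub_self]
    rw [Polynomial.eval_sub, Polynomial.eval_C, ← hev, sub_eq_zero] at this
    exact this
  · exact hne x hx

/-- A matrix in the parabolic subgroup attached to a cocharacter acts on the limit idempotent
through its Levi part. -/
theorem exists_mul_idem [Infinite K] {ν : Fin n → ℤ} (hν : D.Nonneg ν) {g : GL (Fin n) K}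
    (hg : ∀ i j, ν j < ν i → (g : Matrix (Fin n) (Fin n) K) i j = 0) :
    ∃ g₀ : GL (Fin n) K, (∀ i j, (g₀ : Matrix (Fin n) (Fin n) K) i j =
      if ν i = ν j then (g : Matrix (Fin n) (Fin n) K) i j else 0) ∧
      M.ι g * D.idem ν = D.idem ν * M.ι g₀ := by
  obtain ⟨P, hP⟩ := exists_polynomial_lift M (conjCurve ν (g : Matrix (Fin n) (Fin n) K))
    (det_conjCurve hg)
  have hGL : ∀ x, ∃ h : GL (Fin n) K, (h : Matrix (Fin n) (Fin n) K) =
      (conjCurve ν (g : Matrix (Fin n) (Fin n) K)).map (Polynomial.eval x) := fun x =>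
    ⟨Matrix.GeneralLinearGroup.mkOfDetNeZero
      ((conjCurve ν (g : Matrix (Fin n) (Fin n) K)).map (Polynomial.eval x))
      ((det_conjCurve hg x).trans_ne (det_ne_zero g)), rfl⟩
  obtain ⟨g₀, hg₀⟩ := hGL 0
  refine ⟨g₀, fun i j => by rw [hg₀, conjCurve_eval_zero hg], ?_⟩
  -- With `ν(x)` the cocharacter, `g ν(x) = ν(x) (ν(x)⁻¹ g ν(x))` for `x ≠ 0`. Both sides are
  -- polynomial in `x` after embedding, and at `x = 0` the conjugate becomes the Levi part of `g`.
  have hlim := map_eval_zero_eq (P := (M.ι g).map Polynomial.C * D.curve ν) (Q := D.curve ν * P)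
    fun x hx => ?_
  · rw [map_eval_mul, map_eval_mul, D.curve_eval_zero hν, ← hP 0 g₀ hg₀] at hlim
    rw [← hlim]
    congr 1
    ext a b; simp
  · obtain ⟨h, hh⟩ := hGL x
    rw [map_eval_mul, map_eval_mul, ← hP x h hh]
    have h1 := D.curve_eval_unit hν (Units.mk0 x hx)
    rw [Units.val_mk0] at h1
    have h2 : ((M.ι g).map Polynomial.C).map (Polynomial.eval x) = M.ι g := by ext a b; simp
    rw [h1, h2, ← map_mul, ← map_mul]
    congr 1
    apply Units.ext
    rw [Units.val_mul, Units.val_mul, hh]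
    exact (diag_mul_conjCurve hg (Units.mk0 x hx)).symm

/-- The same for the opposite parabolic subgroup. -/
theorem exists_idem_mul [Infinite K] {ν : Fin n → ℤ} (hν : D.Nonneg ν) {g : GL (Fin n) K}
    (hg : ∀ i j, ν i < ν j → (g : Matrix (Fin n) (Fin n) K) i j = 0) :
    ∃ g₀ : GL (Fin n) K, (∀ i j, (g₀ : Matrix (Fin n) (Fin n) K) i j =
      if ν i = ν j then (g : Matrix (Fin n) (Fin n) K) i j else 0) ∧
      D.idem ν * M.ι g = M.ι g₀ * D.idem ν := by
  have hg' : ∀ i j, (-ν) j < (-ν) i → (g : Matrix (Fin n) (Fin n) K) i j = 0 := fun i j h =>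
    hg i j (by simpa using h)
  obtain ⟨P, hP⟩ := exists_polynomial_lift M (conjCurve (-ν) (g : Matrix (Fin n) (Fin n) K))
    (det_conjCurve hg')
  have hGL : ∀ x, ∃ h : GL (Fin n) K, (h : Matrix (Fin n) (Fin n) K) =
      (conjCurve (-ν) (g : Matrix (Fin n) (Fin n) K)).map (Polynomial.eval x) := fun x =>
    ⟨Matrix.GeneralLinearGroup.mkOfDetNeZero
      ((conjCurve (-ν) (g : Matrix (Fin n) (Fin n) K)).map (Polynomial.eval x))
      ((det_conjCurve hg' x).trans_ne (det_ne_zero g)), rfl⟩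
  obtain ⟨g₀, hg₀⟩ := hGL 0
  refine ⟨g₀, fun i j => by rw [hg₀, conjCurve_eval_zero hg']; simp, ?_⟩
  have hlim := map_eval_zero_eq (P := D.curve ν * (M.ι g).map Polynomial.C) (Q := P * D.curve ν)
    fun x hx => ?_
  · rw [map_eval_mul, map_eval_mul, D.curve_eval_zero hν, ← hP 0 g₀ hg₀] at hlim
    rw [← hlim]
    congr 1
    ext a b; simp
  · obtain ⟨h, hh⟩ := hGL x
    rw [map_eval_mul, map_eval_mul, ← hP x h hh]
    have h1 := D.curve_eval_unit hν (Units.mk0 x hx)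
    rw [Units.val_mk0] at h1
    have h2 : ((M.ι g).map Polynomial.C).map (Polynomial.eval x) = M.ι g := by ext a b; simp
    rw [h1, h2, ← map_mul, ← map_mul]
    congr 1
    have h3 : diagGL K n (cochar (-ν) (Units.mk0 x hx)) * h =
        g * diagGL K n (cochar (-ν) (Units.mk0 x hx)) := by
      apply Units.ext
      rw [Units.val_mul, Units.val_mul, hh]
      exact diag_mul_conjCurve hg' (Units.mk0 x hx)
    have h4 : cochar (-ν) (Units.mk0 x hx) = (cochar ν (Units.mk0 x hx))⁻¹ := by
      ext i; simp [cochar]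
    rw [h4, map_inv] at h3
    rw [inv_mul_eq_iff_eq_mul.1 h3]
    group

end WeightDec

end RookPutcha

end

noncomputable section

namespace RookPutcha

open Matrix

variable {K : Type*} [Field K] {n N : ℕ}

/-! ### Elementary matrices -/

theorem coe_transvection_mul {a b : Fin n} (h : a ≠ b) (c : K) :
    Matrix.transvection a b c * Matrix.transvection a b (-c) = 1 := by
  rw [Matrix.transvection_mul_transvection_same a b h, add_neg_cancel, Matrix.transvection_zero]

/-- Elementary matrices as elements of `GL_n`. -/
def transGL {a b : Fin n} (h : a ≠ b) (c : K) : GL (Fin n) K :=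
  ⟨Matrix.transvection a b c, Matrix.transvection a b (-c), coe_transvection_mul h c, by
    simpa using coe_transvection_mul h (-c)⟩

theorem transGL_apply {a b : Fin n} (h : a ≠ b) (c : K) (i j : Fin n) :
    (transGL h c : Matrix (Fin n) (Fin n) K) i j =
      (if i = j then 1 else 0) + if a = i ∧ b = j then c else 0 := by
  change Matrix.transvection a b c i j = _
  rw [Matrix.transvection, Matrix.add_apply, Matrix.one_apply, Matrix.single_apply]

theorem transGL_mem_borel {a b : Fin n} (h : a < b) (c : K) : transGL h.ne c ∈ borel K n := by
  intro i j hij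
  rw [transGL_apply, if_neg hij.ne', if_neg, add_zero]
  rintro ⟨rfl, rfl⟩
  exact absurd h (not_lt.2 hij.le)

theorem transGL_product {a b : Fin n} (h : a ≠ b) :
    transGL h (1 : K) * transGL h.symm (-1) * transGL h 1 =
      permGL K n (Equiv.swap a b) * diagGL K n (Function.update (1 : Fin n → Kˣ) a (-1)) := by
  apply Units.ext
  ext i j
  rw [Units.val_mul, Units.val_mul, Units.val_mul, coe_permGL, coe_diagGL, Matrix.mul_diagonal,
    rookMatrix_perm_apply]
  have h3 : ∀ (x : Matrix (Fin n) (Fin n) K) (a b : Fin n) (h : a ≠ b) (c : K) (i j : Fin n),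
      (x * (transGL h c : Matrix (Fin n) (Fin n) K)) i j = x i j + if b = j then x i a * c else 0 := by
    intro x a b h c i j
    rw [Matrix.mul_apply]
    simp only [transGL_apply, mul_add, Finset.sum_add_distrib]
    simp only [mul_ite, mul_one, mul_zero, Finset.sum_ite_eq', Finset.mem_univ, if_true]
    congr 1
    by_cases hb : b = j <;> simp [hb]
  rw [h3, h3, h3, transGL_apply, transGL_apply, transGL_apply]
  by_cases hja : j = a
  · subst hja
    by_cases hib : i = b
    · subst hib; simp [h, h.symm]
    · by_cases hij : i = j
      · subst hij; simp [h, h.symm]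
      · simp [h.symm, hib, hij, Ne.symm hib, Ne.symm hij]
  · by_cases hjb : j = b
    · subst hjb
      by_cases hia : i = a
      · subst hia; simp [h, h.symm]
      · by_cases hij : i = j
        · subst hij; simp [h, h.symm]
        · simp [h, h.symm, hia, hij, Ne.symm hia]
    · rw [Equiv.swap_apply_of_ne_of_ne hja hjb]
      simp [Ne.symm hja, Ne.symm hjb, eq_comm]

/-! ### The cross-section lattice -/

section Lattice

variable {M : ReductiveMonoid K n N}

theorem mem_Λ_iff {e : Matrix (Fin N) (Fin N) K} :
    e ∈ M.Λ ↔ e ∈ zariskiClosure M.T ∧ e * e = e ∧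
      ∀ b ∈ borel K n, e * M.ι b * e = M.ι b * e := by
  constructor
  · rintro ⟨h1, h2, h3⟩
    refine ⟨h1, h2, fun b hb => ?_⟩
    have h4 : M.ι b * e ∈ (fun b => b * e) '' M.B := ⟨_, ⟨b, hb, rfl⟩, rfl⟩
    rw [h3] at h4
    obtain ⟨x, -, hx⟩ := h4
    simp only at hx
    rw [mul_assoc, ← hx, ← mul_assoc, ← mul_assoc, h2]
  · rintro ⟨h1, h2, h3⟩
    refine ⟨h1, h2, Set.image_congr ?_⟩
    rintro _ ⟨b, hb, rfl⟩
    exact (h3 b hb).symm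

theorem ι_injective (M : ReductiveMonoid K n N) : Function.Injective M.ι := by
  intro g h hgh
  exact M.unitIso.injective (Units.ext (Subtype.ext hgh))

/-! ### Types of limit idempotents -/

namespace WeightDec

variable (D : WeightDec M)

theorem diag_mul_idem (t : Fin n → Kˣ) (ν : Fin n → ℤ) :
    M.ι (diagGL K n t) * D.idem ν = D.idem ν * M.ι (diagGL K n t) := D.map_diag_mul_proj t _

theorem idem_mem_Λ [Infinite K] {ν : Fin n → ℤ} (hν : D.Nonneg ν) (hmono : Monotone ν) :
    D.idem ν ∈ M.Λ := by
  refine mem_Λ_iff.2 ⟨D.idem_mem_closure hν, D.idem_mul_self ν, fun b hb => ?_⟩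
  obtain ⟨g₀, -, h⟩ := D.exists_mul_idem hν (g := b) fun i j hij => hb i j (hmono.reflect_lt hij)
  rw [mul_assoc, h, ← mul_assoc, D.idem_mul_self]

/-- The equation `s e = e s` in the Renner monoid holds on the nose. -/
theorem mem_typeMap_iff [Infinite K] {ν : Fin n → ℤ} {s : Equiv.Perm (Fin n)} :
    s ∈ M.typeMap (D.idem ν) ↔ s ∈ simpleReflections n ∧
      M.ι (permGL K n s) * D.idem ν = D.idem ν * M.ι (permGL K n s) := by
  constructor
  · rintro ⟨h1, g, hg, _, ⟨u, hu, rfl⟩, h2⟩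
    have hgs : g = permGL K n s := Units.ext hg
    obtain ⟨t, rfl⟩ := mem_torus_iff.1 hu
    subst hgs
    refine ⟨h1, ?_⟩
    have h3 : M.ι (permGL K n s) * M.ι (diagGL K n t) =
        M.ι (diagGL K n (t ∘ ⇑s⁻¹)) * M.ι (permGL K n s) := by
      rw [← map_mul, permGL_mul_diagGL, map_mul]
    set P := M.ι (permGL K n s) with hP
    set u := M.ι (diagGL K n (t ∘ ⇑s⁻¹)) with hu
    set e := D.idem ν with he
    set e' := D.idem (ν ∘ ⇑s⁻¹) with he'
    have h4 : P * e = e' * P := D.perm_mul_idem s ν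
    have hPP : P * M.ι (permGL K n s)⁻¹ = 1 := map_mul_inv (M := M) _
    -- The conjugate `e'` of `e` is again idempotent, and `u` is an invertible element commuting
    -- with `e`. So `e u u = e u`, and cancelling `u` removes the torus factor.
    have h5 : e' = e * u := by
      have : e' * P = e * u * P := by rw [← h4, h2, mul_assoc, h3, mul_assoc]
      calc e' = e' * P * M.ι (permGL K n s)⁻¹ := by rw [mul_assoc, hPP, mul_one]
        _ = e * u := by rw [this, mul_assoc, hPP, mul_one]
    have h6 : u * e = e * u := D.diag_mul_idem _ _
    have h7 : e * u * u = e * u := by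
      calc e * u * u = e * (e * u) * u := by rw [← mul_assoc, D.idem_mul_self]
        _ = e * (u * e) * u := by rw [h6]
        _ = (e * u) * (e * u) := by simp only [mul_assoc]
        _ = e * u := by rw [← h5]; exact D.idem_mul_self _
    have huu : u * M.ι (diagGL K n (t ∘ ⇑s⁻¹))⁻¹ = 1 := map_mul_inv (M := M) _
    have h8 : e * u = e := by
      calc e * u = e * u * u * M.ι (diagGL K n (t ∘ ⇑s⁻¹))⁻¹ := by
            rw [mul_assoc (e * u), huu, mul_one]
        _ = e := by rw [h7, mul_assoc, huu, mul_one]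
    rw [h4, h5, h8]
  · rintro ⟨h1, h2⟩
    exact ⟨h1, permGL K n s, rfl, 1, ⟨1, by rw [← (diagGL K n).map_one]; exact diagGL_mem_torus _,
      map_one _⟩, by rw [h2, mul_one]⟩

theorem perm_commute_iff [Infinite K] {ν : Fin n → ℤ} {w : Equiv.Perm (Fin n)} :
    M.ι (permGL K n w) * D.idem ν = D.idem ν * M.ι (permGL K n w) ↔
      ∀ χ ∈ D.face ν, χ ∘ ⇑w⁻¹ ∈ D.face ν := by
  classical
  rw [idem, D.perm_mul_proj]
  constructor
  · intro h χ hχ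
    have h1 : D.proj ((D.face ν).image fun χ => χ ∘ ⇑w⁻¹) = D.proj (D.face ν) := by
      rw [← mul_one (D.proj _), ← map_mul_inv (M := M) (permGL K n w), ← mul_assoc, h, mul_assoc,
        map_mul_inv, mul_one]
    have h2 := D.proj_injOn ?_ (D.face_subset ν) h1
    · rw [← h2]; exact Finset.mem_image_of_mem _ hχ
    · rw [D.image_face]; exact D.face_subset _
  · intro h
    congr 2
    refine Finset.eq_of_subset_of_card_le ?_ ?_
    · intro χ hχ
      obtain ⟨ψ, hψ, rfl⟩ := Finset.mem_image.1 hχ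
      exact h ψ hψ
    · rw [Finset.card_image_of_injective]
      intro χ ψ hχψ
      rw [← comp_perm_inv_comp χ w, ← comp_perm_inv_comp ψ w]
      exact congrArg (· ∘ ⇑w) hχψ

/-- If both root subgroups of a reflection fix an idempotent, so does the reflection, up to the
torus. -/
theorem swap_mul_diag_mul {e : Matrix (Fin N) (Fin N) K} {a b : Fin n} (hab : a ≠ b)
    (h1 : ∀ c : K, M.ι (transGL hab c) * e = e) (h2 : ∀ c : K, M.ι (transGL hab.symm c) * e = e) :
    M.ι (permGL K n (Equiv.swap a b)) *
      M.ι (diagGL K n (Function.update (1 : Fin n → Kˣ) a (-1))) * e = e := by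
  rw [← map_mul, ← transGL_product hab, map_mul, map_mul, mul_assoc, h1, mul_assoc, h2, h1]

/-- With `X = w t` and `e'` the conjugate of `e` by `w`, the hypothesis gives `e' = e X⁻¹`, whence
`e' e = e` and `e e' = e'`. As the two projections commute, they agree. -/
theorem commute_of_mul_eq [Infinite K] {ν : Fin n → ℤ} {w : Equiv.Perm (Fin n)}
    {t : Fin n → Kˣ} (h : M.ι (permGL K n w) * M.ι (diagGL K n t) * D.idem ν = D.idem ν) :
    M.ι (permGL K n w) * D.idem ν = D.idem ν * M.ι (permGL K n w) := by
  set X := permGL K n w * diagGL K n t with hX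
  rw [← map_mul, ← hX] at h
  have h1 : M.ι X * D.idem ν = D.idem (ν ∘ ⇑w⁻¹) * M.ι X := by
    rw [hX, map_mul, mul_assoc, D.diag_mul_idem, ← mul_assoc, D.perm_mul_idem, mul_assoc]
  have h2 : M.ι X⁻¹ * D.idem ν = D.idem ν := by
    conv_lhs => rw [← h]
    rw [← mul_assoc, map_inv_mul, one_mul]
  have h3 : D.idem (ν ∘ ⇑w⁻¹) = D.idem ν * M.ι X⁻¹ := by
    rw [← h, h1, mul_assoc, map_mul_inv, mul_one]
  have h4 : D.idem (ν ∘ ⇑w⁻¹) * D.idem ν = D.idem ν := by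
    rw [h3, mul_assoc, h2, D.idem_mul_self]
  have h5 : D.idem (ν ∘ ⇑w⁻¹) * D.idem ν = D.idem (ν ∘ ⇑w⁻¹) := by
    rw [idem, idem, D.proj_comm]
    change D.idem ν * D.idem (ν ∘ ⇑w⁻¹) = D.idem (ν ∘ ⇑w⁻¹)
    rw [h3, ← mul_assoc, D.idem_mul_self]
  rw [D.perm_mul_idem, ← h5, h4]

/-- Below a unique maximal element. -/
theorem le_of_unique_max (D : WeightDec M) {ε : Matrix (Fin N) (Fin N) K} (hε : ∀ f, M.IsMaxProper f ↔ f = ε)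
    {e : Matrix (Fin N) (Fin N) K} (he : e ∈ M.Λ) (he1 : e ≠ 1) : e = ε * e ∧ e = e * ε := by
  classical
  obtain ⟨F, hF, rfl, -⟩ := D.exists_face (mem_Λ_iff.1 he).1 (mem_Λ_iff.1 he).2.1
  -- Among the proper elements of `Λ` above `e`, one with a largest set of weights is maximal, hence
  -- equal to `ε`.
  obtain ⟨G, hG, hmax⟩ := Finset.exists_max_image
    (D.Ω.powerset.filter fun G => F ⊆ G ∧ D.proj G ∈ M.Λ ∧ D.proj G ≠ 1) Finset.card
    ⟨F, by simp [hF, he, he1]⟩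
  simp only [Finset.mem_filter, Finset.mem_powerset] at hG hmax
  obtain ⟨hGΩ, hFG, hGΛ, hG1⟩ := hG
  have hmp : M.IsMaxProper (D.proj G) := by
    refine ⟨hGΛ, hG1, fun f hf hf1 h1 h2 => ?_⟩
    obtain ⟨G', hG', rfl, -⟩ := D.exists_face (mem_Λ_iff.1 hf).1 (mem_Λ_iff.1 hf).2.1
    have hsub := D.subset_of_proj_mul hGΩ h2.symm
    have hcard := hmax G' ⟨hG', hFG.trans hsub, hf, hf1⟩
    rw [Finset.eq_of_subset_of_card_le hsub hcard]
  rw [← (hε _).1 hmp, D.proj_comm, D.proj_mul_of_subset hFG]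
  exact ⟨rfl, rfl⟩

end WeightDec

end Lattice

end RookPutcha

end

noncomputable section

namespace RookPutcha

open Matrix

variable {K : Type*} [Field K] {n N : ℕ} {M : ReductiveMonoid K n N}

/-! ### The maximal idempotent of a dual canonical monoid -/

theorem dotProduct_comp_swap_sub (χ μ : Fin n → ℤ) {a b : Fin n} (h : a ≠ b) :
    (χ ∘ Equiv.swap a b) ⬝ᵥ μ - χ ⬝ᵥ μ = (χ a - χ b) * (μ b - μ a) := by
  rw [dotProduct, dotProduct, ← Finset.sum_sub_distrib, Fintype.sum_eq_add a b h]
  · simp; ring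
  · rintro i ⟨h1, h2⟩
    simp [Equiv.swap_apply_of_ne_of_ne h1 h2]

/-- The maximal proper idempotent is the limit of a regular cocharacter. -/
structure IsMaxCocharacter (D : WeightDec M) (μ : Fin n → ℤ) : Prop where
  nonneg : D.Nonneg μ
  mono : StrictMono μ
  isMaxProper_iff : ∀ f, M.IsMaxProper f ↔ f = D.idem μ

theorem strictMono_of_adjacent {μ : Fin n → ℤ}
    (h : ∀ (i : ℕ) (hi : i + 1 < n), μ ⟨i, i.lt_succ_self.trans hi⟩ < μ ⟨i + 1, hi⟩) :
    StrictMono μ := by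
  obtain _ | n := n
  · intro a; exact a.elim0
  · rw [Fin.strictMono_iff_lt_succ]
    intro i
    exact h i.val (by omega)

/-- If `μ` fails to increase strictly from `i` to `i + 1`, the corresponding simple reflection
commutes with the idempotent, contradicting the empty type. When the two values agree the reflection
fixes `μ`; when they decrease, both of its root subgroups fix the idempotent. -/
theorem exists_isMaxCocharacter [Infinite K] (D : WeightDec M) (hM : M.IsDualCanonical) :
    ∃ μ, IsMaxCocharacter D μ := by
  obtain ⟨ε, hmax, htype⟩ := hM
  have hε := ((hmax ε).2 rfl).1
  obtain ⟨μ, hμ, rfl⟩ := D.exists_cocharacter (mem_Λ_iff.1 hε).1 (mem_Λ_iff.1 hε).2.1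
  refine ⟨μ, hμ, strictMono_of_adjacent fun i hi => ?_, hmax⟩
  set a : Fin n := ⟨i, i.lt_succ_self.trans hi⟩ with ha
  set b : Fin n := ⟨i + 1, hi⟩ with hb
  have hab : a < b := Fin.lt_def.2 (by simp [ha, hb])
  by_contra hle
  rw [not_lt] at hle
  suffices hcomm : M.ι (permGL K n (Equiv.swap a b)) * D.idem μ =
      D.idem μ * M.ι (permGL K n (Equiv.swap a b)) by
    have : Equiv.swap a b ∈ M.typeMap (D.idem μ) :=
      D.mem_typeMap_iff.2 ⟨⟨i, hi, by omega, rfl⟩, hcomm⟩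
    rw [htype] at this
    exact this
  rcases hle.lt_or_eq with hlt | heq
  · have hentry : ∀ {x y : Fin n} (hxy : x ≠ y) (c : K) (i j : Fin n), μ i = μ j →
        μ x ≠ μ y → (transGL hxy c : Matrix (Fin n) (Fin n) K) i j =
          (1 : Matrix (Fin n) (Fin n) K) i j := by
      intro x y hxy c i j hij hne
      rw [transGL_apply, Matrix.one_apply, if_neg (c := x = i ∧ y = j), add_zero]
      rintro ⟨rfl, rfl⟩; exact hne hij
    have hone : ∀ {x y : Fin n} (hxy : x ≠ y) (c : K) (g₀ : GL (Fin n) K), μ x ≠ μ y →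
        (∀ i j, (g₀ : Matrix (Fin n) (Fin n) K) i j =
          if μ i = μ j then (transGL hxy c : Matrix (Fin n) (Fin n) K) i j else 0) → g₀ = 1 := by
      intro x y hxy c g₀ hne hg
      apply Units.ext
      ext i j
      rw [hg, Units.val_one]
      split_ifs with h
      · exact hentry hxy c i j h hne
      · rw [Matrix.one_apply_ne]; rintro rfl; exact h rfl
    have h2 : ∀ c : K, M.ι (transGL hab.ne.symm c) * D.idem μ = D.idem μ := by
      intro c
      obtain ⟨g₀, hg₀, h⟩ := D.exists_mul_idem hμ (g := transGL hab.ne.symm c) fun x y hxy => by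
        rw [transGL_apply, if_neg (by rintro rfl; omega), if_neg, add_zero]
        rintro ⟨rfl, rfl⟩; omega
      rw [h, hone _ c g₀ hlt.ne hg₀, map_one, mul_one]
    -- This root subgroup lies in the opposite parabolic of `μ` with trivial Levi part, so `e u =
    -- e`. Since `u` is in the Borel subgroup and `e` in `Λ`, also `u e = e u e = e`.
    have h1 : ∀ c : K, M.ι (transGL hab.ne c) * D.idem μ = D.idem μ := by
      intro c
      obtain ⟨g₀, hg₀, h⟩ := D.exists_idem_mul hμ (g := transGL hab.ne c) fun x y hxy => by
        rw [transGL_apply, if_neg (by rintro rfl; omega), if_neg, add_zero]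
        rintro ⟨rfl, rfl⟩; omega
      rw [hone _ c g₀ hlt.ne' hg₀, map_one, one_mul] at h
      rw [← (mem_Λ_iff.1 hε).2.2 _ (transGL_mem_borel hab c), h, D.idem_mul_self]
    exact D.commute_of_mul_eq (WeightDec.swap_mul_diag_mul hab.ne h1 h2)
  · have hcomp : μ ∘ ⇑(Equiv.swap a b)⁻¹ = μ := by
      rw [Equiv.swap_inv]
      ext x
      by_cases hxa : x = a
      · subst hxa; simp [heq]
      · by_cases hxb : x = b
        · subst hxb; simp [heq]
        · simp [Equiv.swap_apply_of_ne_of_ne hxa hxb]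
    rw [D.perm_mul_idem, hcomp]

/-! ### Consequences of the regularity of the maximal cocharacter -/

namespace IsMaxCocharacter

variable {D : WeightDec M} {μ : Fin n → ℤ}

theorem idem_ne_one (hμ : IsMaxCocharacter D μ) : D.idem μ ≠ 1 :=
  ((hμ.isMaxProper_iff _).2 rfl).2.1

theorem mul_eq (hμ : IsMaxCocharacter D μ) {e : Matrix (Fin N) (Fin N) K} (he : e ∈ M.Λ)
    (he1 : e ≠ 1) : D.idem μ * e = e ∧ e * D.idem μ = e :=
  ⟨(D.le_of_unique_max hμ.isMaxProper_iff he he1).1.symm,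
    (D.le_of_unique_max hμ.isMaxProper_iff he he1).2.symm⟩

/-- The Borel subgroup acts on the proper elements of the lattice through the torus. -/
theorem borel_mul [Infinite K] (hμ : IsMaxCocharacter D μ) {e : Matrix (Fin N) (Fin N) K}
    (he : D.idem μ * e = e) {b : GL (Fin n) K}
    (hb : b ∈ borel K n) :
    ∃ t : Fin n → Kˣ, (∀ i, (t i : K) = (b : Matrix (Fin n) (Fin n) K) i i) ∧
      M.ι b * e = M.ι (diagGL K n t) * e := by
  obtain ⟨g₀, hg₀, h⟩ := D.exists_mul_idem hμ.nonneg (g := b) fun i j hij =>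
    hb i j (hμ.mono.lt_iff_lt.1 hij)
  have hT : g₀ ∈ torus K n := by
    intro i j hij
    rw [hg₀, if_neg]
    exact fun h => hij (hμ.mono.injective h)
  obtain ⟨t, rfl⟩ := mem_torus_iff.1 hT
  refine ⟨t, fun i => ?_, ?_⟩
  · have := hg₀ i i
    rw [if_pos rfl, coe_diagGL, Matrix.diagonal_apply_eq] at this
    exact this
  · rw [← he, ← mul_assoc, h, ← D.diag_mul_idem, mul_assoc]

/-- The opposite Borel subgroup acts from the right through the torus. -/
theorem mul_opposite_borel [Infinite K] (hμ : IsMaxCocharacter D μ)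
    {e : Matrix (Fin N) (Fin N) K} (he : e * D.idem μ = e) {b : GL (Fin n) K}
    (hb : ∀ i j, i < j → (b : Matrix (Fin n) (Fin n) K) i j = 0) :
    ∃ t : Fin n → Kˣ, e * M.ι b = e * M.ι (diagGL K n t) := by
  obtain ⟨g₀, hg₀, h⟩ := D.exists_idem_mul hμ.nonneg (g := b) fun i j hij =>
    hb i j (hμ.mono.lt_iff_lt.1 hij)
  have hT : g₀ ∈ torus K n := by
    intro i j hij
    rw [hg₀, if_neg]
    exact fun h => hij (hμ.mono.injective h)
  obtain ⟨t, rfl⟩ := mem_torus_iff.1 hT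
  refine ⟨t, ?_⟩
  rw [← he, mul_assoc, h, D.diag_mul_idem, ← mul_assoc]

theorem idem_mem_Λ_of_subset [Infinite K] (hμ : IsMaxCocharacter D μ) {ν : Fin n → ℤ}
    (hν : D.Nonneg ν) (h : D.face ν ⊆ D.face μ) : D.idem ν ∈ M.Λ := by
  refine mem_Λ_iff.2 ⟨D.idem_mem_closure hν, D.idem_mul_self ν, fun b hb => ?_⟩
  have h1 : D.idem μ * D.idem ν = D.idem ν := by
    rw [WeightDec.idem, WeightDec.idem, D.proj_comm, D.proj_mul_of_subset h]
  obtain ⟨t, -, ht⟩ := hμ.borel_mul h1 hb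
  rw [mul_assoc, ht, ← mul_assoc, ← D.diag_mul_idem, mul_assoc, D.idem_mul_self]

/-- The weights of the maximal idempotent are dominant. -/
theorem antitone_of_mem_face [Infinite K] (hμ : IsMaxCocharacter D μ) {χ : Fin n → ℤ}
    (hχ : χ ∈ D.face μ) : Antitone χ := by
  intro a b hab
  rcases hab.eq_or_lt with rfl | hlt
  · exact le_rfl
  rw [D.mem_face] at hχ
  have h1 := hμ.nonneg _ (D.comp_perm_mem (Equiv.swap a b) hχ.1)
  have h2 := dotProduct_comp_swap_sub χ μ hlt.ne
  have h3 := hμ.mono hlt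
  by_contra h4
  nlinarith

theorem comp_swap_mem_face_iff [Infinite K] (hμ : IsMaxCocharacter D μ) {χ : Fin n → ℤ}
    (hχ : χ ∈ D.face μ) {a b : Fin n} (hab : a < b) :
    χ ∘ Equiv.swap a b ∈ D.face μ ↔ χ a = χ b := by
  rw [D.mem_face] at *
  have h2 := dotProduct_comp_swap_sub χ μ hab.ne
  have h3 := hμ.mono hab
  constructor
  · rintro ⟨-, h⟩
    rw [h, hχ.2, sub_zero, eq_comm, mul_eq_zero] at h2
    omega
  · intro h
    refine ⟨D.comp_perm_mem _ hχ.1, ?_⟩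
    rw [h, hχ.2, sub_self, zero_mul, sub_zero] at h2
    exact h2

/-- Every proper idempotent lies below a conjugate of the maximal one. -/
theorem exists_face_subset [Infinite K] (hμ : IsMaxCocharacter D μ) {ν : Fin n → ℤ}
    (hν : D.Nonneg ν) (h1 : D.idem ν ≠ 1) :
    ∃ w : Equiv.Perm (Fin n), D.face ν ⊆ D.face (μ ∘ w) := by
  -- Sorting `ν` makes its idempotent an element of `Λ`, to which the maximality of `D.idem μ`
  -- applies.
  set σ := Tuple.sort ν with hσ
  have hmono : Monotone (ν ∘ σ) := Tuple.monotone_sort ν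
  have hΛ := D.idem_mem_Λ (D.nonneg_comp_perm hν σ) hmono
  have hne : D.idem (ν ∘ σ) ≠ 1 := by
    intro h
    have h2 := D.perm_mul_idem σ (ν ∘ σ)
    rw [h, mul_one, comp_perm_comp_inv] at h2
    apply h1
    rw [← mul_one (D.idem ν), ← WeightDec.map_mul_inv (M := M) (permGL K n σ), ← mul_assoc, ← h2]
  have hsub := D.subset_of_proj_mul (D.face_subset _) (hμ.mul_eq hΛ hne).2
  refine ⟨σ⁻¹, fun χ hχ => ?_⟩
  rw [D.mem_face] at hχ ⊢
  have h3 : χ ∘ σ ∈ D.face (ν ∘ σ) :=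
    D.mem_face.2 ⟨D.comp_perm_mem σ hχ.1, by rw [dotProduct_comp_perm]; exact hχ.2⟩
  have h4 := (D.mem_face.1 (hsub h3)).2
  refine ⟨hχ.1, ?_⟩
  rw [← dotProduct_comp_perm _ _ σ, comp_perm_inv_comp]
  exact h4

/-- The embedding of `GL_n` is injective, so a cocharacter acting trivially on all weight spaces is
trivial. -/
theorem _root_.RookPutcha.WeightDec.eq_zero_of_vanishing [Infinite K] (D : WeightDec M)
    {ν : Fin n → ℤ} (h : ∀ χ ∈ D.Ω, χ ⬝ᵥ ν = 0) : ν = 0 := by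
  ext i
  by_contra hne
  obtain ⟨x, hx⟩ := exists_zpow_ne_one (K := K) hne
  apply hx
  have h1 : M.ι (diagGL K n (cochar ν x)) = M.ι 1 := by
    rw [D.map_diag, map_one, ← D.sum_eq_one]
    refine Finset.sum_congr rfl fun χ hχ => ?_
    rw [wt_cochar, h χ hχ, zpow_zero, one_smul]
  have h2 := congrArg (fun g : GL (Fin n) K => (g : Matrix (Fin n) (Fin n) K) i i)
    (ι_injective M h1)
  simp only [coe_diagGL, Matrix.diagonal_apply_eq, Units.val_one, Matrix.one_apply_eq] at h2
  exact Units.ext h2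

theorem exists_mem_pos (hμ : IsMaxCocharacter D μ) : ∃ χ ∈ D.Ω, 0 < χ ⬝ᵥ μ := by
  by_contra h
  push Not at h
  apply hμ.idem_ne_one
  rw [WeightDec.idem, ← D.proj_Ω]
  congr 1
  exact Finset.Subset.antisymm (D.face_subset μ) fun χ hχ =>
    D.mem_face.2 ⟨hχ, le_antisymm (h χ hχ) (hμ.nonneg χ hχ)⟩

theorem dotProduct_comp_perm_le {χ μ : Fin n → ℤ} (hχ : Antitone χ) (hμ : Monotone μ)
    (w : Equiv.Perm (Fin n)) : χ ⬝ᵥ μ ≤ χ ⬝ᵥ (μ ∘ w) := by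
  have h : Antivary χ μ := hχ.antivary hμ
  have := h.sum_smul_le_sum_smul_comp_perm (σ := w)
  simpa [dotProduct] using this

/-- The cone of nonnegative cocharacters is generated by the conjugates of `μ`; hence a dominant
vector orthogonal to `μ` is nonnegative on it. -/
theorem dotProduct_nonneg [Infinite K] (hμ : IsMaxCocharacter D μ) {χ₀ : Fin n → ℤ}
    (hanti : Antitone χ₀) (horth : χ₀ ⬝ᵥ μ = 0) {ν : Fin n → ℤ} (hν : D.Nonneg ν) :
    0 ≤ χ₀ ⬝ᵥ ν := by
  classical
  induction hN : (D.Ω.filter fun χ => χ ⬝ᵥ ν ≠ 0).card using Nat.strong_induction_on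
    generalizing ν with
  | _ m ih =>
    by_cases h1 : D.idem ν = 1
    · have hz : ν = 0 := D.eq_zero_of_vanishing fun χ hχ => by
        rw [← D.proj_Ω] at h1
        have := D.proj_injOn (D.face_subset ν) (Finset.Subset.refl _) h1
        rw [← this] at hχ
        exact (D.mem_face.1 hχ).2
      rw [hz, dotProduct_zero]
    obtain ⟨w, hw⟩ := hμ.exists_face_subset hν h1
    have hμw := D.nonneg_comp_perm hμ.nonneg w
    have hposne : (D.Ω.filter fun χ => 0 < χ ⬝ᵥ (μ ∘ w)).Nonempty := by
      obtain ⟨χ, hχ, hpos⟩ := hμ.exists_mem_pos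
      exact ⟨χ ∘ w, Finset.mem_filter.2 ⟨D.comp_perm_mem w hχ, by
        rwa [dotProduct_comp_perm]⟩⟩
    -- The minimal ratio is the largest multiple of `μ ∘ w` that can be subtracted from `ν` while
    -- staying nonnegative. Afterwards `χ₁` vanishes too and no earlier vanishing is lost, so the
    -- induction proceeds; denominators are cleared by `a`.
    obtain ⟨χ₁, hχ₁, hmin⟩ := Finset.exists_min_image _
      (fun χ => ((χ ⬝ᵥ ν : ℤ) : ℚ) / ((χ ⬝ᵥ (μ ∘ w) : ℤ) : ℚ)) hposne
    obtain ⟨hχ₁Ω, ha⟩ := Finset.mem_filter.1 hχ₁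
    set a := χ₁ ⬝ᵥ (μ ∘ w) with hadef
    set b := χ₁ ⬝ᵥ ν with hbdef
    have hb : 0 < b := by
      refine lt_of_le_of_ne (hν χ₁ hχ₁Ω) fun h0 => ?_
      have := (D.mem_face.1 (hw (D.mem_face.2 ⟨hχ₁Ω, h0.symm⟩))).2
      omega
    have hdot : ∀ χ : Fin n → ℤ, χ ⬝ᵥ (a • ν - b • (μ ∘ w)) =
        a * (χ ⬝ᵥ ν) - b * (χ ⬝ᵥ (μ ∘ w)) := fun χ => by
      rw [dotProduct_sub, dotProduct_smul, dotProduct_smul, smul_eq_mul, smul_eq_mul]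
    have hν' : D.Nonneg (a • ν - b • (μ ∘ w)) := by
      intro χ hχ
      rw [hdot]
      rcases (hμw χ hχ).eq_or_lt with h0 | hpos
      · rw [← h0, mul_zero, sub_zero]
        exact mul_nonneg ha.le (hν χ hχ)
      · have h2 := hmin χ (Finset.mem_filter.2 ⟨hχ, hpos⟩)
        rw [div_le_div_iff₀ (by exact_mod_cast ha) (by exact_mod_cast hpos)] at h2
        have h3 : b * (χ ⬝ᵥ (μ ∘ w)) ≤ (χ ⬝ᵥ ν) * a := by exact_mod_cast h2
        linarith
    have hlt : (D.Ω.filter fun χ => χ ⬝ᵥ (a • ν - b • (μ ∘ w)) ≠ 0).card < m := by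
      rw [← hN]
      refine Finset.card_lt_card ⟨fun χ hχ => ?_, fun hsub => ?_⟩
      · rw [Finset.mem_filter] at hχ ⊢
        refine ⟨hχ.1, fun h0 => hχ.2 ?_⟩
        rw [hdot, h0, (D.mem_face.1 (hw (D.mem_face.2 ⟨hχ.1, h0⟩))).2]
        simp
      · have := (Finset.mem_filter.1 (hsub (Finset.mem_filter.2 ⟨hχ₁Ω, hb.ne'⟩))).2
        apply this
        rw [hdot, ← hadef, ← hbdef]; ring
    have h2 := ih _ hlt hν' rfl
    rw [hdot] at h2
    -- By rearrangement, `μ` itself minimizes the pairing of the dominant vector with the conjugates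
    -- of `μ`, and there the value is zero.
    have h3 := dotProduct_comp_perm_le hanti hμ.mono.monotone w
    rw [horth] at h3
    have h4 : 0 ≤ a * (χ₀ ⬝ᵥ ν) := by nlinarith
    exact nonneg_of_mul_nonneg_right h4 ha

/-! ### Types of idempotents -/

theorem swap_mem_typeMap_iff [Infinite K] (hμ : IsMaxCocharacter D μ) {ν : Fin n → ℤ}
    (hsub : D.face ν ⊆ D.face μ) (i : ℕ) (hi : i + 1 < n) :
    Equiv.swap (⟨i, i.lt_succ_self.trans hi⟩ : Fin n) ⟨i + 1, hi⟩ ∈ M.typeMap (D.idem ν) ↔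
      ∀ χ ∈ D.face ν, χ ⟨i, i.lt_succ_self.trans hi⟩ = χ ⟨i + 1, hi⟩ := by
  have hlt : (⟨i, i.lt_succ_self.trans hi⟩ : Fin n) < ⟨i + 1, hi⟩ := Fin.lt_def.2 (by simp)
  rw [D.mem_typeMap_iff, D.perm_commute_iff]
  simp only [Equiv.swap_inv]
  constructor
  · rintro ⟨-, h⟩ χ hχ
    exact (hμ.comp_swap_mem_face_iff (hsub hχ) hlt).1 (hsub (h χ hχ))
  · intro h
    refine ⟨⟨i, hi, by omega, rfl⟩, fun χ hχ => ?_⟩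
    have : χ ∘ Equiv.swap (⟨i, i.lt_succ_self.trans hi⟩ : Fin n) ⟨i + 1, hi⟩ = χ := by
      ext x
      by_cases hxa : x = ⟨i, i.lt_succ_self.trans hi⟩
      · subst hxa; simp [h χ hχ]
      · by_cases hxb : x = ⟨i + 1, hi⟩
        · subst hxb; simp [h χ hχ]
        · simp [Equiv.swap_apply_of_ne_of_ne hxa hxb]
    rwa [this]

theorem _root_.RookPutcha.swap_mem_firstSimple_iff {k i : ℕ} (hi : i + 1 < n) :
    Equiv.swap (⟨i, i.lt_succ_self.trans hi⟩ : Fin n) ⟨i + 1, hi⟩ ∈ firstSimple n k ↔ i < k := by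
  constructor
  · rintro ⟨j, hj, hjk, h⟩
    have h1 := congrArg (fun w => w (⟨i, i.lt_succ_self.trans hi⟩ : Fin n)) h
    simp only [Equiv.swap_apply_left] at h1
    by_contra hik
    rw [Equiv.swap_apply_of_ne_of_ne] at h1
    · simp at h1
    · rw [Ne, Fin.mk.injEq]; omega
    · intro h2
      rw [Fin.mk.injEq] at h2
      subst h2
      have h3 := congrArg (fun w => w (⟨j, by omega⟩ : Fin n)) h
      simp only [Equiv.swap_apply_left] at h3
      rw [Equiv.swap_apply_of_ne_of_ne] at h3
      · simp at h3
      · rw [Ne, Fin.mk.injEq]; omega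
      · rw [Ne, Fin.mk.injEq]; omega
  · intro h; exact ⟨i, hi, h, rfl⟩

theorem typeMap_eq_firstSimple_iff [Infinite K] (hμ : IsMaxCocharacter D μ) {ν : Fin n → ℤ}
    (hsub : D.face ν ⊆ D.face μ) {k : ℕ} :
    M.typeMap (D.idem ν) = firstSimple n k ↔ ∀ (i : ℕ) (hi : i + 1 < n), i < k ↔
      ∀ χ ∈ D.face ν, χ ⟨i, i.lt_succ_self.trans hi⟩ = χ ⟨i + 1, hi⟩ := by
  constructor
  · intro h i hi
    rw [← hμ.swap_mem_typeMap_iff hsub i hi, h, swap_mem_firstSimple_iff]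
  · intro h
    ext s
    constructor
    · intro hs
      obtain ⟨i, hi, -, rfl⟩ := hs.1
      rw [swap_mem_firstSimple_iff, h i hi, ← hμ.swap_mem_typeMap_iff hsub i hi]
      exact hs
    · rintro ⟨i, hi, hik, rfl⟩
      rw [hμ.swap_mem_typeMap_iff hsub i hi, ← h i hi]
      exact hik

theorem _root_.RookPutcha.antitone_of_succ_le {χ : Fin n → ℤ}
    (h : ∀ (i : ℕ) (hi : i + 1 < n), χ ⟨i + 1, hi⟩ ≤ χ ⟨i, i.lt_succ_self.trans hi⟩) :
    Antitone χ := by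
  obtain _ | n := n
  · intro a; exact a.elim0
  · rw [Fin.antitone_iff_succ_le]
    intro i
    exact h i.val (by omega)

/-- The type determines the idempotent. -/
theorem mem_face_of_type [Infinite K] (hμ : IsMaxCocharacter D μ) {ν : Fin n → ℤ}
    (hν : D.Nonneg ν) (hsub : D.face ν ⊆ D.face μ) {k : ℕ}
    (htype : M.typeMap (D.idem ν) = firstSimple n k) {ψ : Fin n → ℤ} (hψ : ψ ∈ D.face μ)
    (hψk : ∀ (i : ℕ) (hi : i + 1 < n), i < k →
      ψ ⟨i, i.lt_succ_self.trans hi⟩ = ψ ⟨i + 1, hi⟩) : ψ ∈ D.face ν := by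
  classical
  rw [hμ.typeMap_eq_firstSimple_iff hsub] at htype
  have hex : ∀ i : ℕ, ∃ χ : Fin n → ℤ, (χ ∈ D.face ν ∨ χ = 0) ∧
      ∀ hi : i + 1 < n, k ≤ i → χ ⟨i + 1, hi⟩ < χ ⟨i, i.lt_succ_self.trans hi⟩ := by
    intro i
    by_cases h : ∃ _ : i + 1 < n, k ≤ i
    · obtain ⟨hi, hk⟩ := h
      have h1 := (htype i hi).not.1 (by omega)
      push Not at h1
      obtain ⟨χ, hχ, hne⟩ := h1
      refine ⟨χ, Or.inl hχ, fun _ _ => lt_of_le_of_ne ?_ hne.symm⟩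
      exact hμ.antitone_of_mem_face (hsub hχ) (Fin.le_def.2 (by simp))
    · exact ⟨0, Or.inr rfl, fun hi hk => absurd ⟨hi, hk⟩ h⟩
  choose f hf hfi using hex
  set ρ := ∑ i ∈ Finset.range n, f i with hρ
  -- `ρ` strictly decreases at every `i ≥ k`, and `L` bounds all differences of values of `ψ`. So `L
  -- • ρ - ψ` is dominant and orthogonal to `μ`, hence nonnegative on `ν`; as `ρ` vanishes on `ν`,
  -- this forces `ψ` to vanish there.
  set L : ℤ := ∑ x : Fin n, 2 * |ψ x| with hL
  have hfanti : ∀ i, Antitone (f i) := fun i => by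
    rcases hf i with h | h
    · exact hμ.antitone_of_mem_face (hsub h)
    · rw [h]; exact antitone_const
  have hdotρ : ∀ ν', (∀ χ ∈ D.face ν, χ ⬝ᵥ ν' = 0) → ρ ⬝ᵥ ν' = 0 := by
    intro ν' h
    rw [hρ, sum_dotProduct]
    refine Finset.sum_eq_zero fun i _ => ?_
    rcases hf i with h1 | h1
    · exact h _ h1
    · rw [h1, zero_dotProduct]
  have hLψ : ∀ x y, ψ x - ψ y ≤ L := by
    intro x y
    have h1 : ∀ z, 2 * |ψ z| ≤ L := fun z =>
      Finset.single_le_sum (f := fun x => 2 * |ψ x|) (fun _ _ => by positivity)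
        (Finset.mem_univ z)
    have h2 := h1 x
    have h3 := h1 y
    have h4 := le_abs_self (ψ x)
    have h5 := neg_abs_le (ψ y)
    omega
  have hL0 : 0 ≤ L := Finset.sum_nonneg fun _ _ => by positivity
  have hanti : Antitone (L • ρ - ψ) := by
    refine antitone_of_succ_le fun i hi => ?_
    simp only [Pi.sub_apply, Pi.smul_apply, smul_eq_mul]
    by_cases hik : i < k
    · have h1 : ρ ⟨i, i.lt_succ_self.trans hi⟩ = ρ ⟨i + 1, hi⟩ := by
        rw [hρ, Finset.sum_apply, Finset.sum_apply]
        refine Finset.sum_congr rfl fun j _ => ?_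
        rcases hf j with h | h
        · exact (htype i hi).1 hik _ h
        · rw [h]; rfl
      rw [h1, hψk i hi hik]
    · have h1 : ρ ⟨i + 1, hi⟩ < ρ ⟨i, i.lt_succ_self.trans hi⟩ := by
        rw [hρ, Finset.sum_apply, Finset.sum_apply]
        refine Finset.sum_lt_sum (fun j _ => hfanti j (Fin.le_def.2 (by simp)))
          ⟨i, Finset.mem_range.2 (by omega), hfi i hi (by omega)⟩
      have h2 := hLψ ⟨i, i.lt_succ_self.trans hi⟩ ⟨i + 1, hi⟩
      nlinarith
  have horth : (L • ρ - ψ) ⬝ᵥ μ = 0 := by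
    rw [sub_dotProduct, smul_dotProduct, hdotρ μ fun χ hχ => (D.mem_face.1 (hsub hχ)).2,
      (D.mem_face.1 hψ).2]
    simp
  have h1 := hμ.dotProduct_nonneg hanti horth hν
  rw [sub_dotProduct, smul_dotProduct, hdotρ ν fun χ hχ => (D.mem_face.1 hχ).2, smul_zero,
    zero_sub] at h1
  have hψΩ := (D.mem_face.1 hψ).1
  exact D.mem_face.2 ⟨hψΩ, le_antisymm (by omega) (hν ψ hψΩ)⟩

theorem idem_eq_of_type [Infinite K] (hμ : IsMaxCocharacter D μ) {k : ℕ}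
    {e f : Matrix (Fin N) (Fin N) K} (he : e ∈ M.Λ) (he1 : e ≠ 1)
    (hek : M.typeMap e = firstSimple n k) (hf : f ∈ M.Λ) (hf1 : f ≠ 1)
    (hfk : M.typeMap f = firstSimple n k) : e = f := by
  obtain ⟨ν, hν, rfl⟩ := D.exists_cocharacter (mem_Λ_iff.1 he).1 (mem_Λ_iff.1 he).2.1
  obtain ⟨ν', hν', rfl⟩ := D.exists_cocharacter (mem_Λ_iff.1 hf).1 (mem_Λ_iff.1 hf).2.1
  have hsub := D.subset_of_proj_mul (D.face_subset _) (hμ.mul_eq he he1).2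
  have hsub' := D.subset_of_proj_mul (D.face_subset _) (hμ.mul_eq hf hf1).2
  have h := (hμ.typeMap_eq_firstSimple_iff hsub).1 hek
  have h' := (hμ.typeMap_eq_firstSimple_iff hsub').1 hfk
  rw [WeightDec.idem, WeightDec.idem]
  congr 1
  ext χ
  constructor
  · intro hχ
    exact hμ.mem_face_of_type hν' hsub' hfk (hsub hχ) fun i hi hik => (h i hi).1 hik χ hχ
  · intro hχ
    exact hμ.mem_face_of_type hν hsub hek (hsub' hχ) fun i hi hik => (h' i hi).1 hik χ hχ

/-- The central cocharacter pairs nontrivially with `μ`. -/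
theorem sum_ne_zero [Infinite K] (hμ : IsMaxCocharacter D μ) : ∑ i, μ i ≠ 0 := by
  intro h0
  obtain ⟨χ, hχ, hpos⟩ := hμ.exists_mem_pos
  have hconst : ∀ i j : Fin n, ∑ w : Equiv.Perm (Fin n), μ (w i) =
      ∑ w : Equiv.Perm (Fin n), μ (w j) := by
    intro i j
    rw [← Equiv.sum_comp (Equiv.mulRight (Equiv.swap i j))]
    simp
  -- The average of the conjugates of `μ` is constant, so it vanishes with the sum of the entries.
  -- Nonnegativity of each conjugate on `χ` then forces all the pairings to be zero.
  have hzero : ∀ i : Fin n, ∑ w : Equiv.Perm (Fin n), μ (w i) = 0 := by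
    intro i
    have h1 : ∑ j : Fin n, ∑ w : Equiv.Perm (Fin n), μ (w j) = 0 := by
      rw [Finset.sum_comm]
      refine Finset.sum_eq_zero fun w _ => ?_
      rw [Equiv.sum_comp w μ, h0]
    rw [Finset.sum_congr rfl fun j _ => hconst j i, Finset.sum_const, Finset.card_univ,
      Fintype.card_fin, nsmul_eq_mul] at h1
    rcases mul_eq_zero.1 h1 with h | h
    · have : n = 0 := by exact_mod_cast h
      subst this; exact i.elim0
    · exact h
  have h1 : ∑ w : Equiv.Perm (Fin n), χ ⬝ᵥ (μ ∘ w) = 0 := by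
    simp only [dotProduct, Function.comp]
    rw [Finset.sum_comm]
    refine Finset.sum_eq_zero fun i _ => ?_
    rw [← Finset.mul_sum, hzero, mul_zero]
  have h2 := (Finset.sum_eq_zero_iff_of_nonneg fun w _ =>
    D.nonneg_comp_perm hμ.nonneg w χ hχ).1 h1 1 (Finset.mem_univ _)
  have h3 : χ ⬝ᵥ (μ ∘ ⇑(1 : Equiv.Perm (Fin n))) = χ ⬝ᵥ μ := rfl
  omega

/-- Every initial segment of the simple reflections is the type of a proper idempotent. -/
theorem exists_of_type [Infinite K] (hμ : IsMaxCocharacter D μ) (k : ℕ) :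
    ∃ e ∈ M.Λ, e ≠ 1 ∧ M.typeMap e = firstSimple n k := by
  classical
  let W : Finset (Equiv.Perm (Fin n)) := Finset.univ.filter fun w => w ∈ fixLast n (k + 1)
  -- Summing the conjugates of `μ` under `W_I` cuts the face down to the weights that vanish on all
  -- of them.
  set ν : Fin n → ℤ := ∑ w ∈ W, μ ∘ w with hνdef
  have hdot : ∀ χ : Fin n → ℤ, χ ⬝ᵥ ν = ∑ w ∈ W, χ ⬝ᵥ (μ ∘ w) := fun χ => dotProduct_sum _ _ _
  have hν : D.Nonneg ν := fun χ hχ => by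
    rw [hdot]; exact Finset.sum_nonneg fun w _ => D.nonneg_comp_perm hμ.nonneg w χ hχ
  have hface : ∀ χ, χ ∈ D.face ν ↔ χ ∈ D.Ω ∧ ∀ w ∈ fixLast n (k + 1), χ ⬝ᵥ (μ ∘ w) = 0 := by
    intro χ
    rw [D.mem_face, hdot]
    refine and_congr_right fun hχ => ?_
    rw [Finset.sum_eq_zero_iff_of_nonneg fun w _ => D.nonneg_comp_perm hμ.nonneg w χ hχ]
    simp [W]
  have hsub : D.face ν ⊆ D.face μ := fun χ hχ =>
    D.mem_face.2 ⟨((hface χ).1 hχ).1, ((hface χ).1 hχ).2 1 (one_mem _)⟩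
  refine ⟨D.idem ν, hμ.idem_mem_Λ_of_subset hν hsub, fun h1 => ?_,
    (hμ.typeMap_eq_firstSimple_iff hsub).2 fun i hi => ⟨fun hik χ hχ => ?_, fun h => ?_⟩⟩
  · rw [WeightDec.idem, ← D.proj_Ω] at h1
    have h2 := D.proj_injOn (D.face_subset ν) (Finset.Subset.refl _) h1
    apply hμ.idem_ne_one
    rw [WeightDec.idem, Finset.Subset.antisymm (D.face_subset μ) (h2 ▸ hsub), D.proj_Ω]
  · have hs : Equiv.swap (⟨i, i.lt_succ_self.trans hi⟩ : Fin n) ⟨i + 1, hi⟩ ∈ fixLast n (k + 1) :=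
      swap_mem_fixLast (by simp; omega) (by simpa using hik)
    refine (hμ.comp_swap_mem_face_iff (hsub hχ) (Fin.lt_def.2 (by simp))).1 (D.mem_face.2 ⟨?_, ?_⟩)
    · exact D.comp_perm_mem _ ((hface χ).1 hχ).1
    · have := ((hface χ).1 hχ).2 _ hs
      rw [← dotProduct_comp_perm _ _ (Equiv.swap _ _)⁻¹, comp_perm_comp_inv] at this
      simpa using this
  · by_contra hik
    set tot := ∑ i, μ i with htot
    let ω : Fin n → ℤ := fun j => if j.val ≤ i then 1 else 0
    -- An integral multiple of the projection of the fundamental weight `ω` to the hyperplane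
    -- orthogonal to `μ`, along the constant vector. The factor `tot` keeps it dominant whatever the
    -- sign of `tot`, and it drops by `tot ^ 2` from `i` to `i + 1`.
    set χ₀ : Fin n → ℤ := fun j => tot * (tot * ω j - ω ⬝ᵥ μ) with hχ₀
    have hdot0 : χ₀ ⬝ᵥ μ = 0 := by
      have : χ₀ ⬝ᵥ μ = tot * (tot * (ω ⬝ᵥ μ) - (ω ⬝ᵥ μ) * tot) := by
        simp only [hχ₀, dotProduct, mul_sub, sub_mul, Finset.sum_sub_distrib]
        congr 1
        · rw [Finset.mul_sum, Finset.mul_sum]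
          exact Finset.sum_congr rfl fun _ _ => by ring
        · rw [← Finset.mul_sum, mul_assoc]
      rw [this]; ring
    have hanti : Antitone χ₀ := by
      intro a b hab
      simp only [hχ₀]
      have h1 : ω b ≤ ω a := by
        have : a.val ≤ b.val := hab
        simp only [ω]
        split_ifs <;> omega
      nlinarith [mul_nonneg (mul_self_nonneg tot) (sub_nonneg.2 h1)]
    rcases farkas_int D.Ω id χ₀ with ⟨d, c, hd, hc⟩ | ⟨ν', hν', hlt⟩
    · have h1 : ∀ j, (d : ℤ) * χ₀ j = ∑ χ ∈ D.Ω, (c χ : ℤ) * χ j := by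
        intro j
        have := congrFun hc j
        simpa using this
      have hcomb : ∀ x : Fin n → ℤ, (d : ℤ) * (χ₀ ⬝ᵥ x) =
          ∑ χ ∈ D.Ω, (c χ : ℤ) * (χ ⬝ᵥ x) := by
        intro x
        simp only [dotProduct, Finset.mul_sum]
        rw [Finset.sum_comm]
        refine Finset.sum_congr rfl fun j _ => ?_
        rw [← mul_assoc, h1, Finset.sum_mul]
        exact Finset.sum_congr rfl fun _ _ => by ring
      -- Since `χ₀` is invariant under `W_I` and orthogonal to `μ`, it vanishes on each conjugate `μ
      -- ∘ w`. Hence so does every weight occurring in the combination.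
      have hmem : ∀ χ ∈ D.Ω, c χ ≠ 0 → χ ∈ D.face ν := by
        intro χ hχ hcχ
        refine (hface χ).2 ⟨hχ, fun w hw => ?_⟩
        have h1 : χ₀ ⬝ᵥ (μ ∘ w) = 0 := by
          have h2 : χ₀ ∘ w = χ₀ := by
            ext j
            have h3 := le_apply_iff_of_mem_fixLast hw (i := i + 1) (by omega) j
            simp only [Function.comp, hχ₀, ω]
            congr 3
            exact if_congr (by omega) rfl rfl
          rw [← h2, dotProduct_comp_perm, hdot0]
        have h2 := hcomb (μ ∘ w)
        rw [h1, mul_zero, eq_comm, Finset.sum_eq_zero_iff_of_nonneg fun χ hχ =>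
          mul_nonneg (by positivity) (D.nonneg_comp_perm hμ.nonneg w χ hχ)] at h2
        rcases mul_eq_zero.1 (h2 χ hχ) with h | h
        · exact absurd (by exact_mod_cast h) hcχ
        · exact h
      have h2 : (d : ℤ) * χ₀ ⟨i, i.lt_succ_self.trans hi⟩ = d * χ₀ ⟨i + 1, hi⟩ := by
        rw [h1, h1]
        refine Finset.sum_congr rfl fun χ hχ => ?_
        by_cases h0 : c χ = 0
        · rw [h0]; simp
        · rw [h χ (hmem χ hχ h0)]
      have h3 : χ₀ ⟨i, i.lt_succ_self.trans hi⟩ = χ₀ ⟨i + 1, hi⟩ :=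
        mul_left_cancel₀ (by exact_mod_cast hd.ne') h2
      have h4 := hμ.sum_ne_zero
      simp only [hχ₀, ω] at h3
      rw [if_pos le_rfl, if_neg (by omega)] at h3
      have h5 : tot * tot = 0 := by linarith
      exact h4 (mul_self_eq_zero.1 h5)
    · exact absurd (hμ.dotProduct_nonneg hanti hdot0 hν') (not_le.2 hlt)

end IsMaxCocharacter

end RookPutcha

end

noncomputable section

namespace RookPutcha

open Matrix

/-! ### The Bruhat decomposition -/

section Decomposition

variable {K : Type*} [Field K] {n : ℕ}

theorem one_mem_borel : (1 : GL (Fin n) K) ∈ borel K n := fun i j h => by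
  rw [Units.val_one, Matrix.one_apply_ne h.ne']

theorem mul_mem_borel {a b : GL (Fin n) K} (ha : a ∈ borel K n) (hb : b ∈ borel K n) :
    a * b ∈ borel K n := by
  obtain ⟨c, hc, h⟩ := mul_mem_borelMat ⟨a, ha, rfl⟩ ⟨b, hb, rfl⟩
  rwa [← show c = a * b from Units.ext h]

theorem inv_mem_borel {b : GL (Fin n) K} (hb : b ∈ borel K n) : b⁻¹ ∈ borel K n := by
  have h : Matrix.BlockTriangular (b : Matrix (Fin n) (Fin n) K) id := fun i j hij => hb i j hij
  have : Invertible (b : Matrix (Fin n) (Fin n) K) := b.isUnit.invertible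
  have h' := Matrix.blockTriangular_inv_of_blockTriangular h
  intro i j hij
  rw [Matrix.coe_units_inv]
  exact h' hij

theorem diagGL_mem_borel (t : Fin n → Kˣ) : diagGL K n t ∈ borel K n :=
  fun i j h => diagGL_mem_torus t i j h.ne'

theorem updateCol_one_mul_apply (z : Fin n → K) (r : Fin n) (x : Matrix (Fin n) (Fin n) K)
    (i j : Fin n) : (Matrix.updateCol 1 r z * x) i j =
      (if i = r then 0 else x i j) + z i * x r j := by
  have h : Matrix.updateCol 1 r z =
      (1 : Matrix (Fin n) (Fin n) K) + Matrix.updateCol 0 r (z - Pi.single r 1) := by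
    ext a b
    by_cases hb : b = r
    · subst hb; simp [Matrix.one_apply, Pi.single_apply]
    · simp [hb]
  rw [h, Matrix.add_mul, Matrix.one_mul, Matrix.add_apply]
  have h2 : (Matrix.updateCol (0 : Matrix (Fin n) (Fin n) K) r (z - Pi.single r 1) * x) i j =
      (z i - (Pi.single r 1 : Fin n → K) i) * x r j := by
    rw [Matrix.mul_apply, Finset.sum_eq_single r]
    · simp
    · intro b _ hb; simp [hb]
    · simp
  rw [h2]
  by_cases hi : i = r
  · subst hi; simp; ring
  · simp [hi]

theorem mul_updateCol_one_apply (y : Fin n → K) (c : Fin n) (x : Matrix (Fin n) (Fin n) K)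
    (i j : Fin n) : (x * Matrix.updateCol 1 c y) i j = if j = c then (x *ᵥ y) i else x i j := by
  by_cases hj : j = c
  · subst hj
    simp [Matrix.mul_apply, Matrix.mulVec, dotProduct]
  · simp [Matrix.mul_apply, hj, Matrix.one_apply]

theorem exists_mem_borel_updateCol {y : Fin n → K} {c : Fin n} (hc : y c ≠ 0)
    (h : ∀ i, c < i → y i = 0) :
    ∃ b ∈ borel K n, (b : Matrix (Fin n) (Fin n) K) = Matrix.updateCol 1 c y := by
  have : Matrix.updateCol (1 : Matrix (Fin n) (Fin n) K) c y ∈ borelMat K n := by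
    rw [mem_borelMat_iff]
    refine ⟨fun i j hij => ?_, fun i => ?_⟩
    · by_cases hj : j = c
      · subst hj; simpa using h i hij
      · simp [hj, Matrix.one_apply_ne hij.ne']
    · by_cases hi : i = c
      · subst hi; simpa using hc
      · simp [hi]
  exact this

/-- Gaussian elimination one column at a time. Earlier pivot columns clear the new column in their
rows, its lowest remaining nonzero entry becomes the pivot, and row operations clear what lies
above. All operations are upper triangular. -/
theorem exists_bruhat_partial (g : GL (Fin n) K) (c : ℕ) (hc : c ≤ n) :
    ∃ b ∈ borel K n, ∃ b' ∈ borel K n, ∃ p : Fin n → Fin n,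
      (∀ i j : Fin n, i.val < c → j.val < c → p i = p j → i = j) ∧
      ∀ j : Fin n, j.val < c → ∀ i, ((b * g * b' : GL (Fin n) K) : Matrix (Fin n) (Fin n) K) i j =
        if p j = i then 1 else 0 := by
  classical
  induction c with
  | zero => exact ⟨1, one_mem_borel, 1, one_mem_borel, id, by simp, by simp⟩
  | succ c ih =>
    obtain ⟨b, hb, b', hb', p, hp, h⟩ := ih (by omega)
    set x : Matrix (Fin n) (Fin n) K := ((b * g * b' : GL (Fin n) K) : Matrix (Fin n) (Fin n) K) with hx
    let cc : Fin n := ⟨c, hc⟩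
    -- The column operation subtracts from column `cc` the earlier pivot columns, each weighted by
    -- the entry of column `cc` in its pivot row.
    let y : Fin n → K := fun j => if j < cc then - x (p j) cc else if j = cc then 1 else 0
    obtain ⟨U, hU, hUy⟩ := exists_mem_borel_updateCol (y := y) (c := cc) (by simp [y])
      (fun i hi => by simp [y, hi.ne', not_lt.2 hi.le])
    set v : Fin n → K := x *ᵥ y with hv
    have hxU : ∀ i j, (x * (U : Matrix (Fin n) (Fin n) K)) i j = if j = cc then v i else x i j :=
      fun i j => by rw [hUy, mul_updateCol_one_apply]
    have hvp : ∀ j : Fin n, j.val < c → v (p j) = 0 := by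
      intro j hj
      rw [hv, Matrix.mulVec, dotProduct]
      have hne : j ≠ cc := fun h => by simp [h, cc] at hj
      have hjc : j < cc := hj
      rw [Fintype.sum_eq_add j cc hne]
      · rw [h j hj]
        simp [y, hjc]
      · rintro a ⟨ha, ha'⟩
        by_cases hac : a < cc
        · rw [h a hac, if_neg (fun h' => ha (hp a j hac hj h')), zero_mul]
        · simp [y, hac, ha']
    have hne : (Finset.univ.filter fun i => v i ≠ 0).Nonempty := by
      rw [Finset.nonempty_iff_ne_empty]
      intro hempty
      have h0 : ∀ i, v i = 0 := fun i => by
        by_contra hi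
        exact Finset.notMem_empty i (hempty ▸ by simpa using hi)
      apply det_ne_zero (b * g * b' * U)
      apply Matrix.det_eq_zero_of_column_eq_zero cc
      intro i
      rw [Units.val_mul, ← hx, hxU, if_pos rfl, h0]
    obtain ⟨r, hr, hmax⟩ := Finset.exists_max_image _ (fun i : Fin n => i) hne
    simp only [Finset.mem_filter, Finset.mem_univ, true_and] at hr hmax
    -- Normalizes the pivot and clears the entries above it; those below already vanish because `r`
    -- is the lowest nonzero row.
    let z : Fin n → K := fun i => if i < r then - v i / v r else if i = r then (v r)⁻¹ else 0
    obtain ⟨L, hL, hLz⟩ := exists_mem_borel_updateCol (y := z) (c := r) (by simp [z, hr])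
      (fun i hi => by simp [z, hi.ne', not_lt.2 hi.le])
    have hrp : ∀ j : Fin n, j.val < c → p j ≠ r := fun j hj h' => hr (h' ▸ hvp j hj)
    have hlt : ∀ j : Fin n, j.val < c + 1 → j ≠ cc → j.val < c := by
      intro j hj hjc
      rw [Ne, Fin.ext_iff] at hjc
      simp only [cc] at hjc
      omega
    refine ⟨L * b, mul_mem_borel hL hb, b' * U, mul_mem_borel hb' hU, Function.update p cc r,
      fun i j hi hj hij => ?_, fun j hj i => ?_⟩
    · by_cases hic : i = cc <;> by_cases hjc : j = cc
      · rw [hic, hjc]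
      · subst hic
        rw [Function.update_self, Function.update_of_ne hjc] at hij
        exact absurd hij.symm (hrp j (hlt j hj hjc))
      · subst hjc
        rw [Function.update_self, Function.update_of_ne hic] at hij
        exact absurd hij (hrp i (hlt i hi hic))
      · rw [Function.update_of_ne hic, Function.update_of_ne hjc] at hij
        exact hp i j (hlt i hi hic) (hlt j hj hjc) hij
    · have hprod : ((L * b * g * (b' * U) : GL (Fin n) K) : Matrix (Fin n) (Fin n) K) =
          Matrix.updateCol 1 r z * (x * U) := by
        rw [← hLz, hx, ← Units.val_mul, ← Units.val_mul]
        congr 1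
        simp only [mul_assoc]
      rw [hprod, updateCol_one_mul_apply, hxU, hxU]
      by_cases hjc : j = cc
      · subst hjc
        rw [if_pos rfl, if_pos rfl, Function.update_self]
        rcases lt_trichotomy i r with hi | hi | hi
        · simp only [z, if_pos hi, if_neg hi.ne, if_neg hi.ne']
          field_simp
          ring
        · subst hi
          simp [z, hr]
        · have : v i = 0 := by
            by_contra h0
            exact absurd (hmax i h0) (not_le.2 hi)
          simp [z, hi.ne, hi.ne', not_lt.2 hi.le, this]
      · rw [if_neg hjc, if_neg hjc, Function.update_of_ne hjc, h j (hlt j hj hjc),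
          h j (hlt j hj hjc), if_neg (hrp j (hlt j hj hjc)), mul_zero, add_zero]
        by_cases hi : i = r
        · subst hi
          rw [if_pos rfl, if_neg (hrp j (hlt j hj hjc))]
        · rw [if_neg hi]

/-- The Bruhat decomposition of `GL_n`. -/
theorem exists_bruhat (g : GL (Fin n) K) :
    ∃ b ∈ borel K n, ∃ b' ∈ borel K n, ∃ p : Equiv.Perm (Fin n), g = b * permGL K n p * b' := by
  obtain ⟨b, hb, b', hb', p, hp, h⟩ := exists_bruhat_partial g n le_rfl
  have hinj : Function.Injective p := fun i j hij => hp i j i.2 j.2 hij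
  refine ⟨b⁻¹, inv_mem_borel hb, b'⁻¹, inv_mem_borel hb',
    Equiv.ofBijective p hinj.bijective_of_finite, ?_⟩
  have h1 : b * g * b' = permGL K n (Equiv.ofBijective p hinj.bijective_of_finite) := by
    apply Units.ext
    ext i j
    rw [h j j.2, coe_permGL, rookMatrix_perm_apply, Equiv.ofBijective_apply]
  rw [← h1]
  group

theorem permGL_rev_conj_apply (b : GL (Fin n) K) (i j : Fin n) :
    ((permGL K n Fin.revPerm * b * permGL K n Fin.revPerm : GL (Fin n) K) :
      Matrix (Fin n) (Fin n) K) i j = (b : Matrix (Fin n) (Fin n) K) i.rev j.rev := by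
  rw [Units.val_mul, Units.val_mul, coe_permGL, mul_rookMatrix_apply, rookMatrix_mul_apply]
  rfl

theorem permGL_rev_mul_self : permGL K n Fin.revPerm * permGL K n Fin.revPerm = 1 := by
  rw [← map_mul, ← map_one (permGL K n)]
  congr 1
  ext i
  simp

/-- The decomposition of `GL_n` into double cosets of the two opposite Borel subgroups. -/
theorem exists_opposite_bruhat (g : GL (Fin n) K) :
    ∃ b : GL (Fin n) K, (∀ i j, i < j → (b : Matrix (Fin n) (Fin n) K) i j = 0) ∧
      (∀ i j, i < j → ((b⁻¹ : GL (Fin n) K) : Matrix (Fin n) (Fin n) K) i j = 0) ∧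
      ∃ b' ∈ borel K n, ∃ p : Equiv.Perm (Fin n), g = b * permGL K n p * b' := by
  obtain ⟨b, hb, b', hb', p, h⟩ := exists_bruhat (permGL K n Fin.revPerm * g)
  have hrev := permGL_rev_mul_self (K := K) (n := n)
  have hinv : (permGL K n Fin.revPerm)⁻¹ = permGL K n Fin.revPerm := inv_eq_of_mul_eq_one_left hrev
  refine ⟨permGL K n Fin.revPerm * b * permGL K n Fin.revPerm, fun i j hij => ?_,
    fun i j hij => ?_, b', hb', Fin.revPerm * p, ?_⟩
  · rw [permGL_rev_conj_apply]
    exact hb _ _ (Fin.rev_lt_rev.2 hij)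
  · rw [_root_.mul_inv_rev, _root_.mul_inv_rev, hinv, ← mul_assoc, permGL_rev_conj_apply]
    exact inv_mem_borel hb _ _ (Fin.rev_lt_rev.2 hij)
  · rw [map_mul]
    calc g = permGL K n Fin.revPerm * (permGL K n Fin.revPerm * g) := by
          rw [← mul_assoc, hrev, one_mul]
      _ = _ := by
          rw [h]
          simp only [mul_assoc]
          rw [← mul_assoc (permGL K n Fin.revPerm) (permGL K n Fin.revPerm), hrev, one_mul]

/-- If `w b = C v` with `b` upper triangular and the leading `j × j` block of `C` regular, then
the leading `j × l` block of the permutation `v` has no larger rank than that of `w`. -/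
theorem card_le_of_mul_eq {v w : Equiv.Perm (Fin n)} {b C : GL (Fin n) K} (hb : b ∈ borel K n)
    (h : permGL K n w * b = C * permGL K n v) {j l : ℕ}
    (hC : ∀ z : Fin n → K, (∀ a : Fin n, j ≤ a.val → z a = 0) →
      (∀ a : Fin n, a.val < j → ((C : Matrix (Fin n) (Fin n) K) *ᵥ z) a = 0) → z = 0) :
    (Finset.univ.filter fun c : Fin n => c.val < l ∧ (v c).val < j).card ≤
      (Finset.univ.filter fun c : Fin n => c.val < l ∧ (w c).val < j).card := by
  classical
  by_contra hlt
  rw [not_le] at hlt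
  set S := Finset.univ.filter fun c : Fin n => c.val < l ∧ (v c).val < j with hS
  set S' := Finset.univ.filter fun c : Fin n => c.val < l ∧ (w c).val < j with hS'
  let B' : Matrix S' S K := Matrix.of fun c d => (b : Matrix (Fin n) (Fin n) K) c.1 d.1
  -- If the counts were the other way, this block of `b` would have a kernel vector. Its extension
  -- `X` makes `v X` supported on the first `j` rows, while `C v X = w b X` vanishes there,
  -- contradicting regularity of the block of `C`.
  have hker : LinearMap.ker (Matrix.mulVecLin B') ≠ ⊥ :=
    LinearMap.ker_ne_bot_of_finrank_lt (by simpa using hlt)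
  obtain ⟨x, hx, hx0⟩ := Submodule.exists_mem_ne_zero_of_ne_bot hker
  apply hx0
  let X : Fin n → K := fun c => if hc : c ∈ S then x ⟨c, hc⟩ else 0
  have hXl : ∀ c : Fin n, c ∉ S → X c = 0 := fun c hc => by simp [X, hc]
  have hbX : ∀ c : Fin n, (w c).val < j → ((b : Matrix (Fin n) (Fin n) K) *ᵥ X) c = 0 := by
    intro c hc
    by_cases hcl : c.val < l
    · have h1 := congrFun (LinearMap.mem_ker.1 hx) ⟨c, by simp [hS', hcl, hc]⟩
      rw [Matrix.mulVecLin_apply] at h1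
      rw [Matrix.mulVec, dotProduct, ← Finset.sum_subset (Finset.subset_univ S)
        (fun d _ hd => by rw [hXl d hd, mul_zero]), ← Finset.sum_coe_sort S]
      simpa [Matrix.mulVec, dotProduct, B', X] using h1
    · rw [Matrix.mulVec, dotProduct]
      refine Finset.sum_eq_zero fun d _ => ?_
      by_cases hd : d ∈ S
      · have : d < c := by
          simp only [hS, Finset.mem_filter] at hd
          exact Fin.lt_def.2 (by omega)
        rw [hb _ _ this, zero_mul]
      · rw [hXl d hd, mul_zero]
  have hperm : ∀ (u : Equiv.Perm (Fin n)) (z : Fin n → K) (a : Fin n),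
      ((permGL K n u : Matrix (Fin n) (Fin n) K) *ᵥ z) a = z (u⁻¹ a) := by
    intro u z a
    rw [Matrix.mulVec, dotProduct, Finset.sum_eq_single (u⁻¹ a)]
    · rw [coe_permGL, rookMatrix_perm_apply, perm_apply_inv_self, if_pos rfl, one_mul]
    · intro d _ hd
      rw [coe_permGL, rookMatrix_perm_apply, if_neg, zero_mul]
      rintro rfl
      exact hd (perm_inv_apply_self u d).symm
    · simp
  have hz := hC ((permGL K n v : Matrix (Fin n) (Fin n) K) *ᵥ X)
    (fun a ha => by
      rw [hperm]
      apply hXl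
      simp only [hS, Finset.mem_filter, Finset.mem_univ, true_and, perm_apply_inv_self]
      omega)
    (fun a ha => by
      rw [Matrix.mulVec_mulVec, ← Units.val_mul, ← h, Units.val_mul, ← Matrix.mulVec_mulVec,
        hperm]
      apply hbX
      rwa [perm_apply_inv_self])
  ext c
  have h2 := congrFun hz (v c.1)
  rw [hperm, perm_inv_apply_self] at h2
  simpa [X] using h2

/-- The leading blocks of `b⁻ p b` are regular when `p` preserves the leading indices. -/
theorem leading_block_injective {b b' : GL (Fin n) K} {p : Equiv.Perm (Fin n)} {j : ℕ}
    (hb : ∀ i j, i < j → ((b⁻¹ : GL (Fin n) K) : Matrix (Fin n) (Fin n) K) i j = 0)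
    (hb' : b' ∈ borel K n) (hp : ∀ a : Fin n, j ≤ a.val → j ≤ (p⁻¹ a).val) {z : Fin n → K}
    (hz : ∀ a : Fin n, j ≤ a.val → z a = 0)
    (h : ∀ a : Fin n, a.val < j →
      (((b * permGL K n p * b' : GL (Fin n) K) : Matrix (Fin n) (Fin n) K) *ᵥ z) a = 0) :
    z = 0 := by
  set y := ((permGL K n p * b' : GL (Fin n) K) : Matrix (Fin n) (Fin n) K) *ᵥ z with hy
  have hy1 : ∀ a : Fin n, j ≤ a.val → y a = 0 := by
    intro a ha
    rw [hy, Matrix.mulVec, dotProduct]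
    refine Finset.sum_eq_zero fun d _ => ?_
    by_cases hd : j ≤ d.val
    · rw [hz d hd, mul_zero]
    · rw [Units.val_mul, coe_permGL, rookMatrix_mul_apply, hb', zero_mul]
      have := hp a ha
      exact Fin.lt_def.2 (by omega)
  have hy2 : ∀ a : Fin n, a.val < j → ((b : Matrix (Fin n) (Fin n) K) *ᵥ y) a = 0 := by
    intro a ha
    rw [hy, Matrix.mulVec_mulVec, ← Units.val_mul, ← mul_assoc]
    exact h a ha
  have hy3 : y = 0 := by
    ext a
    by_cases ha : j ≤ a.val
    · exact hy1 a ha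
    have : y = ((b⁻¹ : GL (Fin n) K) : Matrix (Fin n) (Fin n) K) *ᵥ
        ((b : Matrix (Fin n) (Fin n) K) *ᵥ y) := by
      rw [Matrix.mulVec_mulVec, ← Units.val_mul, inv_mul_cancel, Units.val_one, Matrix.one_mulVec]
    rw [this, Matrix.mulVec, dotProduct]
    refine Finset.sum_eq_zero fun d _ => ?_
    by_cases hd : d.val < j
    · rw [hy2 d hd, mul_zero]
    · rw [hb _ _ (Fin.lt_def.2 (by omega)), zero_mul]
  have : z = (((permGL K n p * b')⁻¹ : GL (Fin n) K) : Matrix (Fin n) (Fin n) K) *ᵥ y := by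
    rw [hy, Matrix.mulVec_mulVec, ← Units.val_mul, inv_mul_cancel, Units.val_one,
      Matrix.one_mulVec]
  rw [this, hy3, Matrix.mulVec_zero]

theorem card_filter_val_lt (j : ℕ) (w : Equiv.Perm (Fin n)) (l : ℕ) :
    (Finset.univ.filter fun c : Fin n => c.val < l ∧ (w c).val < j).card + permRk w j l =
      (Finset.univ.filter fun c : Fin n => c.val < l).card := by
  rw [permRk_eq, ← Finset.card_union_of_disjoint]
  · congr 1
    ext c
    simp only [Finset.mem_union, Finset.mem_filter, Finset.mem_univ, true_and]
    omega
  · rw [Finset.disjoint_filter]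
    intro c _
    omega

theorem permRk_rev_mul (w : Equiv.Perm (Fin n)) (i l : ℕ) :
    permRk (Fin.revPerm * w) i l + permRk w (n - i) l =
      (Finset.univ.filter fun c : Fin n => c.val < l).card := by
  rw [← card_filter_val_lt (n - i) w l, permRk_eq]
  congr 2
  ext c
  simp only [Finset.mem_filter, Finset.mem_univ, true_and, Equiv.Perm.mul_apply,
    Fin.revPerm_apply, Fin.val_rev]
  have := (w c).2
  omega

theorem bruhatLE_rev_mul [Infinite K] {v w : Equiv.Perm (Fin n)}
    (h : ∀ i j, permRk w i j ≤ permRk v i j) :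
    bruhatLE K (Fin.revPerm * v) (Fin.revPerm * w) := by
  rw [bruhatLE_iff]
  intro i j
  have h1 := permRk_rev_mul v i j
  have h2 := permRk_rev_mul w i j
  have h3 := h (n - i) j
  omega

end Decomposition

end RookPutcha

end

noncomputable section

namespace RookPutcha

open Matrix

variable {K : Type*} [Field K] {n N : ℕ} {M : ReductiveMonoid K n N}

/-! ### Idempotents whose type is an initial segment -/

theorem permGL_mul_transGL (w : Equiv.Perm (Fin n)) {a b : Fin n} (h : a ≠ b) (c : K) :
    permGL K n w * transGL h c = transGL (w.injective.ne h) c * permGL K n w := by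
  apply Units.ext
  ext i j
  rw [Units.val_mul, Units.val_mul, coe_permGL, rookMatrix_mul_apply, mul_rookMatrix_apply,
    transGL_apply, transGL_apply]
  congr 1
  · exact if_congr ⟨fun h => by rw [← h, perm_apply_inv_self],
      fun h => by rw [h, perm_inv_apply_self]⟩ rfl rfl
  · refine if_congr (and_congr ⟨fun h => by rw [h, perm_apply_inv_self],
      fun h => by rw [← h, perm_inv_apply_self]⟩ w.injective.eq_iff.symm) rfl rfl

/-- A permutation that has no inversion at `j` fixes `j`. -/
theorem perm_apply_eq_self {τ : Equiv.Perm (Fin n)} {j : Fin n} (h1 : ∀ i < j, τ i < τ j)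
    (h2 : ∀ i, j < i → τ j < τ i) : τ j = j := by
  apply le_antisymm
  · have := Finset.card_le_card_of_injOn τ (s := Finset.Ioi j) (t := Finset.Ioi (τ j))
      (fun i hi => by simpa using h2 i (by simpa using hi)) τ.injective.injOn
    rw [Fin.card_Ioi, Fin.card_Ioi] at this
    have := j.2
    have := (τ j).2
    exact Fin.le_def.2 (by omega)
  · have := Finset.card_le_card_of_injOn τ (s := Finset.Iio j) (t := Finset.Iio (τ j))
      (fun i hi => by simpa using h1 i (by simpa using hi)) τ.injective.injOn
    rw [Fin.card_Iio, Fin.card_Iio] at this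
    exact Fin.le_def.2 this

/-- The idempotent of `ν` is a proper element of the cross-section lattice of a dual canonical
monoid whose type is an initial segment of the simple reflections. -/
structure HasInitialType (D : WeightDec M) (μ ν : Fin n → ℤ) (k : ℕ) : Prop where
  isMax : IsMaxCocharacter D μ
  nonneg : D.Nonneg ν
  subset : D.face ν ⊆ D.face μ
  type_eq : M.typeMap (D.idem ν) = firstSimple n k

theorem IsMaxCocharacter.hasInitialType [Infinite K] {D : WeightDec M} {μ : Fin n → ℤ}
    (hμ : IsMaxCocharacter D μ) {e : Matrix (Fin N) (Fin N) K} (he : e ∈ M.Λ) (he1 : e ≠ 1)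
    {k : ℕ} (hk : M.typeMap e = firstSimple n k) :
    ∃ ν, e = D.idem ν ∧ HasInitialType D μ ν k := by
  obtain ⟨ν, hν, rfl⟩ := D.exists_cocharacter (mem_Λ_iff.1 he).1 (mem_Λ_iff.1 he).2.1
  exact ⟨ν, rfl, hμ, hν, D.subset_of_proj_mul (D.face_subset _) (hμ.mul_eq he he1).2, hk⟩

/-! ### The centralizer of the idempotent and its action -/

namespace HasInitialType

variable {D : WeightDec M} {μ ν : Fin n → ℤ} {k : ℕ}

theorem max_mul (hD : HasInitialType D μ ν k) : D.idem μ * D.idem ν = D.idem ν := by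
  rw [WeightDec.idem, WeightDec.idem, D.proj_comm, D.proj_mul_of_subset hD.subset]

theorem mul_max (hD : HasInitialType D μ ν k) : D.idem ν * D.idem μ = D.idem ν := by
  rw [WeightDec.idem, WeightDec.idem, D.proj_mul_of_subset hD.subset]

theorem borel_mul [Infinite K] (hD : HasInitialType D μ ν k) {b : GL (Fin n) K}
    (hb : b ∈ borel K n) : ∃ t : Fin n → Kˣ,
      (∀ i, (t i : K) = (b : Matrix (Fin n) (Fin n) K) i i) ∧
      M.ι b * D.idem ν = M.ι (diagGL K n t) * D.idem ν := hD.isMax.borel_mul hD.max_mul hb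

theorem trans_mul [Infinite K] (hD : HasInitialType D μ ν k) {a b : Fin n} (h : a < b) (c : K) :
    M.ι (transGL h.ne c) * D.idem ν = D.idem ν := by
  obtain ⟨t, ht, h1⟩ := hD.borel_mul (transGL_mem_borel h c)
  have : t = 1 := by
    ext i
    rw [ht, transGL_apply, if_pos rfl, if_neg, add_zero]
    · rfl
    · rintro ⟨rfl, rfl⟩; exact lt_irrefl _ h
  rw [h1, this, map_one, map_one, one_mul]

/-- The weights of the face are antitone, and an antitone rearrangement of an antitone tuple is the
tuple itself, so `w` fixes each of them. For every `i ≥ k` some weight of the face drops after `i`,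
so `w` preserves the cut at `i`; these cuts isolate each index `≥ k + 1`. -/
theorem mem_fixLast_of_face [Infinite K] (hD : HasInitialType D μ ν k) {w : Equiv.Perm (Fin n)}
    (h : ∀ χ ∈ D.face ν, χ ∘ ⇑w⁻¹ ∈ D.face ν) : w ∈ fixLast n (k + 1) := by
  have hinv : ∀ χ ∈ D.face ν, χ ∘ ⇑w⁻¹ = χ := by
    intro χ hχ
    have h1 : Monotone ((-χ) ∘ ⇑(1 : Equiv.Perm (Fin n))) :=
      (hD.isMax.antitone_of_mem_face (hD.subset hχ)).neg
    have h2 : Monotone ((-χ) ∘ ⇑w⁻¹) :=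
      (hD.isMax.antitone_of_mem_face (hD.subset (h χ hχ))).neg
    have h3 := Tuple.unique_monotone h1 h2
    ext i
    have := congrFun h3 i
    simpa using this.symm
  have htype := (hD.isMax.typeMap_eq_firstSimple_iff hD.subset).1 hD.type_eq
  have hcut : ∀ i : ℕ, k ≤ i → i + 1 < n → ∀ a : Fin n, a.val ≤ i ↔ (w⁻¹ a).val ≤ i := by
    intro i hki hi a
    have h1 : ¬ ∀ χ ∈ D.face ν, χ ⟨i, i.lt_succ_self.trans hi⟩ = χ ⟨i + 1, hi⟩ := fun h' =>
      absurd ((htype i hi).2 h') (by omega)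
    push Not at h1
    obtain ⟨χ, hχ, hne⟩ := h1
    have hanti := hD.isMax.antitone_of_mem_face (hD.subset hχ)
    have hlt : χ ⟨i + 1, hi⟩ < χ ⟨i, i.lt_succ_self.trans hi⟩ :=
      lt_of_le_of_ne (hanti (Fin.le_def.2 (by simp))) (Ne.symm hne)
    have hiff : ∀ c : Fin n, c.val ≤ i ↔ χ ⟨i + 1, hi⟩ < χ c := by
      intro c
      constructor
      · intro hc
        exact hlt.trans_le (hanti (Fin.le_def.2 hc))
      · intro hc
        by_contra hci
        exact absurd (hanti (show (⟨i + 1, hi⟩ : Fin n) ≤ c from Fin.le_def.2 (by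
          simp only; omega))) (not_le.2 hc)
    rw [hiff, hiff, ← congrFun (hinv χ hχ) a]
    rfl
  have hfix : ∀ j : Fin n, k + 1 ≤ j.val → w⁻¹ j = j := by
    intro j hj
    have h1 := hcut (j.val - 1) (by omega) (by omega) j
    apply Fin.ext
    by_cases hjn : j.val + 1 < n
    · have h2 := hcut j.val (by omega) hjn j
      omega
    · have := (w⁻¹ j).2
      omega
  intro j hj
  have := hfix j hj
  rw [Equiv.Perm.inv_eq_iff_eq] at this
  exact this.symm

theorem mem_fixLast_of_absorb [Infinite K] (hD : HasInitialType D μ ν k)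
    {w : Equiv.Perm (Fin n)}
    (h : D.idem ν * M.ι (permGL K n w) * D.idem ν = M.ι (permGL K n w) * D.idem ν) :
    w ∈ fixLast n (k + 1) := by
  classical
  apply hD.mem_fixLast_of_face
  rw [mul_assoc, D.perm_mul_idem, ← mul_assoc] at h
  have h1 : D.idem ν * D.idem (ν ∘ ⇑w⁻¹) = D.idem (ν ∘ ⇑w⁻¹) := by
    have := congrArg (· * M.ι (permGL K n w)⁻¹) h
    simpa [mul_assoc, WeightDec.map_mul_inv] using this
  rw [WeightDec.idem, WeightDec.idem, D.proj_comm] at h1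
  have h2 := D.subset_of_proj_mul (D.face_subset _) h1
  intro χ hχ
  apply h2
  rw [← D.image_face]
  exact Finset.mem_image_of_mem _ hχ

/-- It suffices to treat generators. A simple reflection of the type commutes with `e`. Conjugating
by it the upper root subgroup, which fixes `e`, shows that the lower one fixes `e` too. Hence the
reflection acts on `e` as a torus element. -/
theorem perm_mul_of_mem_fixLast [Infinite K] (hD : HasInitialType D μ ν k)
    {w : Equiv.Perm (Fin n)} (hw : w ∈ fixLast n (k + 1)) :
    M.ι (permGL K n w) * D.idem ν = D.idem ν * M.ι (permGL K n w) ∧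
      ∃ t, M.ι (permGL K n w) * D.idem ν = M.ι (diagGL K n t) * D.idem ν := by
  rw [← parabolic_firstSimple, parabolic] at hw
  induction hw using Subgroup.closure_induction with
  | mem s hs =>
    have hcomm := (D.mem_typeMap_iff.1 (hD.type_eq ▸ hs)).2
    refine ⟨hcomm, ?_⟩
    obtain ⟨i, hi, hik, rfl⟩ := hs
    set a : Fin n := ⟨i, i.lt_succ_self.trans hi⟩ with ha
    set b : Fin n := ⟨i + 1, hi⟩ with hb
    have hab : a < b := Fin.lt_def.2 (by simp [ha, hb])
    have h2 : ∀ c : K, M.ι (transGL hab.ne.symm c) * D.idem ν = D.idem ν := by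
      intro c
      have h1 := permGL_mul_transGL (Equiv.swap a b) hab.ne c
      simp only [Equiv.swap_apply_left, Equiv.swap_apply_right] at h1
      have h3 : M.ι (transGL hab.ne.symm c) * D.idem ν * M.ι (permGL K n (Equiv.swap a b)) =
          D.idem ν * M.ι (permGL K n (Equiv.swap a b)) := by
        rw [mul_assoc, ← hcomm, ← mul_assoc, ← map_mul, ← h1, map_mul, mul_assoc,
          hD.trans_mul hab]
      have := congrArg (· * M.ι (permGL K n (Equiv.swap a b))⁻¹) h3
      simpa [mul_assoc, WeightDec.map_mul_inv] using this
    have h3 := WeightDec.swap_mul_diag_mul hab.ne (hD.trans_mul hab) h2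
    rw [← map_mul, permGL_mul_diagGL, map_mul, mul_assoc] at h3
    set d := Function.update (1 : Fin n → Kˣ) a (-1) ∘ ⇑(Equiv.swap a b)⁻¹
    refine ⟨d⁻¹, ?_⟩
    conv_rhs => rw [← h3]
    rw [← mul_assoc, ← map_mul, ← map_mul, inv_mul_cancel, map_one, map_one, one_mul]
  | one => exact ⟨by simp, 1, by simp⟩
  | mul v w _ _ hv hw =>
    obtain ⟨hv1, t, ht⟩ := hv
    obtain ⟨hw1, s, hs⟩ := hw
    refine ⟨?_, (s ∘ ⇑v⁻¹) * t, ?_⟩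
    · rw [map_mul, map_mul, mul_assoc, hw1, ← mul_assoc, hv1, mul_assoc]
    · rw [map_mul, map_mul, mul_assoc, hs, ← mul_assoc, ← map_mul, permGL_mul_diagGL, map_mul,
        mul_assoc, ht, ← mul_assoc, ← map_mul, ← map_mul]
  | inv w _ hw =>
    obtain ⟨hw1, t, ht⟩ := hw
    constructor
    · have := congrArg (fun x => M.ι (permGL K n w)⁻¹ * x * M.ι (permGL K n w)⁻¹) hw1
      simp only [mul_assoc, WeightDec.map_mul_inv, mul_one] at this
      rw [← mul_assoc, ← mul_assoc, WeightDec.map_inv_mul, one_mul] at this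
      rw [map_inv, this]
    · refine ⟨(t ∘ w)⁻¹, ?_⟩
      have h1 : D.idem ν = M.ι (diagGL K n (t ∘ w)) * (M.ι (permGL K n w⁻¹) * D.idem ν) := by
        have h2 := permGL_mul_diagGL (K := K) w⁻¹ t
        rw [inv_inv] at h2
        rw [← mul_assoc, ← map_mul, ← h2, map_mul, mul_assoc, ← ht, ← mul_assoc, ← map_mul,
          ← map_mul, inv_mul_cancel, map_one, map_one, one_mul]
      conv_rhs => rw [h1]
      rw [← mul_assoc, ← map_mul, ← map_mul, inv_mul_cancel, map_one, map_one, one_mul]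

/-- Torus elements move to the right across `e w`. -/
theorem _root_.RookPutcha.WeightDec.diag_mul_idem_mul_perm (D : WeightDec M) (t : Fin n → Kˣ)
    (ν : Fin n → ℤ) (w : Equiv.Perm (Fin n)) :
    M.ι (diagGL K n t) * (D.idem ν * M.ι (permGL K n w)) =
      D.idem ν * M.ι (permGL K n w) * M.ι (diagGL K n (t ∘ w)) := by
  have h := permGL_mul_diagGL (K := K) w (t ∘ w)
  rw [comp_perm_comp_inv] at h
  rw [← mul_assoc, D.diag_mul_idem, mul_assoc, mul_assoc, ← map_mul, ← map_mul, h]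

theorem perm_mul_of_mem_fixLast_mul_perm [Infinite K] (hD : HasInitialType D μ ν k)
    {u : Equiv.Perm (Fin n)} (hu : u ∈ fixLast n (k + 1)) (w : Equiv.Perm (Fin n)) :
    ∃ t, M.ι (permGL K n u) * (D.idem ν * M.ι (permGL K n w)) =
      D.idem ν * M.ι (permGL K n w) * M.ι (diagGL K n t) := by
  obtain ⟨-, t, ht⟩ := hD.perm_mul_of_mem_fixLast hu
  exact ⟨t ∘ w, by rw [← mul_assoc, ht, mul_assoc, D.diag_mul_idem_mul_perm]⟩

/-- The elements `e w` represent elements of the Gauss–Jordan monoid. -/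
theorem idem_mul_perm_mem [Infinite K] (hD : HasInitialType D μ ν k) (w : Equiv.Perm (Fin n)) :
    D.idem ν * M.ι (permGL K n w) ∈ M.closureNT ∧
      (fun b => b * (D.idem ν * M.ι (permGL K n w))) '' M.B ⊆
        (fun b => D.idem ν * M.ι (permGL K n w) * b) '' M.B := by
  constructor
  · rw [← one_mul (D.idem ν)]
    refine mul_mem_closure (D.idem_mem_closure hD.nonneg) 1 _ ?_
    rintro _ ⟨t, ht, rfl⟩
    obtain ⟨t, rfl⟩ := mem_torus_iff.1 ht
    refine subset_zariskiClosure _ ⟨diagGL K n t * permGL K n w, ?_, by rw [one_mul, map_mul]⟩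
    exact mul_mem (diagGL_mem_torusNormalizer t) (permGL_mem_torusNormalizer w)
  · rintro _ ⟨_, ⟨b, hb, rfl⟩, rfl⟩
    obtain ⟨t, -, ht⟩ := hD.borel_mul hb
    refine ⟨_, ⟨diagGL K n (t ∘ w), diagGL_mem_borel _, rfl⟩, ?_⟩
    change D.idem ν * M.ι (permGL K n w) * M.ι (diagGL K n (t ∘ w)) =
      M.ι b * (D.idem ν * M.ι (permGL K n w))
    rw [← D.diag_mul_idem_mul_perm, ← mul_assoc (M.ι b), ht, mul_assoc]

/-- If `σ e g` represents an element of the Gauss–Jordan monoid, then `σ` centralizes `e`. -/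
theorem mem_fixLast_of_gaussJordan [Infinite K] (hD : HasInitialType D μ ν k)
    {σ : Equiv.Perm (Fin n)} {g : GL (Fin n) K}
    (h : (fun b => b * (M.ι (permGL K n σ) * D.idem ν * M.ι g)) '' M.B ⊆
      (fun b => M.ι (permGL K n σ) * D.idem ν * M.ι g * b) '' M.B) :
    σ ∈ fixLast n (k + 1) := by
  -- From `B x ⊆ x B` with `x = σ e g` one gets `σ⁻¹ b σ e = e (g b' g⁻¹)`, which `e` absorbs from
  -- the left.
  have habs : ∀ b ∈ borel K n, D.idem ν * M.ι ((permGL K n σ)⁻¹ * b * permGL K n σ) * D.idem ν =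
      M.ι ((permGL K n σ)⁻¹ * b * permGL K n σ) * D.idem ν := by
    intro b hb
    obtain ⟨_, ⟨b', -, rfl⟩, hb'⟩ := h ⟨_, ⟨b, hb, rfl⟩, rfl⟩
    have h1 := congrArg (fun x => M.ι (permGL K n σ)⁻¹ * x * M.ι g⁻¹) hb'
    have h2 : M.ι ((permGL K n σ)⁻¹ * b * permGL K n σ) * D.idem ν =
        D.idem ν * M.ι (g * b' * g⁻¹) := by
      calc _ = M.ι (permGL K n σ)⁻¹ * (M.ι b * (M.ι (permGL K n σ) * D.idem ν * M.ι g)) *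
            M.ι g⁻¹ := by
              simp only [map_mul, mul_assoc, WeightDec.map_mul_inv, mul_one]
        _ = M.ι (permGL K n σ)⁻¹ * (M.ι (permGL K n σ) * D.idem ν * M.ι g * M.ι b') *
            M.ι g⁻¹ := h1.symm
        _ = _ := by
              simp only [map_mul, ← mul_assoc, WeightDec.map_inv_mul, one_mul]
    rw [mul_assoc, h2, ← mul_assoc, D.idem_mul_self]
  -- An inversion turns a positive root subgroup into a negative one absorbed by `e`. Together with
  -- the positive root subgroup, which fixes `e`, it produces a reflection absorbed by `e`; this
  -- reflection lies in `W_I`, so it moves only indices below `k + 1`.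
  have hinv : ∀ a b : Fin n, a < b → σ⁻¹ b < σ⁻¹ a → (σ⁻¹ a).val < k + 1 := by
    intro a b hab hlt
    by_contra hge
    have h1 := habs _ (transGL_mem_borel hab (-1))
    have h2 := permGL_mul_transGL σ⁻¹ hab.ne (-1 : K)
    rw [map_inv] at h2
    rw [h2, inv_mul_cancel_right] at h1
    have h3 := transGL_product (K := K) hlt.ne
    have h4 : M.ι (permGL K n (Equiv.swap (σ⁻¹ b) (σ⁻¹ a))) * D.idem ν *
        M.ι (diagGL K n (Function.update (1 : Fin n → Kˣ) (σ⁻¹ b) (-1))) =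
        M.ι (transGL hlt.ne.symm (-1)) * D.idem ν := by
      rw [mul_assoc, ← D.diag_mul_idem, ← mul_assoc, ← map_mul, ← h3, map_mul, map_mul, mul_assoc,
        hD.trans_mul hlt, mul_assoc, ← h1, ← mul_assoc, ← mul_assoc, hD.trans_mul hlt]
    have h5 : Equiv.swap (σ⁻¹ b) (σ⁻¹ a) ∈ fixLast n (k + 1) := by
      apply hD.mem_fixLast_of_absorb
      have h6 := congrArg (· * M.ι (diagGL K n (Function.update (1 : Fin n → Kˣ) (σ⁻¹ b) (-1)))⁻¹)
        h4
      simp only [mul_assoc, WeightDec.map_mul_inv, mul_one] at h6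
      rw [mul_assoc, h6, ← mul_assoc, ← mul_assoc, h1, mul_assoc]
    have h6 := h5 (σ⁻¹ a) (by omega)
    rw [Equiv.swap_apply_right] at h6
    exact hlt.ne h6
  rw [← inv_mem_iff]
  -- If `σ⁻¹ j ≥ k + 1`, then `j` takes part in no inversion of `σ⁻¹`, so it is a fixed point.
  have hinv' : ∀ j : Fin n, k + 1 ≤ (σ⁻¹ j).val → σ⁻¹ j = j := by
    intro j hj
    refine perm_apply_eq_self (fun i hi => ?_) fun i hi => ?_
    · by_contra hle
      have := hinv i j hi (lt_of_le_of_ne (not_lt.1 hle) fun h => hi.ne (σ⁻¹.injective h).symm)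
      have := not_lt.1 hle
      rw [Fin.le_def] at this
      omega
    · by_contra hle
      have := hinv j i hi (lt_of_le_of_ne (not_lt.1 hle) fun h => hi.ne (σ⁻¹.injective h).symm)
      omega
  intro i hi
  have h1 := hinv' (σ i) (by rwa [perm_inv_apply_self])
  rw [perm_inv_apply_self] at h1
  rw [Equiv.Perm.inv_eq_iff_eq]
  exact h1

end HasInitialType

end RookPutcha

end

noncomputable section

namespace RookPutcha

open Matrix

variable {K : Type*} [Field K] {n N : ℕ} {M : ReductiveMonoid K n N}

/-! ### The Putcha poset -/

/-- Polynomials on a reductive monoid pull back to polynomials in the entries of `GL_n`, up to a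
power of the determinant. -/
theorem exists_polynomial_pullback (M : ReductiveMonoid K n N) (C : Matrix (Fin N) (Fin N) K)
    (q : MvPolynomial (Fin N × Fin N) K) :
    ∃ F ∈ polyFun K n, ∃ d : ℕ, ∀ g : GL (Fin n) K,
      evalMat q (C * M.ι g) * (g : Matrix (Fin n) (Fin n) K).det ^ d =
        F (g : Matrix (Fin n) (Fin n) K) := by
  have hdet : (fun x : Matrix (Fin n) (Fin n) K => x.det) ∈ polyFun K n :=
    det_mem_polyFun (fun x => x) fun i j => entry_mem_polyFun i j
  choose p d hp using M.regular
  have hp' : ∀ i j, ∀ g : GL (Fin n) K, M.ι g i j = evalMat (p i j) (g : Matrix (Fin n) (Fin n) K) *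
      ((g : Matrix (Fin n) (Fin n) K).det)⁻¹ ^ d i j := hp
  induction q using MvPolynomial.induction_on with
  | C a => exact ⟨_, const_mem_polyFun a, 0, fun g => by simp [evalMat]⟩
  | add q₁ q₂ h₁ h₂ =>
    obtain ⟨F₁, hF₁, d₁, h₁⟩ := h₁
    obtain ⟨F₂, hF₂, d₂, h₂⟩ := h₂
    refine ⟨_, (polyFun K n).add_mem ((polyFun K n).mul_mem hF₁ ((polyFun K n).pow_mem hdet d₂))
      ((polyFun K n).mul_mem hF₂ ((polyFun K n).pow_mem hdet d₁)), d₁ + d₂, fun g => ?_⟩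
    simp only [Pi.add_apply, Pi.mul_apply, Pi.pow_apply]
    rw [← h₁, ← h₂]
    simp only [evalMat, map_add]
    ring
  | mul_X q ij h =>
    obtain ⟨F, hF, e, h⟩ := h
    set m := ∑ l, d l ij.2 with hm
    refine ⟨_, (polyFun K n).mul_mem hF (sum_mem_polyFun Finset.univ
      (fun l x => C ij.1 l * evalMat (p l ij.2) x * x.det ^ (m - d l ij.2)) fun l _ =>
        (polyFun K n).mul_mem ((polyFun K n).mul_mem (const_mem_polyFun _) ⟨p l ij.2, fun _ => rfl⟩)
          ((polyFun K n).pow_mem hdet _)), e + m, fun g => ?_⟩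
    simp only [Pi.mul_apply]
    rw [← h]
    have h1 : evalMat (q * MvPolynomial.X ij) (C * M.ι g) =
        evalMat q (C * M.ι g) * (C * M.ι g) ij.1 ij.2 := by simp [evalMat]
    rw [h1, Matrix.mul_apply, pow_add, mul_mul_mul_comm, Finset.sum_mul]
    congr 1
    refine Finset.sum_congr rfl fun l _ => ?_
    have hle : d l ij.2 ≤ m :=
      Finset.single_le_sum (f := fun l => d l ij.2) (fun _ _ => Nat.zero_le _) (Finset.mem_univ l)
    have hne := det_ne_zero g
    rw [hp', ← Nat.sub_add_cancel hle, pow_add, Nat.sub_add_cancel hle]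
    rw [inv_pow]
    field_simp

theorem diagGL_mul_permGL (t : Fin n → Kˣ) (w : Equiv.Perm (Fin n)) :
    diagGL K n t * permGL K n w = permGL K n w * diagGL K n (t ∘ w) := by
  rw [permGL_mul_diagGL, comp_perm_comp_inv]

theorem mul_mem_B {a b : Matrix (Fin N) (Fin N) K} (ha : a ∈ M.B) (hb : b ∈ M.B) :
    a * b ∈ M.B := by
  obtain ⟨a, ha, rfl⟩ := ha
  obtain ⟨b, hb, rfl⟩ := hb
  exact ⟨a * b, mul_mem_borel ha hb, map_mul _ _ _⟩

theorem one_mem_B : (1 : Matrix (Fin N) (Fin N) K) ∈ M.B := ⟨1, one_mem_borel, map_one _⟩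

theorem diag_mem_B (t : Fin n → Kˣ) : M.ι (diagGL K n t) ∈ M.B := ⟨_, diagGL_mem_borel t, rfl⟩

/-! ### The classes of the elements `e w` and their order -/

namespace HasInitialType

variable {D : WeightDec M} {μ ν : Fin n → ℤ} {k : ℕ}

/-- The Bruhat order on `S_n` is reversed by `w ↦ e w`. -/
theorem mem_closure_of_permRk_le [Infinite K] (hD : HasInitialType D μ ν k)
    {v w : Equiv.Perm (Fin n)} (h : ∀ i j, permRk w i j ≤ permRk v i j) :
    D.idem ν * M.ι (permGL K n v) ∈
      zariskiClosure (orbitBB M.B (D.idem ν * M.ι (permGL K n w))) := by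
  intro q hq
  -- A polynomial vanishing on the orbit of `e w` is pulled back along `g ↦ e w₀ g`, with `w₀ =
  -- Fin.revPerm`. The pullback vanishes on `B w₀ w B`, whose closure contains `w₀ v`.
  obtain ⟨F, hF, d, hFd⟩ := exists_polynomial_pullback M
    (D.idem ν * M.ι (permGL K n Fin.revPerm)) q
  have hmem : (permGL K n (Fin.revPerm * v) : Matrix (Fin n) (Fin n) K) ∈
      zariskiClosure (orbitBB (borelMat K n) (rookMatrix K (Fin.revPerm * w).toPEquiv)) :=
    bruhatLE_rev_mul (K := K) h ⟨1, one_mem_borelMat, 1, one_mem_borelMat, by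
      rw [one_mul, mul_one]; rfl⟩
  have h0 : F (permGL K n (Fin.revPerm * v) : Matrix (Fin n) (Fin n) K) = 0 := by
    refine evalMat_eq_zero_of_mem_closure hmem hF ?_
    rintro _ ⟨_, ⟨b, hb, rfl⟩, _, ⟨b', hb', rfl⟩, rfl⟩
    have h1 : (b : Matrix (Fin n) (Fin n) K) * rookMatrix K (Fin.revPerm * w).toPEquiv *
        (b' : Matrix (Fin n) (Fin n) K) =
        ((b * permGL K n (Fin.revPerm * w) * b' : GL (Fin n) K) : Matrix (Fin n) (Fin n) K) := by
      rw [Units.val_mul, Units.val_mul, coe_permGL]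
    change F ((b : Matrix (Fin n) (Fin n) K) * rookMatrix K (Fin.revPerm * w).toPEquiv *
      (b' : Matrix (Fin n) (Fin n) K)) = 0
    rw [h1, ← hFd, hq, zero_mul]
    -- The matrix `w₀ b w₀` is lower triangular, so `e w₀ b w₀ = e t` for a torus element `t`.
    obtain ⟨t, ht⟩ := hD.isMax.mul_opposite_borel hD.mul_max
      (b := permGL K n Fin.revPerm * b * permGL K n Fin.revPerm) fun i j hij => by
        rw [permGL_rev_conj_apply]
        exact hb _ _ (Fin.rev_lt_rev.2 hij)
    refine ⟨_, diag_mem_B t, _, ⟨b', hb', rfl⟩, ?_⟩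
    rw [← mul_assoc, D.diag_mul_idem, ← ht]
    simp only [map_mul, mul_assoc]
  rw [← hFd, mul_eq_zero] at h0
  rcases h0 with h0 | h0
  · rwa [mul_assoc, ← map_mul, map_mul (permGL K n), ← mul_assoc, permGL_rev_mul_self,
      one_mul] at h0
  · exact absurd h0 (pow_ne_zero _ (det_ne_zero _))

theorem idem_mul_orbit [Infinite K] (hD : HasInitialType D μ ν k) {w : Equiv.Perm (Fin n)}
    {x : Matrix (Fin N) (Fin N) K} (hx : x ∈ orbitBB M.B (D.idem ν * M.ι (permGL K n w))) :
    ∃ b ∈ borel K n, x = D.idem ν * M.ι (permGL K n w * b) := by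
  obtain ⟨_, ⟨b, hb, rfl⟩, _, ⟨b', hb', rfl⟩, rfl⟩ := hx
  obtain ⟨t, -, ht⟩ := hD.borel_mul hb
  refine ⟨diagGL K n (t ∘ w) * b', mul_mem_borel (diagGL_mem_borel _) hb', ?_⟩
  rw [← mul_assoc (M.ι b), ht, mul_assoc (M.ι (diagGL K n t)), D.diag_mul_idem_mul_perm]
  simp only [map_mul, mul_assoc]

/-- Both triangular factors act on `e` through the torus, leaving `e t p e s`. If `p` moved a weight
`ψ` out of the face, `A ψ` would annihilate the invertible matrix from the left. -/
theorem inv_mem_fixLast_of_det_ne_zero [Infinite K] (hD : HasInitialType D μ ν k)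
    {b b' : GL (Fin n) K} (hb : ∀ i j, i < j → (b : Matrix (Fin n) (Fin n) K) i j = 0)
    (hb' : b' ∈ borel K n) {p : Equiv.Perm (Fin n)}
    (h : (D.idem ν * M.ι (b * permGL K n p * b') * D.idem ν + (1 - D.idem ν)).det ≠ 0) :
    p⁻¹ ∈ fixLast n (k + 1) := by
  apply hD.mem_fixLast_of_face
  intro ψ hψ
  rw [inv_inv]
  by_contra hn
  obtain ⟨t, ht⟩ := hD.isMax.mul_opposite_borel hD.mul_max hb
  obtain ⟨s, -, hs⟩ := hD.borel_mul hb'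
  set X := D.idem ν * M.ι (b * permGL K n p * b') * D.idem ν + (1 - D.idem ν) with hX
  have hψe : D.A ψ * D.idem ν = D.A ψ := by
    rw [WeightDec.idem, D.A_mul_proj, if_pos hψ]
  have hψp : D.A (ψ ∘ p) * D.idem ν = 0 := by
    rw [WeightDec.idem, D.A_mul_proj, if_neg hn]
  have hperm : D.A ψ * M.ι (permGL K n p) = M.ι (permGL K n p) * D.A (ψ ∘ p) := by
    rw [D.perm_mul_A, comp_perm_comp_inv]
  have h1 : D.idem ν * M.ι (b * permGL K n p * b') * D.idem ν =
      D.idem ν * M.ι (diagGL K n t) * M.ι (permGL K n p) * D.idem ν * M.ι (diagGL K n s) := by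
    rw [map_mul, map_mul, ← mul_assoc, ← mul_assoc, ht, mul_assoc _ (M.ι b'), hs,
      D.diag_mul_idem, ← mul_assoc]
  have hzero : D.A ψ * X = 0 := by
    rw [hX, mul_add, mul_sub, mul_one, hψe, sub_self, add_zero, h1]
    simp only [← mul_assoc]
    rw [hψe, D.mul_map_diag, Matrix.smul_mul, hperm, Matrix.smul_mul, mul_assoc _ (D.A _), hψp]
    simp
  have hunit : IsUnit X.det := isUnit_iff_ne_zero.2 h
  apply D.ne_zero ψ (D.face_subset ν hψ)
  rw [← mul_one (D.A ψ), ← Matrix.mul_nonsing_inv X hunit, ← mul_assoc, hzero, zero_mul]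

/-- The function `det (e x v⁻¹ e + 1 - e)` equals `1` at `x = e v`, so it is nonzero at some `x = e
w b` of the orbit. Decomposing `w b v⁻¹` by opposite Borel subgroups, the permutation part then lies
in `W_I`, the leading blocks of size `≥ k + 1` are regular, and corner ranks can be compared. -/
theorem cornerLE_of_mem_closure [Infinite K] (hD : HasInitialType D μ ν k)
    {v w : Equiv.Perm (Fin n)} (h : D.idem ν * M.ι (permGL K n v) ∈
      zariskiClosure (orbitBB M.B (D.idem ν * M.ι (permGL K n w)))) :
    CornerLE (k + 1) w v := by
  set e := D.idem ν with he
  have hee : e * e = e := D.idem_mul_self ν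
  let G : Matrix (Fin N) (Fin N) K → Matrix (Fin N) (Fin N) K := fun x =>
    e * x * (M.ι (permGL K n v)⁻¹ * e) + (1 - e)
  have hG : (fun x => (G x).det) ∈ polyFun K N := det_mem_polyFun G fun i j =>
    (polyFun K N).add_mem (mul_entry_mem_polyFun _ _ i j) (const_mem_polyFun ((1 - e) i j))
  have hGv : G (e * M.ι (permGL K n v)) = 1 := by
    have : e * (e * M.ι (permGL K n v)) * (M.ι (permGL K n v)⁻¹ * e) = e := by
      rw [← mul_assoc e e, hee, mul_assoc, ← mul_assoc (M.ι (permGL K n v)),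
        WeightDec.map_mul_inv, one_mul, hee]
    simp only [G]
    rw [this, add_sub_cancel]
  have hex : ∃ x ∈ orbitBB M.B (e * M.ι (permGL K n w)), (G x).det ≠ 0 := by
    by_contra hcon
    push Not at hcon
    have := evalMat_eq_zero_of_mem_closure h hG hcon
    rw [hGv, Matrix.det_one] at this
    exact one_ne_zero this
  obtain ⟨x, hx, hdet⟩ := hex
  obtain ⟨b, hb, rfl⟩ := hD.idem_mul_orbit hx
  obtain ⟨b₁, hb₁, hb₁', b₂, hb₂, p, hp⟩ :=
    exists_opposite_bruhat (permGL K n w * b * (permGL K n v)⁻¹)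
  have hpf : p⁻¹ ∈ fixLast n (k + 1) := by
    refine hD.inv_mem_fixLast_of_det_ne_zero hb₁ hb₂ ?_
    rw [← hp]
    convert hdet using 2
    simp only [G]
    rw [← he, ← mul_assoc e e, hee, map_mul _ _ (permGL K n v)⁻¹]
    simp only [mul_assoc]
  intro i j hi hj
  have hcard := card_le_of_mul_eq (v := v) (w := w) hb
    (C := permGL K n w * b * (permGL K n v)⁻¹) (by group) (j := i) (l := j) (by
      intro z hz hz'
      rw [hp] at hz'
      exact leading_block_injective hb₁' hb₂
        (fun a ha => (le_apply_iff_of_mem_fixLast hpf hi a).2 ha) hz hz')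
  have h1 := card_filter_val_lt i v j
  have h2 := card_filter_val_lt i w j
  omega

/-- Conjugates of `e v` under the normalizer of the torus. -/
theorem _root_.RookPutcha.WeightDec.exists_conj_eq [Infinite K] (D : WeightDec M)
    (ν : Fin n → ℤ) (v : Equiv.Perm (Fin n)) {g t : GL (Fin n) K} (hg : g ∈ torusNormalizer K n)
    (ht : t ∈ torus K n) :
    ∃ (σ : Equiv.Perm (Fin n)) (s : Fin n → Kˣ),
      M.ι g * (D.idem ν * M.ι (permGL K n v)) * M.ι g⁻¹ * M.ι t =
        M.ι (permGL K n σ) * (D.idem ν * M.ι (permGL K n (v * σ⁻¹))) * M.ι (diagGL K n s) := by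
  obtain ⟨σ, d, rfl⟩ := exists_eq_permGL_mul_diagGL hg
  obtain ⟨t, rfl⟩ := mem_torus_iff.1 ht
  refine ⟨σ, ((d ∘ v) * d⁻¹) ∘ ⇑σ⁻¹ * t, ?_⟩
  have h1 : permGL K n (v * σ⁻¹) * diagGL K n (((d ∘ v) * d⁻¹) ∘ ⇑σ⁻¹ * t) =
      diagGL K n d * permGL K n v * (permGL K n σ * diagGL K n d)⁻¹ * diagGL K n t := by
    rw [map_mul (diagGL K n), ← mul_assoc, map_mul (permGL K n) v, mul_assoc (permGL K n v),
      ← diagGL_mul_permGL, ← mul_assoc (permGL K n v), map_mul (diagGL K n),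
      ← mul_assoc (permGL K n v), ← diagGL_mul_permGL, _root_.mul_inv_rev, map_inv, map_inv]
    simp only [mul_assoc]
  calc _ = M.ι (permGL K n σ) * (M.ι (diagGL K n d) * D.idem ν) *
        (M.ι (permGL K n v) * M.ι (permGL K n σ * diagGL K n d)⁻¹ * M.ι (diagGL K n t)) := by
          simp only [map_mul, mul_assoc]
    _ = M.ι (permGL K n σ) * D.idem ν * M.ι (diagGL K n d * permGL K n v *
          (permGL K n σ * diagGL K n d)⁻¹ * diagGL K n t) := by
          rw [D.diag_mul_idem]
          simp only [map_mul, mul_assoc]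
    _ = _ := by
          rw [← h1]
          simp only [map_mul, mul_assoc]

theorem perm_mul_mul_diag [Infinite K] (hD : HasInitialType D μ ν k)
    {σ : Equiv.Perm (Fin n)} (hσ : σ ∈ fixLast n (k + 1)) (w : Equiv.Perm (Fin n))
    (s : Fin n → Kˣ) :
    ∃ s', M.ι (permGL K n σ) * (D.idem ν * M.ι (permGL K n w)) * M.ι (diagGL K n s) =
      D.idem ν * M.ι (permGL K n w) * M.ι (diagGL K n s') := by
  obtain ⟨t, ht⟩ := hD.perm_mul_of_mem_fixLast_mul_perm hσ w
  exact ⟨t * s, by rw [ht, map_mul, map_mul, mul_assoc]⟩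

/-- The class of `e w` in the Putcha poset. -/
def putchaClass [Infinite K] (hD : HasInitialType D μ ν k) (w : Equiv.Perm (Fin n)) :
    M.PutchaSubposet (D.idem ν) :=
  ⟨Quotient.mk M.conjSetoid ⟨_, hD.idem_mul_perm_mem w⟩, _, rfl, 1, one_mem _, permGL K n w,
    permGL_mem_torusNormalizer w, by simp⟩

theorem putchaClass_eq_of_eq [Infinite K] (hD : HasInitialType D μ ν k)
    {w : Equiv.Perm (Fin n)} (x : M.GJ) {s : Fin n → Kˣ}
    (h : x.1 = D.idem ν * M.ι (permGL K n w) * M.ι (diagGL K n s)) :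
    (hD.putchaClass w).1 = Quotient.mk M.conjSetoid x :=
  Quotient.sound ⟨1, one_mem _, diagGL K n s, diagGL_mem_torus s, by simpa using h⟩

/-- Up to the torus a Gauss–Jordan element of `W e W` is `σ e w`; the inclusion `B x ⊆ x B` forces
`σ` into `W_I`, and there it acts on `e` as a torus element. -/
theorem putchaClass_surjective [Infinite K] (hD : HasInitialType D μ ν k) :
    Function.Surjective hD.putchaClass := by
  rintro ⟨_, x, rfl, a, ha, b, hb, hx⟩
  obtain ⟨σ, d, rfl⟩ := exists_eq_permGL_mul_diagGL ha
  obtain ⟨w, s, rfl⟩ := exists_eq_permGL_mul_diagGL hb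
  have h1 : x.1 = M.ι (permGL K n σ) * (D.idem ν * M.ι (permGL K n w)) *
      M.ι (diagGL K n (d ∘ w * s)) := by
    rw [hx, map_mul M.ι, map_mul M.ι, map_mul (diagGL K n), map_mul M.ι]
    rw [← mul_assoc (M.ι (permGL K n σ) * _), mul_assoc (M.ι (permGL K n σ)) _ (M.ι (diagGL K n _)),
      ← D.diag_mul_idem_mul_perm]
    simp only [mul_assoc]
  have hσ : σ ∈ fixLast n (k + 1) := by
    refine hD.mem_fixLast_of_gaussJordan (g := permGL K n w * diagGL K n (d ∘ w * s)) ?_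
    have h2 := x.2.2
    have h3 : x.1 = M.ι (permGL K n σ) * D.idem ν * M.ι (permGL K n w * diagGL K n (d ∘ w * s)) := by
      rw [h1, map_mul M.ι (permGL K n w)]; simp only [mul_assoc]
    rwa [h3] at h2
  obtain ⟨s', hs'⟩ := hD.perm_mul_mul_diag hσ w (d ∘ w * s)
  exact ⟨w, Subtype.ext (hD.putchaClass_eq_of_eq x (h1.trans hs'))⟩

/-- The factor `u` commutes with `e` and becomes a torus element; `u'` is carried to the left by
conjugation and absorbed in the same way. -/
theorem putchaClass_mul_mul [Infinite K] (hD : HasInitialType D μ ν k)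
    (v : Equiv.Perm (Fin n)) {u u' : Equiv.Perm (Fin n)} (hu : u ∈ fixLast n (k + 1))
    (hu' : u' ∈ fixLast n (k + 1)) : hD.putchaClass (u * v * u') = hD.putchaClass v := by
  obtain ⟨hcomm, -⟩ := hD.perm_mul_of_mem_fixLast hu
  obtain ⟨s₁, h₁⟩ := hD.perm_mul_of_mem_fixLast_mul_perm hu (v * u')
  obtain ⟨s₂, h₂⟩ := hD.perm_mul_of_mem_fixLast_mul_perm (inv_mem hu') (v * u')
  have h₃ : D.idem ν * M.ι (permGL K n (u * v * u')) =
      D.idem ν * M.ι (permGL K n (v * u')) * M.ι (diagGL K n s₁) := by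
    rw [← h₁, ← mul_assoc, hcomm, mul_assoc u, map_mul (permGL K n) u, map_mul M.ι, mul_assoc]
  symm
  apply Subtype.ext
  refine Quotient.sound ⟨permGL K n u'⁻¹, permGL_mem_torusNormalizer _, diagGL K n (s₂⁻¹ * s₁),
    diagGL_mem_torus _, ?_⟩
  change D.idem ν * M.ι (permGL K n (u * v * u')) = _
  have h₄ : M.ι (permGL K n u'⁻¹) * (D.idem ν * M.ι (permGL K n v)) * M.ι (permGL K n u'⁻¹)⁻¹ =
      D.idem ν * M.ι (permGL K n (v * u')) * M.ι (diagGL K n s₂) := by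
    rw [← h₂, map_inv, inv_inv, map_mul, map_mul]
    simp only [mul_assoc]
  rw [h₃]
  change _ = M.ι (permGL K n u'⁻¹) * (D.idem ν * M.ι (permGL K n v)) * M.ι (permGL K n u'⁻¹)⁻¹ *
    M.ι (diagGL K n (s₂⁻¹ * s₁))
  rw [h₄, mul_assoc _ (M.ι (diagGL K n s₂)), ← map_mul, ← map_mul, mul_inv_cancel_left]

/-- All matrices in question are of the form `σ e v σ⁻¹` up to the torus. For the larger element `σ`
lies in `W_I` because it is Gauss–Jordan; for the smaller one because the closure of `e w B` is
absorbed by `e`. Both reduce to elements `e v`. -/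
theorem cornerLE_of_putchaClass_le [Infinite K] (hD : HasInitialType D μ ν k)
    {v w : Equiv.Perm (Fin n)} (h : hD.putchaClass v ≤ hD.putchaClass w) :
    CornerLE (k + 1) w v := by
  obtain ⟨x, y, hx, hy, g, hg, hle⟩ := h
  obtain ⟨g₁, hg₁, t₁, ht₁, hx⟩ := Quotient.exact hx.symm
  obtain ⟨g₂, hg₂, t₂, ht₂, hy⟩ := Quotient.exact hy.symm
  change x.1 = M.ι g₁ * (D.idem ν * M.ι (permGL K n v)) * M.ι g₁⁻¹ * M.ι t₁ at hx
  change y.1 = M.ι g₂ * (D.idem ν * M.ι (permGL K n w)) * M.ι g₂⁻¹ * M.ι t₂ at hy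
  obtain ⟨σ₂, s₂, h₂⟩ := D.exists_conj_eq ν w hg₂ ht₂
  obtain ⟨σ, s, h₁⟩ := D.exists_conj_eq ν v (mul_mem hg hg₁) ((hg t₁).1 ht₁)
  have hz : M.ι g * x.1 * M.ι g⁻¹ =
      M.ι (permGL K n σ) * (D.idem ν * M.ι (permGL K n (v * σ⁻¹))) * M.ι (diagGL K n s) := by
    have h3 : g₁⁻¹ * (t₁ * g⁻¹) = (g * g₁)⁻¹ * (g * t₁ * g⁻¹) := by group
    rw [← h₁, hx, mul_assoc _ (M.ι (g * g₁)⁻¹), ← map_mul M.ι (g * g₁)⁻¹, ← h3]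
    simp only [map_mul, mul_assoc]
  have hσ₂ : σ₂ ∈ fixLast n (k + 1) := by
    refine hD.mem_fixLast_of_gaussJordan (g := permGL K n (w * σ₂⁻¹) * diagGL K n s₂) ?_
    have h3 := y.2.2
    have h4 : y.1 = M.ι (permGL K n σ₂) * D.idem ν *
        M.ι (permGL K n (w * σ₂⁻¹) * diagGL K n s₂) := by
      rw [hy, h₂, map_mul M.ι (permGL K n (w * σ₂⁻¹))]; simp only [mul_assoc]
    rwa [h4] at h3
  obtain ⟨s₃, h₃⟩ := hD.perm_mul_mul_diag hσ₂ (w * σ₂⁻¹) s₂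
  have hyw := hy.trans (h₂.trans h₃)
  have horb : ∀ z ∈ orbitBB M.B y.1,
      z ∈ orbitBB M.B (D.idem ν * M.ι (permGL K n (w * σ₂⁻¹))) := by
    rintro _ ⟨b, hb, b', hb', rfl⟩
    exact ⟨b, hb, _, mul_mem_B (diag_mem_B s₃) hb', by rw [hyw]; simp only [mul_assoc]⟩
  have hmem : M.ι g * x.1 * M.ι g⁻¹ ∈ zariskiClosure (orbitBB M.B y.1) :=
    hle ⟨1, one_mem_B, 1, one_mem_B, by simp⟩
  have hσ : σ ∈ fixLast n (k + 1) := by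
    apply hD.mem_fixLast_of_absorb
    have h3 := mul_eq_of_mem_closure (m := Fin N) hmem (D.idem ν) 1 1 1 fun z hz => by
      obtain ⟨b, -, rfl⟩ := hD.idem_mul_orbit (horb z hz)
      rw [← mul_assoc (D.idem ν), D.idem_mul_self, one_mul]
    rw [mul_one, mul_one, one_mul, hz] at h3
    have h4 := congrArg (· * M.ι (permGL K n (v * σ⁻¹) * diagGL K n s)⁻¹) h3
    have h5 : ∀ X : Matrix (Fin N) (Fin N) K, X * M.ι (permGL K n (v * σ⁻¹)) * M.ι (diagGL K n s) *
        M.ι (permGL K n (v * σ⁻¹) * diagGL K n s)⁻¹ = X := fun X => by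
      rw [mul_assoc X, ← map_mul, mul_assoc, WeightDec.map_mul_inv, mul_one]
    simp only [← mul_assoc, h5] at h4
    exact h4
  obtain ⟨s₄, h₄⟩ := hD.perm_mul_mul_diag hσ (v * σ⁻¹) s
  have hmem' : D.idem ν * M.ι (permGL K n (v * σ⁻¹)) ∈
      zariskiClosure (orbitBB M.B (D.idem ν * M.ι (permGL K n (w * σ₂⁻¹)))) := by
    have h3 := mul_mem_closure (Y := orbitBB M.B (D.idem ν * M.ι (permGL K n (w * σ₂⁻¹)))) hmem 1
      (M.ι (diagGL K n s₄⁻¹)) fun z hz' => by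
        obtain ⟨b, hb, b', hb', rfl⟩ := horb z hz'
        exact subset_zariskiClosure _ ⟨b, hb, _, mul_mem_B hb' (diag_mem_B s₄⁻¹), by
          rw [one_mul]; simp only [mul_assoc]⟩
    rwa [hz, h₄, one_mul, mul_assoc, ← map_mul, ← map_mul, mul_inv_cancel, map_one, map_one,
      mul_one] at h3
  have hcorner := hD.cornerLE_of_mem_closure hmem'
  intro i j hi hj
  have h5 := permRk_mul_mul (one_mem _) (inv_mem hσ₂) w hi hj
  have h6 := permRk_mul_mul (one_mem _) (inv_mem hσ) v hi hj
  rw [one_mul] at h5 h6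
  rw [← h5, ← h6]
  exact hcorner i j hi hj

theorem putchaClass_le_iff [Infinite K] (hD : HasInitialType D μ ν k) (hk : k + 1 ≤ n)
    (v w : Equiv.Perm (Fin n)) :
    hD.putchaClass v ≤ hD.putchaClass w ↔ CornerLE (k + 1) w v := by
  refine ⟨hD.cornerLE_of_putchaClass_le, fun h => ?_⟩
  -- Corner ranks control all ranks only for a dominating representative, so `v` is replaced by one
  -- in its double coset.
  obtain ⟨u, hu, u', hu', hdom⟩ := exists_dominating hk v
  rw [← hD.putchaClass_mul_mul v hu hu']
  refine ⟨_, _, rfl, rfl, 1, one_mem _, ?_⟩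
  refine bcrLE_of_mem (fun a ha b hb => mul_mem_B ha hb) ?_
  simpa using hD.mem_closure_of_permRk_le (hdom w h)

end HasInitialType

end RookPutcha

end

theorem mainTheorem2 {K : Type*} [Field K] [IsAlgClosed K] (n k r : ℕ)
    (h : (n = 2 * r ∧ k + 1 = r) ∨ (n = 2 * r + 1 ∧ k = r) ∨ (n / 2 ≤ k ∧ n = k + 1 + r)) :
    Nonempty ((RookPutcha.DoubleCosets K (RookPutcha.firstSimple n k))ᵒᵈ ≃o
        RookPutcha.RookMonoid K r) ∧
    ∀ (N : ℕ) (M : RookPutcha.ReductiveMonoid K n N), M.IsDualCanonical →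
      (∃! e, e ∈ M.Λ ∧ e ≠ 1 ∧ M.typeMap e = RookPutcha.firstSimple n k) ∧
      ∀ e, e ∈ M.Λ → e ≠ 1 → M.typeMap e = RookPutcha.firstSimple n k →
        Nonempty (M.PutchaSubposet e ≃o RookPutcha.RookMonoid K r) := by
  -- All three cases amount to `n = k + 1 + r` with at least `r` indices moved by `W_I` or standing
  -- before the block, that is, `r ≤ k + 1`.
  obtain ⟨rfl, hr⟩ : n = k + 1 + r ∧ r ≤ k + 1 := by omega
  refine ⟨RookPutcha.doubleCosets_orderIso hr, fun N M hM => ?_⟩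
  obtain ⟨D⟩ := RookPutcha.nonempty_weightDec M
  obtain ⟨μ, hμ⟩ := RookPutcha.exists_isMaxCocharacter D hM
  constructor
  · obtain ⟨e, he, he1, hek⟩ := hμ.exists_of_type k
    exact ⟨e, ⟨he, he1, hek⟩, fun f hf => hμ.idem_eq_of_type hf.1 hf.2.1 hf.2.2 he he1 hek⟩
  · intro e he he1 hek
    obtain ⟨ν, rfl, hD⟩ := hμ.hasInitialType he he1 hek
    exact RookPutcha.nonempty_orderIso_rookMonoid hr hD.putchaClass hD.putchaClass_surjective
      (hD.putchaClass_le_iff (by omega)) fun v u hu u' hu' => hD.putchaClass_mul_mul v hu hu'
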